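/- **Setting.** Let $\delta=1/k$ with an integer $k\ge 8$, let $\ell\in\{3,4,5\}$, and put $$\xi=\lceil \ell\log_{1+\delta}\tfrac1\delta\rceil,\quad y=\tfrac{\xi}{\delta^{\ell+1}}-\xi-1,\quad \gamma=\tfrac{\delta^{12}}{(1+\delta)^y},\quad g=-\left(\tfrac1\delta\right)^{1/\delta^{300}},\quad f=g-\tfrac{2}{\delta^2}.$$ A *bounded instance* consists of $n$ jobs and $m$ machines. Job $j$ has size $p_j=(1+\delta)^{a_j}$, $a_j\in\mathbb Z$, and density $w_j/p_j=(1+\delta)^{r_j}$, $r_j\in\{0,\dots,y\}$, where $w_j$ is its weight. Machine $q$ has speed $s_q=(1+\delta)^{-e_q}$, $e_q\in\mathbb Z_{\ge0}$, and some machine has speed $1$. A *schedule* is an assignment of jobs to machines; every machine processes its jobs without idle time from time $0$ in the natural ordering (larger density first, then larger size, then smaller index), and the *cost* is $\sum_j w_jC_j$, where the completion time $C_j$ is the total size of $j$ and of the jobs that precede it on its machine, divided by the speed of that machine. Let $\mathcal I=\{a_j\}$, and let $n_{r,i}$ be the number of jobs of density $(1+\delta)^r$ and size $(1+\delta)^i$.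 **Configurations.** A configuration $C$ consists of integers $j_1,j_2$ and non-negative integers $n_{r,i}(C)$ ($0\le r\le y$, $i\in\mathcal I$) and $t_r(C)$ ($0\le r\le y$). With $U=U(C)=\gamma(1+\delta)^{j_1-1}$, $\mathcal I(C)=\{i\in\mathcal I: j_1-1+\lceil\log_{1+\delta}\gamma\rceil\le i\le j_1\}$ and $\mathcal I'(C)=\{i\in\mathcal I: i\le j_1-2+\lceil\log_{1+\delta}\gamma\rceil\}$, the set $\mathcal C$ consists of the $C$ such that: $j_1=\lceil\log_{1+\delta}\sum_{j\in S}p_j\rceil$ for some non-empty set $S$ of jobs; $(1+\delta)^{j_2}$ is the speed of some machine; $n_{r,i}(C)=0$ for $i\notin\mathcal I(C)$; $\sum_{r,i}(1+\delta)^in_{r,i}(C)+\sum_rt_r(C)U\in((1+\delta)^{j_1-2},(1+\delta)^{j_1}]$; and $(1+\delta)^{j_1-j_2-2}<2/\delta$. The set $\mathcal C$ is finite. The number $cost(C)$ is the total cost of the following on one machine of speed $s=(1+\delta)^{j_2}$ that runs everything in the natural ordering: $n_{r,i}(C)$ (large) jobs of size $(1+\delta)^i$ and density $(1+\delta)^r$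 for all $r,i$, each contributing its weighted completion time, and, for each $r$, after the large jobs of density $(1+\delta)^r$, a block of small jobs of density $\Delta=(1+\delta)^r$ and total size $T=t_r(C)U$, contributing $\Delta(\tau+\frac{T}{2s})T$, where $\tau$ is the time at which the block starts. **The program $\Pi$.** In real variables $X_C$ ($C\in\mathcal C$) and $Y_{r,i,C}$ ($0\le r\le y$, $i\in\mathcal I$, $C\in\mathcal C$; $Y_{r,i,C}=0$ if $i\notin\mathcal I'(C)$), minimize $$\sum_{C}cost(C)X_C+\sum_{r=0}^y\sum_{i\in\mathcal I}(1+\delta)^{r+2i}\sum_C\frac{Y_{r,i,C}}{2(1+\delta)^{j_2(C)}}$$ subject to $X,Y\ge0$ and - $\sum_{C:(1+\delta)^{j_2(C)}=\sigma}X_C\le N_\sigma$ for every machine speed $\sigma$, where $N_\sigma$ is the number of machines of speed $\sigma$; - $\sum_Cn_{r,i}(C)X_C+\sum_CY_{r,i,C}=n_{r,i}$ for all $r,i$; - $\sum_{i\in\mathcal I'(C)}(1+\delta)^iY_{r,i,C}\le(t_r(C)+1)\,U(C)\,X_C$ for all $r,C$; - $\sum_{C:\,j_1(C)\in\{-1,0\},\,j_2(C)=0}X_C\ge1$;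 - $X_C\in\mathbb Z$ for every $C$ with $j_1(C)>g$ and $j_2(C)>f$. **Theorem.** Let $(X^*,Y^*)$ be an optimal solution of $\Pi$, and let $Z^*$ be its objective value. There exists a schedule whose cost is at most $(1+\delta)Z^*$, and such a schedule can be constructed in polynomial time from $(X^*,Y^*)$. Here the last part means: there are one algorithm and one polynomial $P$ such that for all $k,\ell$ as above, every bounded instance and every rational optimal solution $(X^*,Y^*)$ of $\Pi$, the algorithm, given the instance and the solution (the rows of a list of distinct configurations that contains all $C$ with $X^*_C\ne0$; each row consists of the entries of $C$ and of the values $X^*_C$, $Y^*_{r,i,C}$ for all $r,i$; sizes, densities and speeds are given by their exponents), outputs a schedule of cost at most $(1+\delta)Z^*$ in time at most $P(N)$, where $N$ is the length of this input in binary. Time is measured on a random access machine with the operations $+$, truncated $-$, $\times$, integer division and logarithmic (bit-length) cost. -/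

import Mathlib

namespace WeightedScheduling

noncomputable section

/-! ### A random access machine with logarithmic cost

Structured programs over finitely many registers and an indexed memory, both holding natural
numbers.  Every evaluated operation is charged one unit plus the binary length of the number it
produces, so that numbers, operands and addresses are all paid for by their length in bits. -/

/-- Expressions; `cell e` is the content of the memory cell whose address is `e`. -/
inductive Expr where
  | lit (c : ℕ)
  | reg (x : ℕ)
  | cell (e : Expr)
  | add (e₁ e₂ : Expr)
  | sub (e₁ e₂ : Expr)
  | mul (e₁ e₂ : Expr)
  | div (e₁ e₂ : Expr)

/-- The contents of the registers and of the memory. -/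
structure State where
  reg : ℕ → ℕ
  mem : ℕ → ℕ

/-- The value of an expression (truncated subtraction, integer division). -/
def Expr.eval (s : State) : Expr → ℕ
  | .lit c => c
  | .reg x => s.reg x
  | .cell e => s.mem (e.eval s)
  | .add e₁ e₂ => e₁.eval s + e₂.eval s
  | .sub e₁ e₂ => e₁.eval s - e₂.eval s
  | .mul e₁ e₂ => e₁.eval s * e₂.eval s
  | .div e₁ e₂ => e₁.eval s / e₂.eval s

/-- The logarithmic cost of evaluating an expression. -/
def Expr.cost (s : State) : Expr → ℕ
  | .lit c => 1 + Nat.size c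
  | .reg x => 1 + Nat.size (s.reg x)
  | .cell e => 1 + Nat.size (s.mem (e.eval s)) + e.cost s
  | .add e₁ e₂ => 1 + Nat.size (e₁.eval s + e₂.eval s) + e₁.cost s + e₂.cost s
  | .sub e₁ e₂ => 1 + Nat.size (e₁.eval s - e₂.eval s) + e₁.cost s + e₂.cost s
  | .mul e₁ e₂ => 1 + Nat.size (e₁.eval s * e₂.eval s) + e₁.cost s + e₂.cost s
  | .div e₁ e₂ => 1 + Nat.size (e₁.eval s / e₂.eval s) + e₁.cost s + e₂.cost s

/-- Programs. -/
inductive Prog where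
  | skip
  | set (x : ℕ) (e : Expr)
  | store (a e : Expr)
  | seq (c₁ c₂ : Prog)
  | ite (e : Expr) (c₁ c₂ : Prog)
  | loop (e : Expr) (c : Prog)

/-- `Exec c s t s'`: the program `c`, started in state `s`, halts in state `s'` after a run of
total cost `t`.  Conditions are true when they are nonzero, and `loop e c` is `while e do c`. -/
inductive Exec : Prog → State → ℕ → State → Prop where
  | skip (s : State) : Exec .skip s 1 s
  | set (x : ℕ) (e : Expr) (s : State) :
      Exec (.set x e) s (1 + e.cost s) ⟨Function.update s.reg x (e.eval s), s.mem⟩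
  | store (a e : Expr) (s : State) :
      Exec (.store a e) s (1 + a.cost s + e.cost s)
        ⟨s.reg, Function.update s.mem (a.eval s) (e.eval s)⟩
  | seq {c₁ c₂ : Prog} {s s' s'' : State} {t t' : ℕ} :
      Exec c₁ s t s' → Exec c₂ s' t' s'' → Exec (.seq c₁ c₂) s (1 + t + t') s''
  | iteTrue {e : Expr} {c₁ c₂ : Prog} {s s' : State} {t : ℕ} :
      e.eval s ≠ 0 → Exec c₁ s t s' → Exec (.ite e c₁ c₂) s (1 + e.cost s + t) s'
  | iteFalse {e : Expr} {c₁ c₂ : Prog} {s s' : State} {t : ℕ} :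
      e.eval s = 0 → Exec c₂ s t s' → Exec (.ite e c₁ c₂) s (1 + e.cost s + t) s'
  | loopTrue {e : Expr} {c : Prog} {s s' s'' : State} {t t' : ℕ} :
      e.eval s ≠ 0 → Exec c s t s' → Exec (.loop e c) s' t' s'' →
        Exec (.loop e c) s (1 + e.cost s + t + t') s''
  | loopFalse {e : Expr} {c : Prog} {s : State} :
      e.eval s = 0 → Exec (.loop e c) s (1 + e.cost s) s

/-- The initial state for an input: the input stands in memory from address `0` on, register `0`
holds the number of its entries, and everything else is `0`. -/
def initState (input : List ℕ) : State where
  reg := fun x => if x = 0 then input.length else 0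
  mem := fun a => input.getD a 0

/-- The length of an input in bits (with one separator per entry). -/
def bitLength (input : List ℕ) : ℕ := (input.map fun a => Nat.size a + 1).sum

/-! ### Parameters; throughout, `k = 1/δ` -/

/-- The accuracy `δ = 1/k`. -/
def delta (k : ℕ) : ℝ := 1 / (k : ℝ)

/-- `1 + δ`. -/
def base (k : ℕ) : ℝ := 1 + delta k

/-- `ξ = ⌈ℓ log_{1+δ} (1/δ)⌉`. -/
def xi (k ℓ : ℕ) : ℕ := ⌈(ℓ : ℝ) * Real.logb (base k) (1 / delta k)⌉₊

/-- `y = ξ/δ^(ℓ+1) - ξ - 1`; the subtraction does not truncate when `k ≥ 2`. -/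
def yExp (k ℓ : ℕ) : ℕ := xi k ℓ * k ^ (ℓ + 1) - xi k ℓ - 1

/-- `γ = δ^12 / (1+δ)^y`. -/
def gam (k ℓ : ℕ) : ℝ := delta k ^ 12 / base k ^ yExp k ℓ

/-- `⌈log_{1+δ} γ⌉`. -/
def gamExp (k ℓ : ℕ) : ℤ := ⌈Real.logb (base k) (gam k ℓ)⌉

/-- `g(δ) = -(1/δ)^(1/δ^300)`: work above `(1+δ)^g` is heavy. -/
def gExp (k : ℕ) : ℤ := -((k : ℤ) ^ (k ^ 300))

/-- `f(δ) = g(δ) - 2/δ^2`: speed at most `(1+δ)^f` is slow. -/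
def fExp (k : ℕ) : ℤ := gExp k - 2 * (k : ℤ) ^ 2

/-! ### Bounded instances and schedules -/

/-- A rounded and scaled instance: job `j` has size `(1+δ)^(sizeExp j)` and density
`(1+δ)^(densExp j)` with `0 ≤ densExp j ≤ y`; machine `q` has speed `(1+δ)^(-slowExp q)`, and the
fastest machines have speed `1`. -/
structure BoundedInstance (k ℓ : ℕ) where
  n : ℕ
  m : ℕ
  sizeExp : Fin n → ℤ
  densExp : Fin n → Fin (yExp k ℓ + 1)
  slowExp : Fin m → ℕ
  fastest : ∃ q, slowExp q = 0

namespace BoundedInstance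

variable {k ℓ : ℕ} (I : BoundedInstance k ℓ)

/-- The size of a job. -/
def p (j : Fin I.n) : ℝ := base k ^ I.sizeExp j

/-- The weight of a job: its density times its size. -/
def w (j : Fin I.n) : ℝ := base k ^ ((I.densExp j : ℕ) : ℤ) * I.p j

/-- The speed of a machine. -/
def speed (q : Fin I.m) : ℝ := base k ^ (-(I.slowExp q : ℤ))

/-- A schedule is an assignment of jobs to machines: every machine runs its jobs from time `0`
on, without idle time and in the natural ordering. -/
abbrev Schedule : Type := Fin I.n → Fin I.m

/-- The (reflexive) natural ordering: larger density first, then larger size, then smaller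
index. -/
def RunsBefore (j' j : Fin I.n) : Prop :=
  I.densExp j < I.densExp j' ∨ (I.densExp j = I.densExp j' ∧
    (I.sizeExp j < I.sizeExp j' ∨ (I.sizeExp j = I.sizeExp j' ∧ j' ≤ j)))

open Classical in
/-- The completion time of a job. -/
def completion (σ : I.Schedule) (j : Fin I.n) : ℝ :=
  (∑ j' with σ j' = σ j ∧ I.RunsBefore j' j, I.p j') / I.speed (σ j)

/-- The total weighted completion time. -/
def schedCost (σ : I.Schedule) : ℝ := ∑ j, I.w j * I.completion σ j

/-- The set of all `i` such that there is a job of size `(1+δ)^i`. -/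
def sizes : Finset ℤ := Finset.univ.image I.sizeExp

/-- The number of jobs of density `(1+δ)^r` and size `(1+δ)^i`. -/
def jobCount (r : Fin (yExp k ℓ + 1)) (i : ℤ) : ℕ :=
  (Finset.univ.filter fun j => I.densExp j = r ∧ I.sizeExp j = i).card

end BoundedInstance

/-! ### Configurations -/

/-- A configuration vector: `j1` is the rounded logarithm of the work, `j2` the logarithm of the
speed, `large r i` the number of large jobs of density `(1+δ)^r` and size `(1+δ)^i`, and
`t r` the number of units of length `U` reserved for small jobs of density `(1+δ)^r`. -/
@[ext] structure Config {k ℓ : ℕ} (I : BoundedInstance k ℓ) where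
  j1 : ℤ
  j2 : ℤ
  large : Fin (yExp k ℓ + 1) → I.sizes → ℕ
  t : Fin (yExp k ℓ + 1) → ℕ

namespace Config

variable {k ℓ : ℕ} {I : BoundedInstance k ℓ} (C : Config I)

/-- The third component, the rounded logarithm of the load. -/
def j3 : ℤ := C.j1 - C.j2

/-- The speed of a machine with this configuration. -/
def speed : ℝ := base k ^ C.j2

/-- `U(C) = γ (1+δ)^(j1-1)`. -/
def U : ℝ := gam k ℓ * base k ^ (C.j1 - 1)

/-- Jobs of size `(1+δ)^i` are large for the configuration. -/
def IsLargeExp (i : ℤ) : Prop := C.j1 - 1 + gamExp k ℓ ≤ i ∧ i ≤ C.j1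

/-- Jobs of size `(1+δ)^i` are small for the configuration. -/
def IsSmallExp (i : ℤ) : Prop := i ≤ C.j1 - 2 + gamExp k ℓ

/-- Total size of the large jobs of density `(1+δ)^r`. -/
def largeWork (r : Fin (yExp k ℓ + 1)) : ℝ := ∑ i : I.sizes, base k ^ (i : ℤ) * (C.large r i : ℝ)

/-- Total size reserved for the small jobs of density `(1+δ)^r`. -/
def smallWork (r : Fin (yExp k ℓ + 1)) : ℝ := (C.t r : ℝ) * C.U

/-- Total size of the configuration. -/
def work : ℝ := ∑ r, (C.largeWork r + C.smallWork r)

/-- Validity.  The possible first components are the rounded logarithms of the total sizes of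
sets of jobs, and the possible second ones are those of the speeds of machines. -/
structure IsValid : Prop where
  j1_mem : ∃ S : Finset (Fin I.n), S.Nonempty ∧ C.j1 = ⌈Real.logb (base k) (∑ j ∈ S, I.p j)⌉
  j2_mem : ∃ q, C.j2 = -(I.slowExp q : ℤ)
  large_eq_zero : ∀ r (i : I.sizes), ¬ C.IsLargeExp i → C.large r i = 0
  work_gt : base k ^ (C.j1 - 2) < C.work
  work_le : C.work ≤ base k ^ C.j1
  load_lt : base k ^ (C.j3 - 2) < 2 / delta k

/-- The time at which the first job of density `(1+δ)^r` starts in the natural ordering. -/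
def densStart (r : Fin (yExp k ℓ + 1)) : ℝ :=
  (∑ r' : Fin (yExp k ℓ + 1) with r < r', (C.largeWork r' + C.smallWork r')) / C.speed

/-- The time at which the first large job of density `(1+δ)^r` and size `(1+δ)^i` starts. -/
def largeStart (r : Fin (yExp k ℓ + 1)) (i : I.sizes) : ℝ :=
  C.densStart r + (∑ i' : I.sizes with i < i', base k ^ (i' : ℤ) * (C.large r i' : ℝ)) / C.speed

/-- The time at which the block of small jobs of density `(1+δ)^r` starts. -/
def smallStart (r : Fin (yExp k ℓ + 1)) : ℝ := C.densStart r + C.largeWork r / C.speed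

/-- The `U`-cost of a configuration for `U = U(C)`: the weighted completion times of the large
jobs plus the sum of `w_j (C_j - p_j / (2s))` over the small jobs.  For a block of small jobs of
total size `T` and common density `Δ` that starts at time `τ` on a machine of speed `s` the latter
sum is `Δ (τ + T / (2s)) T`, however the block is divided into jobs. -/
def cost : ℝ :=
  (∑ r : Fin (yExp k ℓ + 1), ∑ i : I.sizes, ∑ q ∈ Finset.range (C.large r i),
    base k ^ ((i : ℤ) + (r : ℕ)) * (C.largeStart r i + ((q : ℝ) + 1) * base k ^ (i : ℤ) / C.speed))
  + ∑ r : Fin (yExp k ℓ + 1), base k ^ (r : ℕ) * (C.smallStart r + C.smallWork r / (2 * C.speed)) * C.smallWork r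

end Config

theorem base_pos (k : ℕ) : 0 < base k := by
  unfold base delta; positivity

theorem delta_nonneg (k : ℕ) : 0 ≤ delta k := by
  unfold delta; positivity

theorem gam_nonneg (k ℓ : ℕ) : 0 ≤ gam k ℓ :=
  div_nonneg (pow_nonneg (delta_nonneg k) _) (pow_nonneg (base_pos k).le _)

theorem gam_pos {k : ℕ} (hk : 0 < k) (ℓ : ℕ) : 0 < gam k ℓ := by
  have hd : 0 < delta k := by unfold delta; positivity
  exact div_pos (pow_pos hd _) (pow_pos (base_pos k) _)

theorem Config.U_nonneg {k ℓ : ℕ} {I : BoundedInstance k ℓ} (C : Config I) : 0 ≤ C.U :=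
  mul_nonneg (gam_nonneg k ℓ) (zpow_pos (base_pos k) _).le

/-- There are finitely many valid configurations. -/
theorem finite_valid {k ℓ : ℕ} (I : BoundedInstance k ℓ) :
    {C : Config I | C.IsValid}.Finite := by
  classical
  rcases Nat.eq_zero_or_pos k with hk | hk
  · have : {C : Config I | C.IsValid} = ∅ := by
      ext C
      simp only [Set.mem_ofPred_eq, Set.mem_empty_iff_false, iff_false]
      intro h
      have h1 := h.load_lt
      have h2 : (0 : ℝ) < base k ^ (C.j3 - 2) := zpow_pos (base_pos k) _
      simp [delta, hk] at h1 h2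
      linarith
    rw [this]; exact Set.finite_empty
  let A : Set ℤ := Set.range fun S : Finset (Fin I.n) => ⌈Real.logb (base k) (∑ j ∈ S, I.p j)⌉
  let B : Set ℤ := Set.range fun q => -(I.slowExp q : ℤ)
  have hA : A.Finite := Set.finite_range _
  have hB : B.Finite := Set.finite_range _
  let bl : ℤ → Fin (yExp k ℓ + 1) → I.sizes → ℕ := fun a _ i =>
    ⌊base k ^ a / base k ^ (i : ℤ)⌋₊
  let bt : ℤ → Fin (yExp k ℓ + 1) → ℕ := fun a _ =>
    ⌊base k ^ a / (gam k ℓ * base k ^ (a - 1))⌋₊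
  have hfin : (⋃ a ∈ A, ⋃ b ∈ B, (fun x : (Fin (yExp k ℓ + 1) → I.sizes → ℕ) ×
      (Fin (yExp k ℓ + 1) → ℕ) => (⟨a, b, x.1, x.2⟩ : Config I)) ''
        Set.Icc (0, 0) (bl a, bt a)).Finite :=
    hA.biUnion fun a _ => hB.biUnion fun b _ => (Set.finite_Icc _ _).image _
  refine hfin.subset ?_
  intro C hC
  have hl0 : ∀ r, 0 ≤ C.largeWork r := fun r =>
    Finset.sum_nonneg fun i _ => mul_nonneg (zpow_pos (base_pos k) _).le (Nat.cast_nonneg _)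
  have hs0 : ∀ r, 0 ≤ C.smallWork r := fun r => mul_nonneg (Nat.cast_nonneg _) C.U_nonneg
  have hr : ∀ r, C.largeWork r + C.smallWork r ≤ base k ^ C.j1 := fun r =>
    (Finset.single_le_sum (f := fun r => C.largeWork r + C.smallWork r)
      (fun r _ => add_nonneg (hl0 r) (hs0 r)) (Finset.mem_univ r)).trans hC.work_le
  simp only [Set.mem_iUnion, exists_prop]
  obtain ⟨S, -, hS⟩ := hC.j1_mem
  obtain ⟨q, hq⟩ := hC.j2_mem
  refine ⟨C.j1, ⟨S, hS.symm⟩, C.j2, ⟨q, hq.symm⟩, (C.large, C.t), ⟨⟨?_, ?_⟩, ⟨?_, ?_⟩⟩, rfl⟩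
  · intro r i; exact Nat.zero_le _
  · intro r; exact Nat.zero_le _
  · intro r i
    refine Nat.le_floor ?_
    rw [le_div_iff₀ (zpow_pos (base_pos k) _), mul_comm]
    refine le_trans ?_ (le_trans (le_add_of_nonneg_right (hs0 r)) (hr r))
    exact Finset.single_le_sum (f := fun i : I.sizes => base k ^ (i : ℤ) * (C.large r i : ℝ))
      (fun i _ => mul_nonneg (zpow_pos (base_pos k) _).le (Nat.cast_nonneg _)) (Finset.mem_univ i)
  · intro r
    refine Nat.le_floor ?_
    rw [le_div_iff₀ (mul_pos (gam_pos hk ℓ) (zpow_pos (base_pos k) _))]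
    exact le_trans (le_add_of_nonneg_left (hl0 r)) (hr r)

/-- The set of all (valid) configurations. -/
def configs {k ℓ : ℕ} (I : BoundedInstance k ℓ) : Finset (Config I) := (finite_valid I).toFinset

/-! ### The mixed integer linear program -/

section MILP

variable {k ℓ : ℕ} (I : BoundedInstance k ℓ)
  (X : Config I → ℝ) (Y : Fin (yExp k ℓ + 1) → I.sizes → Config I → ℝ)

/-- The objective function. -/
def objective : ℝ :=
  (∑ C ∈ configs I, C.cost * X C)
  + ∑ r : Fin (yExp k ℓ + 1), ∑ i : I.sizes, base k ^ (((r : ℕ) : ℤ) + 2 * (i : ℤ)) *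
      ∑ C ∈ configs I, Y r i C / (2 * base k ^ C.j2)

open Classical in
/-- Feasible solutions.  Only the values at configurations in `configs I` matter. -/
structure IsFeasible : Prop where
  machines : ∀ q : Fin I.m,
    ∑ C ∈ configs I with C.j2 = -(I.slowExp q : ℤ), X C
      ≤ ((Finset.univ.filter fun q' => I.slowExp q' = I.slowExp q).card : ℝ)
  jobs : ∀ (r : Fin (yExp k ℓ + 1)) (i : I.sizes),
    ∑ C ∈ configs I, (C.large r i : ℝ) * X C + ∑ C ∈ configs I, Y r i C = (I.jobCount r i : ℝ)
  space : ∀ (r : Fin (yExp k ℓ + 1)), ∀ C ∈ configs I,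
    ∑ i ∈ Finset.univ.filter (fun i : I.sizes => C.IsSmallExp (i : ℤ)), base k ^ (i : ℤ) * Y r i C ≤ ((C.t r : ℝ) + 1) * C.U * X C
  fastest : 1 ≤ ∑ C ∈ configs I with (C.j1 = -1 ∨ C.j1 = 0) ∧ C.j2 = 0, X C
  Y_nonneg : ∀ r (i : I.sizes), ∀ C ∈ configs I, 0 ≤ Y r i C
  Y_eq_zero : ∀ r (i : I.sizes), ∀ C ∈ configs I, ¬ C.IsSmallExp i → Y r i C = 0
  X_nonneg : ∀ C ∈ configs I, 0 ≤ X C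
  /-- The variables of heavy configurations of fast machines are integral. -/
  integral : ∀ C ∈ configs I, gExp k < C.j1 → fExp k < C.j2 → ∃ z : ℤ, X C = z

/-- Optimal solutions. -/
def IsOptimal : Prop :=
  IsFeasible I X Y ∧ ∀ X' Y', IsFeasible I X' Y' → objective I X Y ≤ objective I X' Y'

end MILP

/-! ### Encoding of an instance together with a rational solution -/

/-- An integer, as its positive and its negative part. -/
def encodeInt (z : ℤ) : List ℕ := [z.toNat, (-z).toNat]

/-- A nonnegative rational number in lowest terms. -/
def encodeRat (x : ℚ) : List ℕ := [x.num.toNat, x.den]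

/-- The exponents of job sizes in increasing order. -/
def sizeList {k ℓ : ℕ} (I : BoundedInstance k ℓ) : List I.sizes :=
  (Finset.univ : Finset I.sizes).sort (fun a b => a ≤ b)

/-- The rows of a solution that belong to a configuration: its components, and the values of its
variables. -/
def encodeConfig {k ℓ : ℕ} (I : BoundedInstance k ℓ) (X : Config I → ℚ)
    (Y : Fin (yExp k ℓ + 1) → I.sizes → Config I → ℚ) (C : Config I) : List ℕ :=
  encodeInt C.j1 ++ [(-C.j2).toNat] ++ (List.finRange (yExp k ℓ + 1)).map C.t
    ++ (List.finRange (yExp k ℓ + 1)).flatMap (fun r => (sizeList I).map (C.large r))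
    ++ encodeRat (X C)
    ++ (List.finRange (yExp k ℓ + 1)).flatMap
        (fun r => (sizeList I).flatMap fun i => encodeRat (Y r i C))

/-- The input that consists of the instance and of a solution, of which the configurations in the
list `L` are written down.  All numbers are written in binary, and sizes, densities and speeds
are given by their exponents. -/
def encodeInput {k ℓ : ℕ} (I : BoundedInstance k ℓ) (X : Config I → ℚ)
    (Y : Fin (yExp k ℓ + 1) → I.sizes → Config I → ℚ) (L : List (Config I)) : List ℕ :=
  [k, ℓ, yExp k ℓ + 1, I.n, I.m, I.sizes.card, L.length]
    ++ (List.finRange I.n).flatMap (fun j => encodeInt (I.sizeExp j) ++ [(I.densExp j : ℕ)])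
    ++ (List.finRange I.m).map I.slowExp
    ++ (sizeList I).flatMap (fun i => encodeInt (i : ℤ))
    ++ L.flatMap (encodeConfig I X Y)

end

end WeightedScheduling

/-! # Rounding an optimal solution of the mixed integer linear program -/

namespace WeightedScheduling
noncomputable section
open Finset

/-! ### Sums over ordered pairs and the quadratic form of a schedule -/

/-! Costs as quadratic forms. A job waits only for jobs of at least its own density, so each product
of a weight with a preceding size carries the smaller of the two densities and is symmetric in the
two jobs. Hence a machine with total size T_r of density r costs, up to its speed, half the sum of
(1+δ)^min(r,r') T_r T_r' plus half the sum of w_j p_j (`schedCost_eq`). For cost(C) the same formula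
holds with the diagonal part of the large jobs only (`cost_eq`); the second sum of the objective
supplies the diagonal part of the small jobs (`objective_eq`). Everything depends only on how many
jobs of each density and size a machine gets, and is monotone in these numbers.

Rounding. Configuration C goes to ⌊X_C⌋ machines of its speed, and each of them has room for
n_{r,i}(C) + ⌈Y_{r,i,C}/X_C⌉ jobs of every density and size (`need`). Jobs of a type fill the rooms
in order, and what remains goes to one machine of speed 1 (`fillRooms`). Two losses have to be
controlled.

Room: per density the small jobs exceed t_r U by at most (k+2)U, namely one U from the space
constraint and (k+1)U from rounding up once for each small size, a geometric series. The factor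
δ^12/(1+δ)^y in γ absorbs the largest density and the at most 2k^8 densities, so the excess costs at
most δ/2 times the cost of C (`need_cost_le`, `sum_rooms_le`).

Leftovers: the bound on the load forces j_2 > f once j_1 > g, so X_C is integral for heavy
configurations. Only light ones leave jobs over, each at most what one machine with it could take.
For fixed j_1, j_2 there are boundedly many configurations, and the number of possible j_2 grows
only linearly in -j_1; the total leftover size is thus at most an arithmetic-geometric tail, which
is tiny because |g| is enormous (`sum_light_work_le`). On a machine of speed 1, whose room is at
most 6k, these jobs cost at most δ/10, while the constraint on fast machines gives an objective of
at least 1/5 (`objective_ge`). The two losses add up to the factor 1+δ in `schedCost_fillRooms_le`.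

Algorithm. For each job, nested scans compute its rank among the jobs of its type and find the room
containing this rank. Loops have at most N rounds and all stored numbers stay below 2^(3N+10), so
the logarithmic cost is polynomial (`exists_exec`). The machine of job j overwrites input cell j;
the scans remain correct because ranks count later jobs only and no cell before j is read when job j
is treated. -/

theorem two_mul_sum_related {ι : Type*} [Fintype ι] [DecidableEq ι] (R : ι → ι → Prop)
    [DecidableRel R] (refl : ∀ i, R i i) (total : ∀ i j, R i j ∨ R j i)
    (antisymm : ∀ i j, R i j → R j i → i = j) (a : ι → ι → ℝ) (symm : ∀ i j, a i j = a j i) :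
    2 * ∑ i, ∑ j with R j i, a i j = ∑ i, ∑ j, a i j + ∑ i, a i i := by
  have h1 : ∀ i, ∑ j with R j i, a i j = ∑ j, if R j i then a i j else 0 := fun i => sum_filter _ _
  have h2 : ∑ i, ∑ j with R j i, a i j = ∑ i, ∑ j, if R i j then a i j else 0 := by
    simp_rw [h1]
    rw [sum_comm]
    refine sum_congr rfl fun i _ => sum_congr rfl fun j _ => ?_
    rw [symm]
  have h3 : ∑ i, a i i = ∑ i, ∑ j, if i = j then a i j else 0 := by simp
  have h4 : 2 * ∑ i, ∑ j with R j i, a i j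
      = (∑ i, ∑ j, if R j i then a i j else 0) + ∑ i, ∑ j, if R i j then a i j else 0 := by
    rw [two_mul, ← h2]
    simp_rw [h1]
  rw [h4, h3, ← sum_add_distrib, ← sum_add_distrib]
  refine sum_congr rfl fun i _ => ?_
  rw [← sum_add_distrib, ← sum_add_distrib]
  refine sum_congr rfl fun j _ => ?_
  by_cases hij : i = j
  · subst hij; simp [refl]
  · rcases total i j with h | h
    · have : ¬ R j i := fun h' => hij (antisymm _ _ h h')
      simp [h, this, hij]
    · have : ¬ R i j := fun h' => hij (antisymm _ _ h' h)
      simp [h, this, hij]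

/-- Each unordered pair of distinct indices occurs twice; it is charged here to its smaller index,
as a job of lower density waits for those of higher density. -/
theorem sum_sum_eq_diag_add_lt {ι : Type*} [Fintype ι] [LinearOrder ι] (a : ι → ι → ℝ)
    (symm : ∀ i j, a i j = a j i) :
    ∑ i, ∑ j, a i j = ∑ i, (a i i + 2 * ∑ j with i < j, a i j) := by
  have h := two_mul_sum_related (fun j i : ι => i ≤ j) le_refl (fun i j => le_total _ _)
    (fun i j h h' => le_antisymm h' h) a symm
  have h1 : ∀ i, ∑ j with i ≤ j, a i j = a i i + ∑ j with i < j, a i j := by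
    intro i
    have : univ.filter (fun j => i ≤ j) = insert i (univ.filter fun j => i < j) := by
      ext j; simp [le_iff_eq_or_lt, eq_comm]
    rw [this, sum_insert (by simp)]
  simp_rw [h1] at h
  simp only [sum_add_distrib, ← mul_sum] at h ⊢
  linarith

/-- The weighted completion time of densities `b ^ r` with total sizes `T r` on a machine of speed
one, when all jobs are infinitesimal. -/
def quadForm (b : ℝ) {N : ℕ} (T : Fin N → ℝ) : ℝ :=
  (∑ r : Fin N, ∑ r' : Fin N, b ^ min (r : ℕ) (r' : ℕ) * (T r * T r')) / 2

section quadForm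

variable {b : ℝ} {N : ℕ} {T E : Fin N → ℝ}

/-- Higher densities run first: density r waits for all r' > r, and for half of its own total on
average. This is the shape in which the cost of a configuration is defined. -/
theorem quadForm_eq_nested (b : ℝ) (T : Fin N → ℝ) :
    quadForm b T = ∑ r : Fin N, b ^ (r : ℕ) * (T r * ∑ r' with r < r', T r' + T r ^ 2 / 2) := by
  unfold quadForm
  rw [sum_sum_eq_diag_add_lt _ (fun i j => by rw [min_comm, mul_comm (T i)]), sum_div]
  refine sum_congr rfl fun r _ => ?_
  have : ∑ r' with r < r', b ^ min (r : ℕ) (r' : ℕ) * (T r * T r')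
      = b ^ (r : ℕ) * (T r * ∑ r' with r < r', T r') := by
    rw [mul_sum, mul_sum]
    refine sum_congr rfl fun r' hr' => ?_
    have h : (r : ℕ) < r' := by simpa using hr'
    rw [min_eq_left h.le]
  rw [this, min_self]
  ring

/-- All densities are at least 1. This turns the work of a configuration into a lower bound for its
cost, against which the losses are measured. -/
theorem sq_sum_le_quadForm (hb : 1 ≤ b) (hT : ∀ r, 0 ≤ T r) :
    (∑ r, T r) ^ 2 / 2 ≤ quadForm b T := by
  unfold quadForm
  rw [sq, sum_mul_sum]
  refine div_le_div_of_nonneg_right ?_ (by norm_num)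
  refine sum_le_sum fun r _ => sum_le_sum fun r' _ => ?_
  exact le_mul_of_one_le_left (mul_nonneg (hT r) (hT r')) (one_le_pow₀ hb)

theorem quadForm_mono (hb : 1 ≤ b) (hT : ∀ r, 0 ≤ T r) (h : ∀ r, T r ≤ E r) :
    quadForm b T ≤ quadForm b E := by
  unfold quadForm
  refine div_le_div_of_nonneg_right ?_ (by norm_num)
  refine sum_le_sum fun r _ => sum_le_sum fun r' _ => ?_
  exact mul_le_mul_of_nonneg_left
    (mul_le_mul (h r) (h r') (hT r') ((hT r).trans (h r))) (by positivity)

/-- Every new product has density at most b^y, and the mixed products occur twice, which cancels the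
factor 1/2. -/
theorem quadForm_add_le (hb : 1 ≤ b) (hT : ∀ r, 0 ≤ T r) (hE : ∀ r, 0 ≤ E r) {y : ℕ}
    (hy : N ≤ y + 1) :
    quadForm b (fun r => T r + E r)
      ≤ quadForm b T + b ^ y * ((∑ r, T r) * (∑ r, E r) + (∑ r, E r) ^ 2 / 2) := by
  have key : ∑ r : Fin N, ∑ r' : Fin N, b ^ min (r : ℕ) (r' : ℕ) * ((T r + E r) * (T r' + E r'))
      ≤ ∑ r : Fin N, ∑ r' : Fin N, (b ^ min (r : ℕ) (r' : ℕ) * (T r * T r')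
        + b ^ y * (T r * E r' + E r * T r' + E r * E r')) := by
    refine sum_le_sum fun r _ => sum_le_sum fun r' _ => ?_
    have h1 : b ^ min (r : ℕ) (r' : ℕ) ≤ b ^ y :=
      pow_le_pow_right₀ hb ((min_le_left _ _).trans (by omega))
    have h2 : 0 ≤ T r * E r' + E r * T r' + E r * E r' :=
      add_nonneg (add_nonneg (mul_nonneg (hT r) (hE r')) (mul_nonneg (hE r) (hT r')))
        (mul_nonneg (hE r) (hE r'))
    nlinarith [mul_le_mul_of_nonneg_right h1 h2]
  have h3 : ∑ r : Fin N, ∑ r' : Fin N, b ^ y * (T r * E r' + E r * T r' + E r * E r')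
      = b ^ y * (2 * ((∑ r, T r) * ∑ r, E r) + (∑ r, E r) ^ 2) := by
    simp_rw [← mul_sum, sum_add_distrib, ← mul_sum, ← sum_mul]
    ring
  simp_rw [sum_add_distrib] at key
  rw [h3] at key
  unfold quadForm
  linarith

end quadForm

/-! ### The cost of a schedule -/

theorem delta_pos {k : ℕ} (hk : 0 < k) : 0 < delta k := by unfold delta; positivity

theorem one_lt_base {k : ℕ} (hk : 0 < k) : 1 < base k := by
  unfold base; linarith [delta_pos hk]

namespace BoundedInstance

variable {k ℓ : ℕ} (I : BoundedInstance k ℓ)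

theorem runsBefore_refl (j : Fin I.n) : I.RunsBefore j j := by simp [RunsBefore]

theorem runsBefore_total (i j : Fin I.n) : I.RunsBefore i j ∨ I.RunsBefore j i := by
  unfold RunsBefore
  rcases lt_trichotomy (I.densExp i) (I.densExp j) with h | h | h <;>
  rcases lt_trichotomy (I.sizeExp i) (I.sizeExp j) with h' | h' | h' <;>
  rcases le_total i j with h'' | h'' <;> simp [h, h', h'']

theorem runsBefore_antisymm (i j : Fin I.n) (h : I.RunsBefore i j) (h' : I.RunsBefore j i) :
    i = j := by
  unfold RunsBefore at h h'
  rcases h with h | ⟨h1, h | ⟨h2, h3⟩⟩ <;> rcases h' with h' | ⟨h1', h' | ⟨h2', h3'⟩⟩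
  all_goals first
    | exact le_antisymm h3 h3'
    | (exfalso; order)

/-- The size exponent of a job, as an element of the set of sizes. -/
def sizeIdx (j : Fin I.n) : I.sizes := ⟨I.sizeExp j, mem_image_of_mem _ (mem_univ j)⟩

/-- The number of jobs of given density and size on a machine. -/
def onMachine (σ : I.Schedule) (q : Fin I.m) (r : Fin (yExp k ℓ + 1)) (i : I.sizes) : ℕ :=
  #{j : Fin I.n | σ j = q ∧ I.densExp j = r ∧ I.sizeIdx j = i}

theorem sum_on_machine (σ : I.Schedule) (q : Fin I.m)
    (F : Fin (yExp k ℓ + 1) → I.sizes → ℝ) :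
    ∑ j with σ j = q, F (I.densExp j) (I.sizeIdx j)
      = ∑ r, ∑ i, (I.onMachine σ q r i : ℝ) * F r i := by
  have : ∀ j, F (I.densExp j) (I.sizeIdx j)
      = ∑ r, ∑ i, if I.densExp j = r ∧ I.sizeIdx j = i then F r i else 0 := by
    intro j
    simp [ite_and]
  simp_rw [this]
  rw [sum_comm]
  refine sum_congr rfl fun r _ => ?_
  rw [sum_comm]
  refine sum_congr rfl fun i _ => ?_
  rw [← sum_filter, filter_filter, sum_const, nsmul_eq_mul]
  rfl

/-- The total size of the jobs of density `b ^ r` if there are `N r i` jobs of size `b ^ i`. -/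
def sizeSum (N : Fin (yExp k ℓ + 1) → I.sizes → ℝ) (r : Fin (yExp k ℓ + 1)) : ℝ :=
  ∑ i : I.sizes, base k ^ (i : ℤ) * N r i

/-- Half of the sum of `w_j p_j` if there are `N r i` jobs of density `b ^ r` and size `b ^ i`. -/
def diagSum (N : Fin (yExp k ℓ + 1) → I.sizes → ℝ) : ℝ :=
  ∑ r : Fin (yExp k ℓ + 1), ∑ i : I.sizes, base k ^ (((r : ℕ) : ℤ) + 2 * (i : ℤ)) * N r i / 2

/-- By symmetry of the pairwise delays the order on a machine no longer matters; only the numbers of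
jobs per type remain. -/
theorem schedCost_eq (σ : I.Schedule) :
    I.schedCost σ = ∑ q, (quadForm (base k) (I.sizeSum fun r i => I.onMachine σ q r i)
      + I.diagSum fun r i => I.onMachine σ q r i) / I.speed q := by
  classical
  have hb := base_pos k
  let a : Fin I.n → Fin I.n → ℝ := fun j j' => if σ j' = σ j then
    base k ^ min (I.densExp j : ℕ) (I.densExp j' : ℕ) * (I.p j * I.p j') / I.speed (σ j) else 0
  have ha : ∀ j j', a j j' = a j' j := by
    intro j j'
    by_cases h : σ j' = σ j
    · simp only [a, h, if_true]; rw [min_comm, mul_comm (I.p j)]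
    · simp only [a, h, Ne.symm h, if_false]
  have h := two_mul_sum_related I.RunsBefore I.runsBefore_refl I.runsBefore_total
    I.runsBefore_antisymm a ha
  -- A predecessor has at least the density of j, so the density of j is the minimum of the two and
  -- the delay equals the symmetric kernel `a`.
  have h1 : I.schedCost σ = ∑ j, ∑ j' with I.RunsBefore j' j, a j j' := by
    refine sum_congr rfl fun j _ => ?_
    unfold completion
    rw [mul_div_assoc', mul_sum, sum_div]
    have : (univ.filter fun j' => σ j' = σ j ∧ I.RunsBefore j' j)
        = (univ.filter fun j' => I.RunsBefore j' j).filter fun j' => σ j' = σ j := by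
      ext; simp [and_comm]
    rw [this, sum_filter]
    refine sum_congr rfl fun j' hj' => ?_
    have hle : (I.densExp j : ℕ) ≤ I.densExp j' := by
      rcases (mem_filter.1 hj').2 with h | h
      · exact (Fin.lt_def.1 h).le
      · rw [h.1]
    simp only [a, w]
    rw [min_eq_left hle, zpow_natCast, mul_assoc]
  have h2 : ∀ j, a j j = base k ^ (I.densExp j : ℕ) * I.p j ^ 2 / I.speed (σ j) := by
    intro j; simp only [a, if_true, min_self]; ring
  have h3 : ∑ j, ∑ j', a j j' = ∑ q, 2 * quadForm (base k)
      (I.sizeSum fun r i => I.onMachine σ q r i) / I.speed q := by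
    rw [← sum_fiberwise univ σ]
    refine sum_congr rfl fun q _ => ?_
    have e1 : ∀ j ∈ univ.filter (fun j => σ j = q), ∑ j', a j j'
        = ∑ r', ∑ i', (I.onMachine σ q r' i' : ℝ) * (base k ^ min (I.densExp j : ℕ) (r' : ℕ) *
          (base k ^ ((I.sizeIdx j : I.sizes) : ℤ) * base k ^ (i' : ℤ)) / I.speed q) := by
      intro j hj
      have hj' : σ j = q := (mem_filter.1 hj).2
      rw [← I.sum_on_machine σ q fun r' i' => base k ^ min (I.densExp j : ℕ) (r' : ℕ) *
          (base k ^ ((I.sizeIdx j : I.sizes) : ℤ) * base k ^ (i' : ℤ)) / I.speed q, sum_filter]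
      refine sum_congr rfl fun j' _ => ?_
      simp only [a, hj']
      rfl
    rw [sum_congr rfl e1, I.sum_on_machine σ q fun r i => ∑ r', ∑ i',
        (I.onMachine σ q r' i' : ℝ) * (base k ^ min (r : ℕ) (r' : ℕ) *
          (base k ^ (i : ℤ) * base k ^ (i' : ℤ)) / I.speed q)]
    unfold quadForm
    rw [mul_div_cancel₀ _ (two_ne_zero), sum_div]
    refine sum_congr rfl fun r _ => ?_
    simp_rw [mul_sum]
    rw [sum_comm, sum_div]
    refine sum_congr rfl fun r' _ => ?_
    unfold sizeSum
    rw [sum_mul_sum, mul_sum, sum_div]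
    refine sum_congr rfl fun i _ => ?_
    rw [mul_sum, sum_div]
    refine sum_congr rfl fun i' _ => ?_
    ring
  have h4 : ∑ j, a j j = ∑ q, 2 * (I.diagSum fun r i => I.onMachine σ q r i) / I.speed q := by
    rw [← sum_fiberwise univ σ]
    refine sum_congr rfl fun q _ => ?_
    have e1 : ∀ j ∈ univ.filter (fun j => σ j = q), a j j
        = base k ^ (I.densExp j : ℕ) * (base k ^ ((I.sizeIdx j : I.sizes) : ℤ)) ^ 2 / I.speed q := by
      intro j hj
      have hj' : σ j = q := (mem_filter.1 hj).2
      rw [h2, hj']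
      rfl
    rw [sum_congr rfl e1, I.sum_on_machine σ q fun r i =>
      base k ^ (r : ℕ) * (base k ^ (i : ℤ)) ^ 2 / I.speed q]
    unfold diagSum
    rw [mul_sum, sum_div]
    refine sum_congr rfl fun r _ => ?_
    rw [mul_sum, sum_div]
    refine sum_congr rfl fun i _ => ?_
    rw [zpow_add₀ hb.ne', zpow_natCast, mul_comm 2 (i : ℤ), zpow_mul]
    norm_cast
    ring
  have h5 : I.schedCost σ = (2 * ∑ j, ∑ j' with I.RunsBefore j' j, a j j') / 2 := by
    rw [h1]; ring
  rw [h5, h, h3, h4, ← sum_add_distrib, sum_div]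
  refine sum_congr rfl fun q _ => ?_
  ring

end BoundedInstance

/-! ### The cost of a configuration -/

namespace Config

variable {k ℓ : ℕ} {I : BoundedInstance k ℓ} (C : Config I)

/-- Total size of the jobs of density `(1+δ)^r`. -/
def total (r : Fin (yExp k ℓ + 1)) : ℝ := C.largeWork r + C.smallWork r

theorem sum_range_succ_real (n : ℕ) : ∑ q ∈ range n, ((q : ℝ) + 1) = n * (n + 1) / 2 := by
  induction n with
  | zero => simp
  | succ n ih => rw [sum_range_succ, ih]; push_cast; ring

/-- A group of n equal large jobs contributes n(n+1)/2 = n²/2 + n/2: the squares complete the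
quadratic form and the linear terms form the diagonal part. A block of small jobs has only the
square, by definition of its cost. -/
theorem cost_eq : C.cost = (quadForm (base k) C.total + I.diagSum fun r i => C.large r i) / C.speed := by
  have hb := base_pos k
  have hs : 0 < C.speed := zpow_pos hb _
  have key : ∀ r : Fin (yExp k ℓ + 1),
      (∑ i : I.sizes, ∑ q ∈ range (C.large r i),
        base k ^ ((i : ℤ) + (r : ℕ)) * (C.largeStart r i + ((q : ℝ) + 1) * base k ^ (i : ℤ) / C.speed))
      + base k ^ (r : ℕ) * (C.smallStart r + C.smallWork r / (2 * C.speed)) * C.smallWork r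
      = (base k ^ (r : ℕ) * (C.total r * ∑ r' with r < r', C.total r' + C.total r ^ 2 / 2)
        + ∑ i : I.sizes, base k ^ (((r : ℕ) : ℤ) + 2 * (i : ℤ)) * C.large r i / 2) / C.speed := by
    intro r
    have e1 : ∀ i : I.sizes, ∑ q ∈ range (C.large r i),
        base k ^ ((i : ℤ) + (r : ℕ)) * (C.largeStart r i + ((q : ℝ) + 1) * base k ^ (i : ℤ) / C.speed)
        = base k ^ (r : ℕ) * (base k ^ (i : ℤ) * C.large r i * C.densStart r
          + ((base k ^ (i : ℤ) * C.large r i) * (base k ^ (i : ℤ) * C.large r i) / 2 + (∑ i' : I.sizes with i < i',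
              (base k ^ (i : ℤ) * C.large r i) * (base k ^ (i' : ℤ) * C.large r i'))) / C.speed)
          + base k ^ (((r : ℕ) : ℤ) + 2 * (i : ℤ)) * C.large r i / 2 / C.speed := by
      intro i
      rw [← mul_sum, sum_add_distrib, ← sum_div, ← sum_mul, sum_range_succ_real, sum_const, card_range,
        nsmul_eq_mul, ← mul_sum]
      unfold largeStart
      rw [zpow_add₀ hb.ne', zpow_natCast, zpow_add₀ hb.ne', zpow_natCast, two_mul, zpow_add₀ hb.ne']
      field_simp
      ring
    rw [sum_congr rfl fun i _ => e1 i, sum_add_distrib, ← mul_sum, sum_add_distrib, ← sum_mul,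
      ← sum_div, ← sum_div]
    -- Expanding the square of the large work of one density collects the waiting times between its
    -- different sizes.
    have e2 : C.largeWork r ^ 2 = ∑ i : I.sizes, ((base k ^ (i : ℤ) * C.large r i) *
        (base k ^ (i : ℤ) * C.large r i) + 2 * (∑ i' : I.sizes with i < i',
              (base k ^ (i : ℤ) * C.large r i) * (base k ^ (i' : ℤ) * C.large r i'))) := by
      rw [sq]
      unfold largeWork
      rw [sum_mul_sum, sum_sum_eq_diag_add_lt _ fun i j => by ring]
    have e3 : ∑ i : I.sizes, ((base k ^ (i : ℤ) * C.large r i) *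
        (base k ^ (i : ℤ) * C.large r i) / 2 + (∑ i' : I.sizes with i < i',
              (base k ^ (i : ℤ) * C.large r i) * (base k ^ (i' : ℤ) * C.large r i')))
        = C.largeWork r ^ 2 / 2 := by
      rw [e2, sum_div]
      exact sum_congr rfl fun i _ => by ring
    rw [e3]
    have e4 : ∑ i : I.sizes, base k ^ (i : ℤ) * (C.large r i : ℝ) = C.largeWork r := rfl
    rw [e4]
    unfold smallStart densStart total
    field_simp
    ring
  unfold cost
  rw [← sum_add_distrib, sum_congr rfl fun r _ => key r, ← sum_div, sum_add_distrib,
    ← quadForm_eq_nested]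
  rfl

end Config

/-! ### Ranks and prefix sums -/

/-- Extension by zero. -/
def extend {M : Type*} [Zero M] {n : ℕ} (g : Fin n → M) (x : ℕ) : M :=
  if h : x < n then g ⟨x, h⟩ else 0

@[simp] theorem extend_val {M : Type*} [Zero M] {n : ℕ} (g : Fin n → M) (x : Fin n) :
    extend g x = g x := by simp [extend]

theorem extend_of_lt {M : Type*} [Zero M] {n : ℕ} (g : Fin n → M) {x : ℕ} (h : x < n) :
    extend g x = g ⟨x, h⟩ := by simp [extend, h]

theorem extend_self {M : Type*} [Zero M] {n : ℕ} (g : Fin n → M) : extend g n = 0 := by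
  simp [extend]

/-- The sum of the first `n` values. -/
def prefixSum (f : ℕ → ℕ) (n : ℕ) : ℕ := ∑ x ∈ range n, f x

theorem prefixSum_succ (f : ℕ → ℕ) (n : ℕ) : prefixSum f (n + 1) = prefixSum f n + f n :=
  sum_range_succ _ _

theorem prefixSum_mono (f : ℕ → ℕ) {a b : ℕ} (h : a ≤ b) : prefixSum f a ≤ prefixSum f b :=
  sum_le_sum_of_subset (range_mono h)

theorem prefixSum_extend {n : ℕ} (g : Fin n → ℕ) : prefixSum (extend g) n = ∑ x, g x := by
  unfold prefixSum
  rw [← Fin.sum_univ_eq_sum_range]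
  simp

/-- `v x` for the `x < n` such that `t` lies between the sums of the first `x` and of the first
`x + 1` values of `f`, and `d` if there is none. -/
def seek (f v : ℕ → ℕ) (t d : ℕ) : ℕ → ℕ
  | 0 => d
  | n + 1 => if prefixSum f n ≤ t ∧ t < prefixSum f n + f n then v n else seek f v t d n

section seek

variable {f v : ℕ → ℕ} {t d : ℕ}

theorem seek_of_le {n : ℕ} (h : prefixSum f n ≤ t) : seek f v t d n = d := by
  induction n with
  | zero => rfl
  | succ n ih =>
    rw [prefixSum_succ] at h
    rw [seek, if_neg (by omega), ih (by omega)]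

theorem seek_of_mem {n x : ℕ} (hx : x < n) (h : prefixSum f x ≤ t) (h' : t < prefixSum f x + f x) :
    seek f v t d n = v x := by
  induction n with
  | zero => omega
  | succ n ih =>
    rcases Nat.lt_succ_iff_lt_or_eq.1 hx with hn | rfl
    · have := prefixSum_mono f hn
      rw [prefixSum_succ] at this
      rw [seek, if_neg (by omega), ih hn]
    · rw [seek, if_pos ⟨h, h'⟩]

theorem exists_prefixSum {n : ℕ} (h : t < prefixSum f n) :
    ∃ x < n, prefixSum f x ≤ t ∧ t < prefixSum f x + f x := by
  induction n with
  | zero => simp [prefixSum] at h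
  | succ n ih =>
    by_cases hn : t < prefixSum f n
    · obtain ⟨x, hx, h'⟩ := ih hn
      exact ⟨x, hx.trans (Nat.lt_succ_self n), h'⟩
    · rw [prefixSum_succ] at h
      exact ⟨n, Nat.lt_succ_self n, by omega, h⟩

theorem seek_cases (f v : ℕ → ℕ) (t d n : ℕ) :
    (∃ x < n, prefixSum f x ≤ t ∧ t < prefixSum f x + f x ∧ seek f v t d n = v x) ∨
      (prefixSum f n ≤ t ∧ seek f v t d n = d) := by
  by_cases h : t < prefixSum f n
  · obtain ⟨x, hx, h1, h2⟩ := exists_prefixSum h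
    exact .inl ⟨x, hx, h1, h2, seek_of_mem hx h1 h2⟩
  · exact .inr ⟨by omega, seek_of_le (by omega)⟩

/-- Searching an index and then looking up its value is one search for the value; the program
performs the latter. -/
theorem seek_map (f v : ℕ → ℕ) (t d n : ℕ) : seek f v t (v d) n = v (seek f id t d n) := by
  induction n with
  | zero => rfl
  | succ n ih => rw [seek, seek, ih]; split_ifs <;> rfl

theorem seek_lt {n m : ℕ} (hn : n ≤ m) (hd : d < m) : seek f id t d n < m := by
  rcases seek_cases f id t d n with ⟨x, hx, -, -, h⟩ | ⟨-, h⟩ <;> rw [h]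
  · exact hx.trans_le hn
  · exact hd

end seek

/-- The number of later elements with the property `p`. -/
def rankGt {n : ℕ} (p : Fin n → Prop) [DecidablePred p] (a : Fin n) : ℕ := #{x | a < x ∧ p x}

/-- The rank is strictly decreasing on the elements with the property and smaller than their number,
so it numbers them 0, 1, 2, … without gaps. Intervals of ranks can then be handed out as in prefix
sums. -/
theorem image_rankGt {n : ℕ} (p : Fin n → Prop) [DecidablePred p] :
    (univ.filter p).image (rankGt p) = range #{x | p x} := by
  have hlt : ∀ a b, p b → a < b → rankGt p b < rankGt p a := by
    intro a b hb hab
    refine card_lt_card ⟨fun x hx => ?_, fun h => ?_⟩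
    · simp only [mem_filter, mem_univ, true_and] at hx ⊢
      exact ⟨hab.trans hx.1, hx.2⟩
    · have : b ∈ univ.filter fun x => b < x ∧ p x := h (by simp [hab, hb])
      simp at this
  have hinj : Set.InjOn (rankGt p) (univ.filter p : Finset (Fin n)) := by
    intro a ha b hb h
    have ha' : p a := by simpa using ha
    have hb' : p b := by simpa using hb
    rcases lt_trichotomy a b with hab | hab | hab
    · have := hlt a b hb' hab; omega
    · exact hab
    · have := hlt b a ha' hab; omega
  refine eq_of_subset_of_card_le (fun x hx => ?_) ?_
  · obtain ⟨a, ha, rfl⟩ := mem_image.1 hx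
    have ha' : p a := by simpa using ha
    refine mem_range.2 (card_lt_card ⟨fun x hx => ?_, fun h => ?_⟩)
    · simp only [mem_filter, mem_univ, true_and] at hx ⊢
      exact hx.2
    · have : a ∈ univ.filter fun x => a < x ∧ p x := h (by simpa using ha')
      simp at this
  · rw [card_range, card_image_of_injOn hinj]

theorem card_filter_rankGt {n : ℕ} (p : Fin n → Prop) [DecidablePred p] (A : ℕ → Prop)
    [DecidablePred A] :
    #{a | p a ∧ A (rankGt p a)} = #{x ∈ range #{x | p x} | A x} := by
  have himg := image_rankGt p
  have hinj : Set.InjOn (rankGt p) (univ.filter p : Finset (Fin n)) := by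
    rw [← card_image_iff, himg, card_range]
  rw [← himg, filter_image, card_image_of_injOn, filter_filter]
  exact hinj.mono (by intro x; simp +contextual)

theorem card_rankGt_mem_Ico {n : ℕ} (p : Fin n → Prop) [DecidablePred p] {lo hi : ℕ}
    (h : hi ≤ #{x | p x}) : #{a | p a ∧ lo ≤ rankGt p a ∧ rankGt p a < hi} = hi - lo := by
  rw [card_filter_rankGt p fun x => lo ≤ x ∧ x < hi, ← Nat.card_Ico]
  congr 1
  ext x; simp only [mem_filter, mem_range, mem_Ico]; omega

theorem card_rankGt_mem_Ico_le {n : ℕ} (p : Fin n → Prop) [DecidablePred p] (lo hi : ℕ) :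
    #{a | p a ∧ lo ≤ rankGt p a ∧ rankGt p a < hi} ≤ hi - lo := by
  rw [card_filter_rankGt p fun x => lo ≤ x ∧ x < hi, ← Nat.card_Ico]
  refine card_le_card fun x => ?_
  simp only [mem_filter, mem_range, mem_Ico]; omega

theorem card_le_rankGt {n : ℕ} (p : Fin n → Prop) [DecidablePred p] (lo : ℕ) :
    #{a | p a ∧ lo ≤ rankGt p a} = #{x | p x} - lo := by
  rw [card_filter_rankGt p fun x => lo ≤ x, ← Nat.card_Ico]
  congr 1
  ext x; simp only [mem_filter, mem_range, mem_Ico]; omega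

theorem sum_get_eq {α M : Type*} [DecidableEq α] [AddCommMonoid M] {L : List α} (hL : L.Nodup)
    (g : α → M) : ∑ c : Fin L.length, g (L.get c) = ∑ C ∈ L.toFinset, g C := by
  rw [List.sum_toFinset g hL]
  exact Fin.sum_univ_fun_getElem L g

/-! ### Rounding a solution of the program -/

namespace BoundedInstance

variable {k ℓ : ℕ} {I : BoundedInstance k ℓ}

/-- The number of later jobs of the same density and size. -/
def jobRank (j : Fin I.n) : ℕ := #{x | j < x ∧ I.densExp x = I.densExp j ∧ I.sizeExp x = I.sizeExp j}

/-- The number of later machines of the same speed. -/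
def machRank (q : Fin I.m) : ℕ := #{x | q < x ∧ I.slowExp x = I.slowExp q}

/-! ### Filling given rooms with the jobs of each type. -/

section jobs

variable (room : Fin I.m → Fin (yExp k ℓ + 1) → I.sizes → ℕ) (host : Fin I.m)

/-- The schedule that fills the room on the machines with jobs of the respective density and size,
and puts all remaining jobs onto the machine `host`. -/
def fillRooms : I.Schedule := fun j =>
  ⟨seek (extend fun q => room q (I.densExp j) (I.sizeIdx j)) id (jobRank j) host I.m,
    seek_lt le_rfl host.2⟩

theorem sizeIdx_eq_iff (x : Fin I.n) (i : I.sizes) : I.sizeIdx x = i ↔ I.sizeExp x = i :=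
  Subtype.ext_iff

/-- The jobs of one type on q have their ranks in the interval of q, whose length is the room there.
The host also gets the ranks beyond the total room; the truncated difference counts them. -/
theorem onMachine_fillRooms_le (q : Fin I.m) (r : Fin (yExp k ℓ + 1)) (i : I.sizes) :
    I.onMachine (fillRooms room host) q r i
      ≤ room q r i + if q = host then I.jobCount r i - ∑ q', room q' r i else 0 := by
  classical
  set p : Fin I.n → Prop := fun x => I.densExp x = r ∧ I.sizeExp x = i with hp
  set f : ℕ → ℕ := extend fun q => room q r i with hf
  have hrank : ∀ j, p j → jobRank j = rankGt p j := by
    rintro j ⟨h1, h2⟩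
    unfold jobRank rankGt
    rw [h1, h2]
  have hcard : I.jobCount r i = #{x | p x} := rfl
  have hsum : ∑ q', room q' r i = prefixSum f I.m := (prefixSum_extend _).symm
  have hσ : ∀ j, p j → ((fillRooms room host j : Fin I.m) : ℕ)
      = seek f id (rankGt p j) host I.m := by
    intro j hj
    have h2 : I.sizeIdx j = i := (sizeIdx_eq_iff j i).2 hj.2
    simp only [fillRooms, hrank j hj, hj.1, h2, hf]
  have hsub : (univ.filter fun j => fillRooms room host j = q ∧ I.densExp j = r ∧ I.sizeIdx j = i)
      ⊆ (univ.filter fun j => p j ∧ prefixSum f q ≤ rankGt p j ∧ rankGt p j < prefixSum f q + f q)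
        ∪ if q = host then univ.filter fun j => p j ∧ prefixSum f I.m ≤ rankGt p j else ∅ := by
    intro j hj
    simp only [mem_filter, mem_univ, true_and] at hj
    have hpj : p j := ⟨hj.2.1, (sizeIdx_eq_iff j i).1 hj.2.2⟩
    have hq : (q : ℕ) = seek f id (rankGt p j) host I.m := by rw [← hσ j hpj, hj.1]
    rcases seek_cases f id (rankGt p j) host I.m with ⟨x, hx, h1, h2, h3⟩ | ⟨h1, h2⟩
    · rw [h3] at hq
      simp only [id] at hq
      subst hq
      simp [hpj, h1, h2]
    · rw [h2] at hq
      have : q = host := Fin.ext hq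
      simp [this, hpj, h1]
  refine (card_le_card hsub).trans ((card_union_le _ _).trans (Nat.add_le_add ?_ ?_))
  · refine (card_rankGt_mem_Ico_le p _ _).trans ?_
    simp [hf]
  · split_ifs with h
    · rw [card_le_rankGt, hcard, hsum]
    · simp

end jobs

/-! ### Handing out configurations to machines. -/

section machines

variable (X : Config I → ℝ) (Y : Fin (yExp k ℓ + 1) → I.sizes → Config I → ℝ) (L : List (Config I))

/-- The number of machines of speed `(1+δ)^s` that get the `c`-th configuration. -/
def copies (s : ℤ) (c : Fin L.length) : ℕ := if (L.get c).j2 = s then ⌊X (L.get c)⌋₊ else 0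

/-- The index of the configuration of a machine (the length of the list if there is none). -/
def cfg (q : Fin I.m) : ℕ :=
  seek (extend (copies X L (-(I.slowExp q : ℤ)))) id (machRank q) L.length L.length

/-- The number of jobs of given density and size that a machine with a configuration can get. -/
def need (C : Config I) (r : Fin (yExp k ℓ + 1)) (i : I.sizes) : ℕ :=
  C.large r i + ⌈Y r i C / X C⌉₊

/-- The number of jobs of given density and size that a machine can get. -/
def room (q : Fin I.m) (r : Fin (yExp k ℓ + 1)) (i : I.sizes) : ℕ :=
  extend (fun c => need X Y (L.get c) r i) (cfg X L q)

theorem room_eq_seek (q : Fin I.m) (r : Fin (yExp k ℓ + 1)) (i : I.sizes) :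
    room X Y L q r i = seek (extend (copies X L (-(I.slowExp q : ℤ))))
      (extend fun c => need X Y (L.get c) r i) (machRank q) 0 L.length := by
  have h := seek_map (extend (copies X L (-(I.slowExp q : ℤ))))
    (extend fun c => need X Y (L.get c) r i) (machRank q) L.length L.length
  rw [extend_self] at h
  exact h.symm

variable {X Y L} (hfeas : IsFeasible I X Y) (hnodup : L.Nodup) (hsub : ∀ C ∈ L, C ∈ configs I)

theorem cfg_eq_iff (q : Fin I.m) (c : Fin L.length) : cfg X L q = c ↔
    prefixSum (extend (copies X L (-(I.slowExp q : ℤ)))) c ≤ machRank q ∧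
    machRank q < prefixSum (extend (copies X L (-(I.slowExp q : ℤ)))) c
      + copies X L (-(I.slowExp q : ℤ)) c := by
  constructor
  · intro h
    rcases seek_cases (extend (copies X L (-(I.slowExp q : ℤ)))) id (machRank q) L.length L.length
      with ⟨x, hx, h1, h2, h3⟩ | ⟨h1, h2⟩
    · have : x = c := by rw [← h, cfg, h3]; rfl
      subst this
      rw [extend_val] at h2
      exact ⟨h1, h2⟩
    · have : (c : ℕ) = L.length := by rw [← h, cfg, h2]
      have := c.2
      omega
  · rintro ⟨h1, h2⟩
    rw [← extend_val (copies X L (-(I.slowExp q : ℤ))) c] at h2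
    exact seek_of_mem c.2 h1 h2

theorem j2_of_cfg_eq {q : Fin I.m} {c : Fin L.length} (h : cfg X L q = c) :
    (L.get c).j2 = -(I.slowExp q : ℤ) := by
  have := (cfg_eq_iff q c).1 h
  by_contra hne
  simp only [copies, hne, if_false] at this
  omega

include hfeas hnodup hsub

theorem sum_copies_le (q : Fin I.m) :
    ∑ c, copies X L (-(I.slowExp q : ℤ)) c ≤ #{q' : Fin I.m | I.slowExp q' = I.slowExp q} := by
  classical
  have h1 := hfeas.machines q
  unfold copies
  rw [sum_get_eq hnodup fun C => if C.j2 = -(I.slowExp q : ℤ) then ⌊X C⌋₊ else 0]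
  have hL : L.toFinset ⊆ configs I := fun C hC => hsub C (List.mem_toFinset.1 hC)
  rw [← Nat.cast_le (α := ℝ)]
  refine le_trans ?_ h1
  push_cast
  rw [sum_filter]
  refine (sum_le_sum_of_subset_of_nonneg hL fun C hC _ => by split_ifs <;> positivity).trans ?_
  refine sum_le_sum fun C hC => ?_
  split_ifs
  · exact Nat.floor_le (hfeas.X_nonneg C hC)
  · exact le_rfl

/-- The rank intervals of the configurations of one speed fit into the machines of that speed, since
the floors sum to at most the bound of the machine constraint. No interval is cut off, so the count
is exact. -/
theorem card_cfg_eq (c : Fin L.length) : #{q | cfg X L q = c} = ⌊X (L.get c)⌋₊ := by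
  -- Validity provides a machine of the speed of the configuration; the ranks are taken among the
  -- machines of this speed.
  obtain ⟨q₀, hq₀⟩ : ∃ q, (L.get c).j2 = -(I.slowExp q : ℤ) :=
    ((finite_valid I).mem_toFinset.1 (hsub _ (L.get_mem c))).j2_mem
  set p : Fin I.m → Prop := fun q => I.slowExp q = I.slowExp q₀ with hp
  set f := extend (copies X L (-(I.slowExp q₀ : ℤ))) with hf
  have hc : copies X L (-(I.slowExp q₀ : ℤ)) c = ⌊X (L.get c)⌋₊ := if_pos hq₀
  have hset : (univ.filter fun q => cfg X L q = c) = univ.filter fun q =>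
      p q ∧ prefixSum f c ≤ rankGt p q ∧ rankGt p q < prefixSum f c + ⌊X (L.get c)⌋₊ := by
    ext q
    simp only [mem_filter, mem_univ, true_and]
    have hpq : p q → machRank q = rankGt p q := by
      intro h
      have h' : I.slowExp q = I.slowExp q₀ := h
      simp only [machRank, rankGt, h', hp]
    constructor
    · intro h
      have h1 := j2_of_cfg_eq h
      have h2 : I.slowExp q = I.slowExp q₀ := by rw [hq₀] at h1; omega
      have h3 := (cfg_eq_iff q c).1 h
      rw [hpq h2, h2, hc] at h3
      exact ⟨h2, h3⟩
    · rintro ⟨h2, h3⟩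
      rw [cfg_eq_iff, hpq h2, h2, hc]
      exact h3
  have hle : prefixSum f c + ⌊X (L.get c)⌋₊ ≤ #{q | p q} := by
    have h1 : prefixSum f c + ⌊X (L.get c)⌋₊ = prefixSum f (c + 1) := by
      rw [prefixSum_succ, hf, extend_val, hc]
    rw [h1]
    refine (prefixSum_mono f (Nat.succ_le_of_lt c.2)).trans ?_
    rw [hf, prefixSum_extend]
    exact sum_copies_le hfeas hnodup hsub q₀
  rw [hset, card_rankGt_mem_Ico p hle]
  omega

/-- Transfers sums over machines to sums over configurations. Unlisted configurations have X = 0,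
and machines without a configuration contribute 0 by the extension by zero. -/
theorem sum_cfg (hall : ∀ C ∈ configs I, X C ≠ 0 → C ∈ L) (G : Config I → ℝ) :
    ∑ q : Fin I.m, extend (fun c => G (L.get c)) (cfg X L q)
      = ∑ C ∈ configs I, (⌊X C⌋₊ : ℝ) * G C := by
  classical
  have h1 : ∀ x : ℕ, extend (fun c => G (L.get c)) x
      = ∑ c : Fin L.length, if x = c then G (L.get c) else 0 := by
    intro x
    by_cases hx : x < L.length
    · rw [extend_of_lt _ hx, sum_eq_single ⟨x, hx⟩]
      · simp
      · intro c _ hc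
        rw [if_neg]
        rintro rfl
        exact hc rfl
      · simp
    · rw [extend, dif_neg hx, sum_eq_zero]
      intro c _
      rw [if_neg]
      have := c.2
      omega
  simp_rw [h1]
  rw [sum_comm]
  have h2 : ∀ c : Fin L.length, ∑ q, (if cfg X L q = c then G (L.get c) else 0)
      = (⌊X (L.get c)⌋₊ : ℝ) * G (L.get c) := by
    intro c
    rw [← sum_filter, sum_const, card_cfg_eq hfeas hnodup hsub, nsmul_eq_mul]
  simp_rw [h2]
  rw [sum_get_eq hnodup fun C => (⌊X C⌋₊ : ℝ) * G C]
  refine sum_subset (fun C hC => hsub C (List.mem_toFinset.1 hC)) fun C hC hC' => ?_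
  have : X C = 0 := by
    by_contra h
    exact hC' (List.mem_toFinset.2 (hall C hC h))
  simp [this]

end machines

end BoundedInstance

/-! ### Estimates for the parameters -/

section parameters

variable {k ℓ : ℕ}

theorem base_eq (hk : 0 < k) : base k * k = k + 1 := by
  have : (k : ℝ) ≠ 0 := by positivity
  unfold base delta; field_simp

theorem base_le (hk : 8 ≤ k) : base k ≤ 9 / 8 := by
  have : (8 : ℝ) ≤ k := by exact_mod_cast hk
  have h : (1 : ℝ) / k ≤ 1 / 8 := by gcongr
  unfold base delta; linarith

theorem two_le_base_pow (hk : 0 < k) : 2 ≤ base k ^ k := by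
  have h := one_add_mul_le_pow (a := delta k) (by linarith [delta_pos hk]) k
  have : (k : ℝ) * delta k = 1 := by unfold delta; field_simp
  unfold base
  linarith

theorem two_pow_le_base_pow (hk : 0 < k) (n : ℕ) : 2 ^ n ≤ base k ^ (k * n) := by
  rw [pow_mul]
  exact pow_le_pow_left₀ (by norm_num) (two_le_base_pow hk) n

theorem pow_eight_le (hk : 8 ≤ k) : k ^ 8 ≤ 8 ^ k := by
  induction k, hk using Nat.le_induction with
  | base => norm_num
  | succ k hk ih =>
    -- For k ≥ 8 one has (1 + 1/k)^8 ≤ (9/8)^8 < 8.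
    have h : (k + 1) ^ 8 ≤ 8 * k ^ 8 := by
      have h8 : 8 * (k + 1) ≤ 9 * k := by omega
      have := Nat.pow_le_pow_left h8 8
      rw [mul_pow, mul_pow] at this
      norm_num at this
      omega
    rw [pow_succ 8]
    omega

/-- From k^8 ≤ 8^k = 2^(3k) ≤ (1+δ)^(3k²). The constant 3/8 makes room for ℓ ≤ 5: 15/8 k², rounded
up, is still at most 2k². -/
theorem logb_le (hk : 8 ≤ k) : Real.logb (base k) k ≤ 3 * k ^ 2 / 8 := by
  have hk0 : 0 < k := by omega
  have hkr : (0 : ℝ) < k := by exact_mod_cast hk0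
  have h1 : (k : ℝ) ^ 8 ≤ base k ^ (3 * k ^ 2) := by
    have h2 : ((k ^ 8 : ℕ) : ℝ) ≤ ((8 ^ k : ℕ) : ℝ) := by exact_mod_cast pow_eight_le hk
    have h3 := two_pow_le_base_pow hk0 (3 * k)
    have h4 : (2 : ℝ) ^ (3 * k) = 8 ^ k := by rw [pow_mul]; norm_num
    have h5 : k * (3 * k) = 3 * k ^ 2 := by ring
    rw [h4, h5] at h3
    push_cast at h2
    exact h2.trans h3
  have h2 := Real.logb_le_logb_of_le (one_lt_base hk0) (by positivity) h1
  rw [Real.logb_pow, Real.logb_pow, Real.logb_self_eq_one (one_lt_base hk0)] at h2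
  push_cast at h2
  linarith

theorem xi_le (hk : 8 ≤ k) (hℓ : ℓ ≤ 5) : xi k ℓ ≤ 2 * k ^ 2 := by
  have hkr : (8 : ℝ) ≤ k := by exact_mod_cast hk
  have hl : (ℓ : ℝ) ≤ 5 := by exact_mod_cast hℓ
  unfold xi
  rw [Nat.ceil_le]
  have h : 1 / delta k = k := by unfold delta; simp
  rw [h]
  have h0 : 0 ≤ Real.logb (base k) k :=
    Real.logb_nonneg (one_lt_base (by omega)) (by linarith)
  have := logb_le hk
  push_cast
  nlinarith

theorem yExp_lt (hk : 8 ≤ k) (hℓ : ℓ ≤ 5) : yExp k ℓ + 1 ≤ 2 * k ^ 8 := by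
  have h1 : k ^ (ℓ + 1) ≤ k ^ 6 := Nat.pow_le_pow_right (by omega) (by omega)
  have h2 : xi k ℓ * k ^ (ℓ + 1) ≤ 2 * k ^ 2 * k ^ 6 := Nat.mul_le_mul (xi_le hk hℓ) h1
  have h3 : 2 * k ^ 2 * k ^ 6 = 2 * k ^ 8 := by ring
  have h4 : 0 < k ^ 8 := by positivity
  unfold yExp
  omega

theorem base_pow_mul_gam (k ℓ : ℕ) : base k ^ yExp k ℓ * gam k ℓ = delta k ^ 12 := by
  unfold gam
  rw [mul_div_cancel₀ _ (pow_pos (base_pos k) _).ne']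

theorem gam_le_zpow_gamExp (hk : 0 < k) : gam k ℓ ≤ base k ^ gamExp k ℓ := by
  have h := Int.le_ceil (Real.logb (base k) (gam k ℓ))
  rw [Real.logb_le_iff_le_rpow (one_lt_base hk) (gam_pos hk ℓ)] at h
  rwa [Real.rpow_intCast] at h

theorem zpow_gamExp_lt (hk : 0 < k) : base k ^ (gamExp k ℓ - 1) < gam k ℓ := by
  have h := Int.ceil_lt_add_one (Real.logb (base k) (gam k ℓ))
  rw [← sub_lt_iff_lt_add, Real.lt_logb_iff_rpow_lt (one_lt_base hk) (gam_pos hk ℓ)] at h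
  have h2 : ((⌈Real.logb (base k) (gam k ℓ)⌉ : ℤ) : ℝ) - 1
      = ((gamExp k ℓ - 1 : ℤ) : ℝ) := by unfold gamExp; push_cast; rfl
  rw [h2, Real.rpow_intCast] at h
  exact h

/-- Distinct exponents below A are dominated by the full geometric series, whose value relative to
its largest term is (1+δ)/δ = k+1. -/
theorem sum_zpow_le (hk : 0 < k) (S : Finset ℤ) (A : ℤ) (hS : ∀ i ∈ S, i ≤ A) :
    ∑ i ∈ S, base k ^ i ≤ (k + 1) * base k ^ A := by
  have hb := base_pos k
  induction S using Finset.induction_on_max generalizing A with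
  | empty => simp only [sum_empty]; positivity
  | insert a S ha ih =>
    rw [sum_insert fun h => (ha a h).false]
    have h1 := ih (a - 1) fun i hi => by have := ha i hi; omega
    have h2 : base k ^ a = base k ^ (a - 1) * base k := by
      rw [← zpow_add_one₀ hb.ne']; simp
    have h3 : base k ^ a ≤ base k ^ A :=
      zpow_le_zpow_right₀ (one_lt_base hk).le (hS a (mem_insert_self _ _))
    have h4 := base_eq hk
    have h5 : base k ^ a + (k + 1) * base k ^ (a - 1) = (k + 1) * base k ^ a := by
      rw [h2]
      calc base k ^ (a - 1) * base k + (k + 1) * base k ^ (a - 1)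
          = base k ^ (a - 1) * (base k + (k + 1)) := by ring
        _ = base k ^ (a - 1) * (base k + base k * k) := by rw [h4]
        _ = (k + 1) * (base k ^ (a - 1) * base k) := by ring
    have h6 : ((k : ℝ) + 1) * base k ^ a ≤ (k + 1) * base k ^ A := by gcongr
    linarith

end parameters

/-! ### Enlarged configurations -/

open BoundedInstance

namespace Config

variable {k ℓ : ℕ} {I : BoundedInstance k ℓ} (C : Config I)

theorem largeWork_nonneg (r : Fin (yExp k ℓ + 1)) : 0 ≤ C.largeWork r :=
  sum_nonneg fun _ _ => mul_nonneg (zpow_pos (base_pos k) _).le (Nat.cast_nonneg _)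

theorem smallWork_nonneg (r : Fin (yExp k ℓ + 1)) : 0 ≤ C.smallWork r :=
  mul_nonneg (Nat.cast_nonneg _) C.U_nonneg

theorem total_nonneg (r : Fin (yExp k ℓ + 1)) : 0 ≤ C.total r :=
  add_nonneg (C.largeWork_nonneg r) (C.smallWork_nonneg r)

theorem speed_pos : 0 < C.speed := zpow_pos (base_pos k) _

theorem U_eq : C.U * base k = gam k ℓ * base k ^ C.j1 := by
  unfold U
  rw [mul_assoc, ← zpow_add_one₀ (base_pos k).ne']
  simp

/-- The rounding in ⌈log γ⌉ goes the right way: even the largest small size does not exceed U. -/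
theorem zpow_small_le_U (hk : 0 < k) : base k ^ (C.j1 - 2 + gamExp k ℓ) ≤ C.U := by
  unfold U
  have h := zpow_gamExp_lt (ℓ := ℓ) hk
  have : C.j1 - 2 + gamExp k ℓ = (gamExp k ℓ - 1) + (C.j1 - 1) := by ring
  rw [this, zpow_add₀ (base_pos k).ne']
  exact mul_le_mul_of_nonneg_right h.le (zpow_pos (base_pos k) _).le

open Classical in
/-- The exponents of the sizes that are small for the configuration. -/
def smallIdx : Finset I.sizes := univ.filter fun i : I.sizes => C.IsSmallExp (i : ℤ)

theorem mem_smallIdx {i : I.sizes} : i ∈ C.smallIdx ↔ C.IsSmallExp i := by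
  simp [smallIdx]

/-- One job of each small size is all that rounding up Y/X can add for one density. -/
theorem sum_small_le (hk : 0 < k) :
    ∑ i ∈ C.smallIdx, base k ^ (i : ℤ) ≤ (k + 1) * C.U := by
  have h1 : ∑ i ∈ C.smallIdx, base k ^ (i : ℤ)
      = ∑ i ∈ C.smallIdx.image (fun i : I.sizes => (i : ℤ)), base k ^ i := by
    rw [sum_image fun a _ b _ h => Subtype.ext h]
  rw [h1]
  refine (sum_zpow_le hk _ (C.j1 - 2 + gamExp k ℓ) fun _ hi => ?_).trans ?_
  · obtain ⟨a, ha, rfl⟩ := mem_image.1 hi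
    exact C.mem_smallIdx.1 ha
  have := C.zpow_small_le_U hk
  gcongr

/-- The factor (1+δ)^(-y) of γ cancels the largest density. What remains is 2k^8 densities times k+2
≤ 5k/4 times δ^12, that is (5/2)/k³. -/
theorem base_pow_mul_U_le (hk : 8 ≤ k) (hℓ : ℓ ≤ 5) :
    base k ^ yExp k ℓ * (((yExp k ℓ : ℝ) + 1) * ((k + 2) * C.U))
      ≤ 5 / 2 / k ^ 3 * base k ^ C.j1 := by
  have hk0 : 0 < k := by omega
  have hkr : (8 : ℝ) ≤ k := by exact_mod_cast hk
  have hu : 0 < base k ^ C.j1 := zpow_pos (base_pos k) _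
  have h1 : base k ^ yExp k ℓ * C.U ≤ delta k ^ 12 * base k ^ C.j1 := by
    have h := C.U_eq
    have h2 : C.U ≤ gam k ℓ * base k ^ C.j1 := by
      rw [← h]
      exact le_mul_of_one_le_right C.U_nonneg (one_lt_base hk0).le
    rw [← base_pow_mul_gam k ℓ, mul_assoc]
    exact mul_le_mul_of_nonneg_left h2 (pow_pos (base_pos k) _).le
  have h2 : (yExp k ℓ : ℝ) + 1 ≤ 2 * k ^ 8 := by exact_mod_cast yExp_lt hk hℓ
  calc base k ^ yExp k ℓ * (((yExp k ℓ : ℝ) + 1) * ((k + 2) * C.U))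
      = ((yExp k ℓ : ℝ) + 1) * (k + 2) * (base k ^ yExp k ℓ * C.U) := by ring
    _ ≤ (2 * k ^ 8) * (5 / 4 * k) * (delta k ^ 12 * base k ^ C.j1) := by
        have h3 : (k : ℝ) + 2 ≤ 5 / 4 * k := by linarith
        have h0 : 0 ≤ base k ^ yExp k ℓ * C.U :=
          mul_nonneg (pow_pos (base_pos k) _).le C.U_nonneg
        gcongr
    _ = 5 / 2 / k ^ 3 * base k ^ C.j1 := by
        unfold delta
        field_simp
        norm_num

variable {X : Config I → ℝ} {Y : Fin (yExp k ℓ + 1) → I.sizes → Config I → ℝ}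

theorem need_le (hX : 0 ≤ X C) (hYn : ∀ r i, 0 ≤ Y r i C)
    (hY0 : ∀ r (i : I.sizes), ¬ C.IsSmallExp (i : ℤ) → Y r i C = 0) (r : Fin (yExp k ℓ + 1)) (i : I.sizes) :
    (need X Y C r i : ℝ) ≤ C.large r i + Y r i C / X C + (open Classical in if C.IsSmallExp i then 1 else 0) := by
  unfold need
  push_cast
  have h0 : 0 ≤ Y r i C / X C := div_nonneg (hYn r i) hX
  by_cases h : C.IsSmallExp i
  · rw [if_pos h]
    linarith [Nat.ceil_lt_add_one h0]
  · rw [if_neg h, hY0 r i h]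
    simp

/-- The space constraint, divided by X, allows (t_r+1)U, one unit more than cost(C) accounts for;
rounding up adds at most (k+1)U. -/
theorem sizeSum_need_le (hk : 0 < k) (hX : 0 ≤ X C) (hYn : ∀ r i, 0 ≤ Y r i C)
    (hY0 : ∀ r (i : I.sizes), ¬ C.IsSmallExp (i : ℤ) → Y r i C = 0)
    (hspace : ∀ r, ∑ i ∈ C.smallIdx, base k ^ (i : ℤ) * Y r i C
      ≤ ((C.t r : ℝ) + 1) * C.U * X C) (r : Fin (yExp k ℓ + 1)) :
    I.sizeSum (fun r i => need X Y C r i) r ≤ C.total r + (k + 2) * C.U := by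
  classical
  have hb := base_pos k
  have h1 : I.sizeSum (fun r i => need X Y C r i) r
      ≤ C.largeWork r + (∑ i : I.sizes, base k ^ (i : ℤ) * (Y r i C / X C)
        + ∑ i ∈ C.smallIdx, base k ^ (i : ℤ)) := by
    unfold sizeSum largeWork
    simp only [smallIdx, sum_filter]
    rw [← sum_add_distrib, ← sum_add_distrib]
    refine sum_le_sum fun i _ => ?_
    have h := mul_le_mul_of_nonneg_left (C.need_le hX hYn hY0 r i) (zpow_pos hb (i : ℤ)).le
    refine h.trans (le_of_eq ?_)
    split_ifs <;> ring
  have h2 : ∑ i : I.sizes, base k ^ (i : ℤ) * (Y r i C / X C) ≤ ((C.t r : ℝ) + 1) * C.U := by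
    -- If X = 0, the quotients Y/X are 0 by the convention for division.
    rcases hX.eq_or_lt with h | h
    · simp only [← h, div_zero, mul_zero, sum_const_zero]
      exact mul_nonneg (by positivity) C.U_nonneg
    · have h3 : ∑ i : I.sizes, base k ^ (i : ℤ) * (Y r i C / X C)
          = (∑ i ∈ C.smallIdx, base k ^ (i : ℤ) * Y r i C) / X C := by
        simp only [smallIdx, sum_filter]
        rw [sum_div]
        refine sum_congr rfl fun i _ => ?_
        split_ifs with h'
        · ring
        · rw [hY0 r i h']; simp
      rw [h3, div_le_iff₀ h]
      exact hspace r
  have h3 := C.sum_small_le hk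
  unfold total smallWork
  linarith

/-- The jobs added by rounding up have sizes at most U, so the sum of their squares is at most U
times the sum of their sizes. -/
theorem diagSum_need_le (hk : 0 < k) (hX : 0 ≤ X C) (hYn : ∀ r i, 0 ≤ Y r i C)
    (hY0 : ∀ r (i : I.sizes), ¬ C.IsSmallExp (i : ℤ) → Y r i C = 0) :
    I.diagSum (fun r i => need X Y C r i) ≤ (I.diagSum fun r i => C.large r i)
      + (I.diagSum fun r i => Y r i C / X C)
      + base k ^ yExp k ℓ * (((yExp k ℓ : ℝ) + 1) * ((k + 2) * C.U)) * C.U / 2 := by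
  classical
  have hb := base_pos k
  have hU := C.U_nonneg
  have h1 : I.diagSum (fun r i => need X Y C r i) ≤ (I.diagSum fun r i => C.large r i)
      + (I.diagSum fun r i => Y r i C / X C)
      + ∑ r : Fin (yExp k ℓ + 1), ∑ i ∈ C.smallIdx,
          base k ^ (((r : ℕ) : ℤ) + 2 * (i : ℤ)) / 2 := by
    unfold diagSum
    rw [← sum_add_distrib, ← sum_add_distrib]
    refine sum_le_sum fun r _ => ?_
    simp only [smallIdx, sum_filter]
    rw [← sum_add_distrib, ← sum_add_distrib]
    refine sum_le_sum fun i _ => ?_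
    have h := mul_le_mul_of_nonneg_left (C.need_le hX hYn hY0 r i)
      (zpow_pos hb (((r : ℕ) : ℤ) + 2 * (i : ℤ))).le
    split_ifs at h ⊢ <;> linarith
  have h2 : ∀ r : Fin (yExp k ℓ + 1), ∑ i ∈ C.smallIdx,
      base k ^ (((r : ℕ) : ℤ) + 2 * (i : ℤ)) / 2 ≤ base k ^ yExp k ℓ * ((k + 2) * C.U) * C.U / 2 := by
    intro r
    have h3 : ∀ i ∈ C.smallIdx,
        base k ^ (((r : ℕ) : ℤ) + 2 * (i : ℤ)) / 2
          ≤ base k ^ yExp k ℓ * C.U / 2 * base k ^ (i : ℤ) := by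
      intro i hi
      have hi' : base k ^ (i : ℤ) ≤ C.U := (zpow_le_zpow_right₀ (one_lt_base hk).le
        (C.mem_smallIdx.1 hi)).trans (C.zpow_small_le_U hk)
      have hr : base k ^ (r : ℕ) ≤ base k ^ yExp k ℓ :=
        pow_le_pow_right₀ (one_lt_base hk).le (by omega)
      rw [zpow_add₀ hb.ne', zpow_natCast, two_mul, zpow_add₀ hb.ne']
      have hp := zpow_pos hb (i : ℤ)
      have : base k ^ (r : ℕ) * base k ^ (i : ℤ) ≤ base k ^ yExp k ℓ * C.U :=
        mul_le_mul hr hi' hp.le (by positivity)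
      nlinarith
    refine (sum_le_sum h3).trans ?_
    rw [← mul_sum]
    have h4 := C.sum_small_le hk
    have h5 : (k + 1 : ℝ) * C.U ≤ (k + 2) * C.U := by nlinarith
    have h6 : 0 ≤ base k ^ yExp k ℓ * C.U / 2 := by positivity
    nlinarith [mul_le_mul_of_nonneg_left (h4.trans h5) h6]
  have h3 := sum_le_sum fun r (_ : r ∈ (univ : Finset (Fin (yExp k ℓ + 1)))) => h2 r
  rw [sum_const, card_univ, Fintype.card_fin, nsmul_eq_mul] at h3
  push_cast at h3
  linarith

theorem sum_total (C : Config I) : ∑ r, C.total r = C.work := rfl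

/-- By validity (1+δ)^j1 is at most (1+δ)² times the work, and 20 (9/8)^4 < 64 ≤ k². -/
theorem work_sq_le (hk : 8 ≤ k) (hC : C.IsValid) :
    20 * (base k ^ C.j1) ^ 2 ≤ k ^ 2 * C.work ^ 2 := by
  have hb := base_pos k
  have hkr : (8 : ℝ) ≤ k := by exact_mod_cast hk
  have h1 := hC.work_gt
  have h2 : base k ^ C.j1 = base k ^ (C.j1 - 2) * base k ^ 2 := by
    rw [← zpow_natCast, ← zpow_add₀ hb.ne']; congr 1; norm_num
  have h3 : base k ^ C.j1 ≤ C.work * base k ^ 2 := by rw [h2]; gcongr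
  have h4 : (base k ^ 2) ^ 2 ≤ ((9 / 8) ^ 2) ^ 2 := by
    have := base_le hk
    gcongr
  have h5 : 0 < base k ^ C.j1 := zpow_pos hb _
  have h6 : (base k ^ C.j1) ^ 2 ≤ C.work ^ 2 * (base k ^ 2) ^ 2 := by
    rw [← mul_pow]; gcongr
  have h7 : (64 : ℝ) ≤ k ^ 2 := by nlinarith
  nlinarith [mul_le_mul_of_nonneg_left h4 (sq_nonneg C.work), mul_le_mul_of_nonneg_right h7 (sq_nonneg C.work)]

theorem sizeSum_need_nonneg (r : Fin (yExp k ℓ + 1)) :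
    0 ≤ I.sizeSum (fun r i => need X Y C r i) r :=
  sum_nonneg fun _ _ => mul_nonneg (zpow_pos (base_pos k) _).le (Nat.cast_nonneg _)

theorem diagSum_nonneg {N : Fin (yExp k ℓ + 1) → I.sizes → ℝ} (hN : ∀ r i, 0 ≤ N r i) :
    0 ≤ I.diagSum N := by
  refine sum_nonneg fun r _ => sum_nonneg fun i _ => ?_
  have := hN r i
  have := zpow_pos (base_pos k) (((r : ℕ) : ℤ) + 2 * (i : ℤ))
  positivity

theorem sum_sizeSum_need_le (hk : 8 ≤ k) (hℓ : ℓ ≤ 5) (hC : C ∈ configs I)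
    (hfeas : IsFeasible I X Y) :
    ∑ r, I.sizeSum (fun r i => need X Y C r i) r ≤ 2 * base k ^ C.j1 := by
  classical
  have hk0 : 0 < k := by omega
  have hkr : (8 : ℝ) ≤ k := by exact_mod_cast hk
  have hv : C.IsValid := (finite_valid I).mem_toFinset.1 hC
  have h1 := sum_le_sum fun r (_ : r ∈ (univ : Finset (Fin (yExp k ℓ + 1)))) =>
    C.sizeSum_need_le (X := X) (Y := Y) hk0 (hfeas.X_nonneg C hC) (fun r i => hfeas.Y_nonneg r i C hC)
    (fun r i => hfeas.Y_eq_zero r i C hC) (hfeas.space · C hC) r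
  rw [sum_add_distrib, sum_total, sum_const, card_univ, Fintype.card_fin, nsmul_eq_mul] at h1
  push_cast at h1
  have h2 := C.base_pow_mul_U_le hk hℓ
  have h3 : 1 ≤ base k ^ yExp k ℓ := one_le_pow₀ (one_lt_base hk0).le
  have h4 : 0 ≤ ((yExp k ℓ : ℝ) + 1) * ((k + 2) * C.U) :=
    mul_nonneg (by positivity) (mul_nonneg (by positivity) C.U_nonneg)
  have h5 := hv.work_le
  have h6 : (5 : ℝ) / 2 / k ^ 3 ≤ 1 := by
    rw [div_le_one (by positivity)]
    nlinarith [pow_le_pow_left₀ (by norm_num) hkr 3]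
  have h7 := zpow_pos (base_pos k) C.j1
  nlinarith [mul_le_mul_of_nonneg_right h3 h4, mul_le_mul_of_nonneg_right h6 h7.le]

/-- The excess is of order k^(-3) relative to the squared work, hence below δ/2 times the quadratic
form. The diagonal part of Y/X keeps the factor 1, as it is already paid for in the objective. -/
theorem need_cost_le (hk : 8 ≤ k) (hℓ : ℓ ≤ 5) (hC : C ∈ configs I)
    (hfeas : IsFeasible I X Y) :
    quadForm (base k) (I.sizeSum fun r i => need X Y C r i) + I.diagSum (fun r i => need X Y C r i)
      ≤ (1 + delta k / 2) * (quadForm (base k) C.total + I.diagSum fun r i => C.large r i)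
        + I.diagSum fun r i => Y r i C / X C := by
  classical
  have hk0 : 0 < k := by omega
  have hkr : (8 : ℝ) ≤ k := by exact_mod_cast hk
  have hv : C.IsValid := (finite_valid I).mem_toFinset.1 hC
  have hb1 := (one_lt_base hk0).le
  have hX := hfeas.X_nonneg C hC
  have hYn := fun r i => hfeas.Y_nonneg r i C hC
  have hY0 := fun r i => hfeas.Y_eq_zero r i C hC
  have hU := C.U_nonneg
  have hE : 0 ≤ (k + 2) * C.U := mul_nonneg (by positivity) hU
  have h1 : quadForm (base k) (I.sizeSum fun r i => need X Y C r i)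
      ≤ quadForm (base k) fun r => C.total r + (k + 2) * C.U :=
    quadForm_mono hb1 C.sizeSum_need_nonneg fun r =>
      C.sizeSum_need_le hk0 hX hYn hY0 (hfeas.space · C hC) r
  have h2 := quadForm_add_le hb1 C.total_nonneg (E := fun _ => (k + 2) * C.U) (fun _ => hE)
    (y := yExp k ℓ) le_rfl
  have h3 := C.diagSum_need_le hk0 hX hYn hY0
  have h4 := sq_sum_le_quadForm hb1 C.total_nonneg
  rw [sum_total] at h2 h4
  rw [sum_const, card_univ, Fintype.card_fin, nsmul_eq_mul] at h2
  push_cast at h2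
  set e : ℝ := ((yExp k ℓ : ℝ) + 1) * ((k + 2) * C.U) with he
  have he0 : 0 ≤ e := mul_nonneg (by positivity) hE
  have hUe : C.U ≤ e := by
    have h5 : C.U ≤ (k + 2) * C.U := by nlinarith
    have h6 : (k + 2) * C.U ≤ e := by
      rw [he]; exact le_mul_of_one_le_left hE (by linarith [(yExp k ℓ).cast_nonneg (α := ℝ)])
    exact h5.trans h6
  have hbe := C.base_pow_mul_U_le hk hℓ
  rw [← he] at hbe
  set u := base k ^ C.j1 with hu
  have hu0 : 0 < u := zpow_pos (base_pos k) _
  have hy1 : 1 ≤ base k ^ yExp k ℓ := one_le_pow₀ hb1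
  have hbe' : e ≤ base k ^ yExp k ℓ * e := le_mul_of_one_le_left he0 hy1
  have hη : (5 : ℝ) / 2 / k ^ 3 ≤ 1 := by
    rw [div_le_one (by positivity)]
    nlinarith [pow_le_pow_left₀ (by norm_num) hkr 3]
  have heu : e ≤ u := by
    have := mul_le_mul_of_nonneg_right hη hu0.le
    linarith
  have hw := hv.work_le
  rw [← hu] at hw
  -- Here e bounds the total excess over all densities. Work, e and U are each at most u = (1+δ)^j1,
  -- so the bracket is at most 2u.
  have hextra : base k ^ yExp k ℓ * (C.work * e + e ^ 2 / 2) + base k ^ yExp k ℓ * e * C.U / 2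
      ≤ 5 / k ^ 3 * u ^ 2 := by
    calc base k ^ yExp k ℓ * (C.work * e + e ^ 2 / 2) + base k ^ yExp k ℓ * e * C.U / 2
        = base k ^ yExp k ℓ * e * (C.work + e / 2 + C.U / 2) := by ring
      _ ≤ (5 / 2 / k ^ 3 * u) * (2 * u) := by
          apply mul_le_mul hbe (by linarith)
          · have : 0 ≤ C.work := by
              have := hv.work_gt
              exact (zpow_pos (base_pos k) _).le.trans this.le
            positivity
          · positivity
      _ = 5 / k ^ 3 * u ^ 2 := by ring
  -- Over the common denominator 4k³ this is exactly the inequality 20u² ≤ k² work².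
  have hfin : 5 / k ^ 3 * u ^ 2 ≤ delta k / 2 * (C.work ^ 2 / 2) := by
    have := C.work_sq_le hk hv
    rw [← hu] at this
    have e1 : 5 / (k : ℝ) ^ 3 * u ^ 2 = (20 * u ^ 2) / (4 * k ^ 3) := by field_simp; norm_num
    have e2 : delta k / 2 * (C.work ^ 2 / 2) = (k ^ 2 * C.work ^ 2) / (4 * k ^ 3) := by
      unfold delta; field_simp
      ring
    rw [e1, e2]
    gcongr
  have hd : 0 ≤ delta k / 2 := by linarith [delta_nonneg k]
  have hD : 0 ≤ I.diagSum fun r i => (C.large r i : ℝ) := diagSum_nonneg fun _ _ => Nat.cast_nonneg _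
  nlinarith [mul_le_mul_of_nonneg_left h4 hd, mul_nonneg hd hD]

end Config

/-! ### The total size of light configurations -/

section tail

variable {k ℓ : ℕ}

theorem base_pow_le_two_pow (hk : 8 ≤ k) (n : ℕ) : base k ^ n ≤ 2 ^ n :=
  pow_le_pow_left₀ (base_pos k).le ((base_le hk).trans (by norm_num)) n

theorem natCast_le_base_pow (hk : 8 ≤ k) : (k : ℝ) ≤ base k ^ (k ^ 2) := by
  have h1 : (k : ℝ) ≤ 2 ^ k := by exact_mod_cast Nat.lt_two_pow_self.le
  rw [sq]
  exact h1.trans (two_pow_le_base_pow (by omega) k)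

theorem two_mul_natCast_le_base_pow (hk : 8 ≤ k) : 2 * (k : ℝ) ≤ base k ^ (k ^ 2) := by
  have h : ∀ n : ℕ, 8 ≤ n → 2 * n ≤ 2 ^ n := by
    intro n hn
    induction n, hn using Nat.le_induction with
    | base => norm_num
    | succ n hn ih => rw [pow_succ]; omega
  have h1 : 2 * (k : ℝ) ≤ 2 ^ k := by exact_mod_cast h k hk
  rw [sq]
  exact h1.trans (two_pow_le_base_pow (by omega) k)

/-- Since k ≤ (1+δ)^(k²), γ is at least (1+δ)^(-y-12k²). This bounds the length of the window of
large exponents. -/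
theorem neg_le_gamExp (hk : 8 ≤ k) : -((yExp k ℓ + 12 * k ^ 2 : ℕ) : ℤ) ≤ gamExp k ℓ := by
  have hb := base_pos k
  have hk0 : 0 < k := by omega
  have hkr : (0 : ℝ) < k := by exact_mod_cast hk0
  by_contra! h
  have h1 := gam_le_zpow_gamExp (ℓ := ℓ) hk0
  have h2 := zpow_lt_zpow_right₀ (one_lt_base hk0) h
  rw [zpow_neg, zpow_natCast] at h2
  have h3 : (base k ^ (yExp k ℓ + 12 * k ^ 2))⁻¹ ≤ gam k ℓ := by
    unfold gam delta
    rw [one_div, inv_pow, div_eq_mul_inv, ← mul_inv]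
    apply inv_anti₀ (by positivity)
    have := pow_le_pow_left₀ hkr.le (natCast_le_base_pow hk) 12
    rw [← pow_mul] at this
    rw [pow_add, mul_comm, mul_comm 12]
    gcongr
  linarith

/-- A strict bound for the components of a configuration. -/
def countBound (k ℓ : ℕ) : ℕ := 2 * k ^ 12 * 2 ^ yExp k ℓ + 1

theorem lt_countBound (hk : 8 ≤ k) {n : ℕ} (h : n * gam k ℓ ≤ base k) : n < countBound k ℓ := by
  have hkr : (0 : ℝ) < k := by exact_mod_cast (by omega : 0 < k)
  have hp : 0 < base k ^ yExp k ℓ := pow_pos (base_pos k) _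
  unfold countBound
  rw [Nat.lt_succ_iff, ← Nat.cast_le (α := ℝ)]
  push_cast
  have h1 : (n : ℝ) = n * gam k ℓ * (k ^ 12 * base k ^ yExp k ℓ) := by
    unfold gam delta
    field_simp
  rw [h1]
  have h2 := base_pow_le_two_pow hk (yExp k ℓ)
  have h3 : base k ≤ 2 := (base_le hk).trans (by norm_num)
  calc (n : ℝ) * gam k ℓ * ((k : ℝ) ^ 12 * base k ^ yExp k ℓ) ≤ 2 * ((k : ℝ) ^ 12 * 2 ^ yExp k ℓ) := by
        have := h.trans h3
        gcongr
    _ = 2 * (k : ℝ) ^ 12 * 2 ^ yExp k ℓ := by ring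

namespace Config

variable {I : BoundedInstance k ℓ} {C : Config I}

theorem total_le (hC : C.IsValid) (r : Fin (yExp k ℓ + 1)) : C.total r ≤ base k ^ C.j1 :=
  (single_le_sum (f := C.total) (fun r _ => C.total_nonneg r) (mem_univ r)).trans hC.work_le

theorem t_lt (hk : 8 ≤ k) (hC : C.IsValid) (r : Fin (yExp k ℓ + 1)) : C.t r < countBound k ℓ := by
  refine lt_countBound hk ?_
  have h1 : (C.t r : ℝ) * C.U ≤ base k ^ C.j1 :=
    le_trans (le_add_of_nonneg_left (C.largeWork_nonneg r)) (total_le hC r)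
  have h2 : (C.t r : ℝ) * gam k ℓ * base k ^ C.j1 ≤ base k * base k ^ C.j1 := by
    rw [mul_assoc, ← C.U_eq, ← mul_assoc, mul_comm (base k)]
    exact mul_le_mul_of_nonneg_right h1 (base_pos k).le
  exact le_of_mul_le_mul_right h2 (zpow_pos (base_pos k) _)

theorem large_lt (hk : 8 ≤ k) (hC : C.IsValid) (r : Fin (yExp k ℓ + 1)) (i : I.sizes) :
    C.large r i < countBound k ℓ := by
  have hb := base_pos k
  by_cases hi : C.IsLargeExp i
  · refine lt_countBound hk ?_
    have h0 : base k ^ (i : ℤ) * (C.large r i : ℝ) ≤ C.largeWork r :=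
      single_le_sum (f := fun i : I.sizes => base k ^ (i : ℤ) * (C.large r i : ℝ))
        (fun i _ => mul_nonneg (zpow_pos hb _).le (Nat.cast_nonneg _)) (mem_univ i)
    have h1 : base k ^ (i : ℤ) * (C.large r i : ℝ) ≤ base k ^ C.j1 :=
      (h0.trans (le_add_of_nonneg_right (C.smallWork_nonneg r))).trans (total_le hC r)
    have h2 : C.U ≤ base k ^ (i : ℤ) := by
      refine le_trans ?_ (zpow_le_zpow_right₀ (one_lt_base (by omega)).le hi.1)
      rw [add_comm, zpow_add₀ hb.ne']
      exact mul_le_mul_of_nonneg_right (gam_le_zpow_gamExp (by omega)) (zpow_pos hb _).le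
    have h3 : (C.large r i : ℝ) * C.U ≤ base k ^ C.j1 := by
      refine le_trans ?_ h1
      rw [mul_comm]
      gcongr
    have h4 : (C.large r i : ℝ) * gam k ℓ * base k ^ C.j1 ≤ base k * base k ^ C.j1 := by
      rw [mul_assoc, ← C.U_eq, ← mul_assoc, mul_comm (base k)]
      exact mul_le_mul_of_nonneg_right h3 hb.le
    exact le_of_mul_le_mul_right h4 (zpow_pos hb _)
  · rw [hC.large_eq_zero r i hi]
    exact Nat.succ_pos _

end Config

/-- A bound for the number of configurations with given work and speed. -/
def configBound (k ℓ : ℕ) : ℕ :=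
  countBound k ℓ ^ ((yExp k ℓ + 1) * (yExp k ℓ + 12 * k ^ 2 + 3) + (yExp k ℓ + 1))

variable (I : BoundedInstance k ℓ)

/-- Once j1 and j2 are fixed, a configuration is determined by its numbers of large jobs on a
bounded window of exponents below j1 and by its t, all below `countBound`. The bound does not depend
on the instance. -/
theorem card_configs_le (hk : 8 ≤ k) (a c : ℤ) :
    #{C ∈ configs I | C.j1 = a ∧ C.j2 = c} ≤ configBound k ℓ := by
  classical
  have hpos : 0 < countBound k ℓ := Nat.succ_pos _
  let A := Fin (yExp k ℓ + 1) × Fin (yExp k ℓ + 12 * k ^ 2 + 3) → Fin (countBound k ℓ)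
  let B := Fin (yExp k ℓ + 1) → Fin (countBound k ℓ)
  -- Reduction modulo the bound only serves to land in a finite type; it loses nothing on components
  -- of valid configurations.
  let cut : ℕ → Fin (countBound k ℓ) := fun x => ⟨x % countBound k ℓ, Nat.mod_lt _ hpos⟩
  have hcut : ∀ {x y}, x < countBound k ℓ → y < countBound k ℓ → cut x = cut y → x = y := by
    intro x y hx hy h
    have := congrArg Fin.val h
    simpa [cut, Nat.mod_eq_of_lt hx, Nat.mod_eq_of_lt hy] using this
  let φ : Config I → A × B := fun C =>
    (fun x => cut (if h : a - (x.2 : ℕ) ∈ I.sizes then C.large x.1 ⟨a - (x.2 : ℕ), h⟩ else 0),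
      fun r => cut (C.t r))
  have hinj : Set.InjOn φ ({C ∈ configs I | C.j1 = a ∧ C.j2 = c} : Finset (Config I)) := by
    intro C hC C' hC' h
    obtain ⟨hC1, hC2, hC3⟩ := mem_filter.1 hC
    obtain ⟨hC1', hC2', hC3'⟩ := mem_filter.1 hC'
    have hv : C.IsValid := (finite_valid I).mem_toFinset.1 hC1
    have hv' : C'.IsValid := (finite_valid I).mem_toFinset.1 hC1'
    refine Config.ext (by rw [hC2, hC2']) (by rw [hC3, hC3']) ?_ ?_
    · funext r i
      by_cases hi : C.IsLargeExp i
      · have h1 := neg_le_gamExp (ℓ := ℓ) hk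
        have h2 := hi.1
        have h3 := hi.2
        rw [hC2] at h2 h3
        have hx : (a - i).toNat < yExp k ℓ + 12 * k ^ 2 + 3 := by omega
        have hai : a - (((a - i).toNat : ℕ) : ℤ) = i := by omega
        have h4 := congrFun (congrArg Prod.fst h) (r, ⟨(a - i).toNat, hx⟩)
        simp only [φ, hai, i.2, dif_pos] at h4
        exact hcut (C.large_lt hk hv r i) (C'.large_lt hk hv' r i) h4
      · have hi' : ¬ C'.IsLargeExp i := by
          unfold Config.IsLargeExp at hi ⊢
          rwa [hC2', ← hC2]
        rw [hv.large_eq_zero r i hi, hv'.large_eq_zero r i hi']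
    · funext r
      exact hcut (C.t_lt hk hv r) (C'.t_lt hk hv' r) (congrFun (congrArg Prod.snd h) r)
  have := card_le_card_of_injOn φ (t := univ) (fun _ _ => mem_univ _) hinj
  refine this.trans (le_of_eq ?_)
  rw [card_univ, Fintype.card_prod, Fintype.card_fun, Fintype.card_fun, Fintype.card_prod]
  simp only [Fintype.card_fin]
  rw [← pow_add]
  rfl

/-- The tail of an arithmetic-geometric series in closed form; it telescopes because (k+1)/(1+δ) =
k. -/
theorem sum_linear_mul_pow_add (hk : 0 < k) (c : ℝ) {G M : ℕ} (h : G ≤ M) :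
    ∑ n ∈ Ico G M, ((n : ℝ) + c) * (base k ^ n)⁻¹ + (k + 1) * (M + c + k) * (base k ^ M)⁻¹
      = (k + 1) * (G + c + k) * (base k ^ G)⁻¹ := by
  have hb := base_pos k
  induction M, h using Nat.le_induction with
  | base => simp
  | succ M hM ih =>
    rw [sum_Ico_succ_top hM, ← ih, pow_succ]
    have h1 := base_eq hk
    have h2 : ((k : ℝ) + 1) * (base k ^ M * base k)⁻¹ = k * (base k ^ M)⁻¹ := by
      rw [← h1]; field_simp
    push_cast
    calc _ = ∑ n ∈ Ico G M, ((n : ℝ) + c) * (base k ^ n)⁻¹ + ((M : ℝ) + c) * (base k ^ M)⁻¹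
          + (M + 1 + c + k) * ((k + 1) * (base k ^ M * base k)⁻¹) := by ring
      _ = _ := by rw [h2]; ring

/-- The load bound reads (1+δ)^(j1-j2-2) < 2k ≤ (1+δ)^(k²). It makes heavy configurations fast, and
leaves only linearly many speeds for a given light work. -/
theorem j2_ge (hk : 8 ≤ k) {C : Config I} (hC : C.IsValid) : C.j1 - 1 - k ^ 2 ≤ C.j2 := by
  have h1 := hC.load_lt
  have h2 : (2 : ℝ) / delta k = 2 * k := by unfold delta; simp
  rw [h2] at h1
  have h3 := h1.trans_le (two_mul_natCast_le_base_pow hk)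
  rw [← zpow_natCast] at h3
  have h4 := (zpow_lt_zpow_iff_right₀ (one_lt_base (k := k) (by omega))).1 h3
  unfold Config.j3 at h4
  push_cast at h4
  omega

theorem sum_light_le (hk : 8 ≤ k) (G : ℕ) :
    ∑ C ∈ configs I with C.j1 ≤ -(G : ℤ), base k ^ C.j1
      ≤ configBound k ℓ * ((k + 1) * (G + (k ^ 2 + 2) + k) * (base k ^ G)⁻¹) := by
  classical
  have hb := base_pos k
  have hvalid : ∀ C ∈ configs I, C.IsValid := fun C hC => (finite_valid I).mem_toFinset.1 hC
  -- Any number beyond all -j1 will do: it makes the tail a finite sum.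
  set M : ℕ := G + ∑ C ∈ configs I, ((-C.j1).toNat + 1) with hM
  set S := (configs I).filter fun C => C.j1 ≤ -(G : ℤ) with hS
  -- Pairs (-j1, -j2) of light configurations: j2 ≤ 0, and the load bound leaves n + k² + 2 values
  -- of -j2 when -j1 = n.
  set T : Finset (Σ _ : ℕ, ℕ) := (Ico G M).sigma fun n => range (n + (k ^ 2 + 2)) with hT
  let φ : Config I → (Σ _ : ℕ, ℕ) := fun C => ⟨(-C.j1).toNat, (-C.j2).toNat⟩
  have hφ : ∀ C ∈ S, φ C ∈ T := by
    intro C hC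
    obtain ⟨hC1, hC2⟩ := mem_filter.1 hC
    have h1 := single_le_sum (f := fun C : Config I => (-C.j1).toNat + 1)
      (fun _ _ => Nat.zero_le _) hC1
    have h2 := j2_ge I hk (hvalid C hC1)
    obtain ⟨q, hq⟩ := (hvalid C hC1).j2_mem
    simp only [T, φ, mem_sigma, mem_Ico, mem_range]
    have h3 : ((k ^ 2 : ℕ) : ℤ) = (k : ℤ) ^ 2 := by push_cast; rfl
    rw [← h3] at h2
    refine ⟨⟨by omega, by omega⟩, by omega⟩
  rw [← sum_fiberwise_of_maps_to hφ]
  have h1 : ∀ x ∈ T, ∑ C ∈ S with φ C = x, base k ^ C.j1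
      ≤ configBound k ℓ * (base k ^ x.1)⁻¹ := by
    rintro ⟨n, v⟩ _
    have h2 : ∀ C ∈ S.filter (fun C => φ C = ⟨n, v⟩), C.j1 = -(n : ℤ) ∧ C.j2 = -(v : ℤ) := by
      intro C hC
      obtain ⟨hC1, hC2⟩ := mem_filter.1 hC
      obtain ⟨hC3, hC4⟩ := mem_filter.1 hC1
      obtain ⟨q, hq⟩ := (hvalid C hC3).j2_mem
      simp only [φ, Sigma.mk.injEq, heq_eq_eq] at hC2
      omega
    have h3 : ∀ C ∈ S.filter (fun C => φ C = ⟨n, v⟩), base k ^ C.j1 = (base k ^ n)⁻¹ := by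
      intro C hC
      rw [(h2 C hC).1, zpow_neg, zpow_natCast]
    rw [sum_congr rfl h3, sum_const, nsmul_eq_mul]
    have h4 : #(S.filter fun C => φ C = ⟨n, v⟩) ≤ configBound k ℓ := by
      refine le_trans (card_le_card fun C hC => ?_) (card_configs_le I hk (-(n : ℤ)) (-(v : ℤ)))
      exact mem_filter.2 ⟨(mem_filter.1 (mem_filter.1 hC).1).1, h2 C hC⟩
    have : (0 : ℝ) < (base k ^ n)⁻¹ := by positivity
    gcongr
  refine (sum_le_sum h1).trans ?_
  rw [hT, sum_sigma, ← sum_linear_mul_pow_add (by omega) ((k : ℝ) ^ 2 + 2) (Nat.le_add_right G _),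
    ← hM, mul_add, mul_sum]
  refine le_add_of_le_of_nonneg (sum_le_sum fun n _ => le_of_eq ?_) (by positivity)
  change ∑ _s ∈ range (n + (k ^ 2 + 2)), (configBound k ℓ : ℝ) * (base k ^ n)⁻¹ = _
  rw [sum_const, card_range, nsmul_eq_mul]
  push_cast
  ring

/-- Apart from the factor H, the left side is at most 2^A where A has order k^24, so H ≥ k^28 is
ample. -/
theorem tail_numeric (hk : 8 ≤ k) (hℓ : ℓ ≤ 5) {H : ℕ} (hH : k ^ 28 ≤ H) :
    140 * k ^ 2 * 2 ^ yExp k ℓ * (configBound k ℓ * ((k + 1) * (k * H + (k ^ 2 + 2) + k))) ≤ 2 ^ H := by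
  have hy := yExp_lt hk hℓ
  set y := yExp k ℓ with hydef
  have hk2 : k ≤ 2 ^ k := Nat.lt_two_pow_self.le
  have hpow : ∀ n, k ^ n ≤ 2 ^ (n * k) := fun n => by
    rw [mul_comm, pow_mul]; exact Nat.pow_le_pow_left hk2 n
  have hD : countBound k ℓ ≤ 2 ^ (12 * k + y + 2) := by
    have h1 := Nat.mul_le_mul_right (2 * 2 ^ y) (hpow 12)
    have h2 : 2 ^ (12 * k) * (2 * 2 ^ y) * 2 = 2 ^ (12 * k + y + 2) := by
      rw [pow_add, pow_add]; ring
    have h3 : 0 < 2 ^ (12 * k) * (2 * 2 ^ y) := by positivity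
    have h4 : countBound k ℓ = k ^ 12 * (2 * 2 ^ y) + 1 := by unfold countBound; ring
    omega
  set E := (y + 1) * (y + 12 * k ^ 2 + 3) + (y + 1) with hE
  have hK : configBound k ℓ ≤ 2 ^ ((12 * k + y + 2) * E) := by
    rw [pow_mul]; exact Nat.pow_le_pow_left hD E
  have hk8 : 8 * k ^ 7 ≤ k ^ 8 := by
    rw [pow_succ k 7, mul_comm 8]; exact Nat.mul_le_mul_left _ hk
  have hk1 : k ≤ k ^ 7 := Nat.le_self_pow (by norm_num) k
  have hk27 : k ^ 2 ≤ k ^ 7 := Nat.pow_le_pow_right (by omega) (by norm_num)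
  have h1 : 12 * k + y + 2 ≤ 4 * k ^ 8 := by omega
  have h2 : E ≤ 2 * k ^ 8 * (4 * k ^ 8) := by
    have : E = (y + 1) * (y + 12 * k ^ 2 + 4) := by rw [hE]; ring
    rw [this]
    exact Nat.mul_le_mul hy (by omega)
  have h3 : (12 * k + y + 2) * E ≤ 32 * k ^ 24 :=
    (Nat.mul_le_mul h1 h2).trans (le_of_eq (by ring))
  have h4 : k ^ 8 ≤ k ^ 24 := Nat.pow_le_pow_right (by omega) (by norm_num)
  have h5 : 4096 * k ^ 24 ≤ H := by
    have : 4096 ≤ k ^ 4 := (by norm_num : 4096 = 8 ^ 4) ▸ Nat.pow_le_pow_left hk 4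
    calc 4096 * k ^ 24 ≤ k ^ 4 * k ^ 24 := Nat.mul_le_mul_right _ this
      _ = k ^ 28 := by ring
      _ ≤ H := hH
  have h6 : k * H + (k ^ 2 + 2) + k ≤ 2 ^ 2 * 2 ^ k * H := by
    have a1 : k * H ≤ 2 ^ k * H := Nat.mul_le_mul_right _ hk2
    have a2 : H ≤ 2 ^ k * H := Nat.le_mul_of_pos_left _ (by positivity)
    have a3 : k ^ 2 + 2 + k ≤ H := by omega
    have a4 : 2 ^ 2 * 2 ^ k * H = 4 * (2 ^ k * H) := by ring
    omega
  have h7 : k + 1 ≤ 2 * 2 ^ k := by omega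
  -- The summands are the exponents of powers of two bounding 140k², 2^y, the number of
  -- configurations, k+1, and the last factor divided by H.
  set A := (8 + 2 * k) + y + ((12 * k + y + 2) * E + ((1 + k) + (2 + k))) with hA
  have hAH : 2 * A ≤ H := by omega
  calc 140 * k ^ 2 * 2 ^ y * (configBound k ℓ * ((k + 1) * (k * H + (k ^ 2 + 2) + k)))
      ≤ 2 ^ 8 * 2 ^ (2 * k) * 2 ^ y * (2 ^ ((12 * k + y + 2) * E) * (2 * 2 ^ k * (2 ^ 2 * 2 ^ k * H))) := by
        exact Nat.mul_le_mul (Nat.mul_le_mul (Nat.mul_le_mul (by norm_num) (hpow 2)) le_rfl)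
          (Nat.mul_le_mul hK (Nat.mul_le_mul h7 h6))
    _ = 2 ^ A * H := by
        rw [hA, pow_add, pow_add, pow_add 2 8, pow_add, pow_add _ (1 + k), pow_add 2 1, pow_add 2 2]
        ring
    _ ≤ 2 ^ A * 2 ^ (H - A) := by
        gcongr
        have : ∀ n : ℕ, 1 ≤ n → 2 * n ≤ 2 ^ n := by
          intro n hn
          induction n, hn using Nat.le_induction with
          | base => norm_num
          | succ n hn ih => rw [pow_succ]; omega
        have := this (H - A) (by omega)
        omega
    _ = 2 ^ H := by rw [← pow_add]; congr 1; omega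

/-- The factor 70k² = 7k · 10k is what the host needs: a load of at most 7k against an allowance of
1/(10k). -/
theorem sum_light_work_le (hk : 8 ≤ k) (hℓ : ℓ ≤ 5) :
    70 * k ^ 2 * base k ^ yExp k ℓ * ∑ C ∈ configs I with C.j1 ≤ gExp k, 2 * base k ^ C.j1 ≤ 1 := by
  -- Writing g = -kH with H = k^(k^300 - 1) makes (1+δ)^(-g) at least 2^H.
  obtain ⟨H, hH1, hH2⟩ : ∃ H : ℕ, k ^ 28 ≤ H ∧ gExp k = -((k * H : ℕ) : ℤ) := by
    obtain ⟨Q, hQ, h2⟩ : ∃ Q, k ^ 300 = Q ∧ k ^ 2 ≤ Q :=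
      ⟨_, rfl, Nat.pow_le_pow_right (by omega) (by norm_num)⟩
    have h3 : 8 * 8 ≤ k ^ 2 := by rw [sq]; exact Nat.mul_le_mul hk hk
    have h1 : Q = (Q - 1) + 1 := by omega
    refine ⟨k ^ (Q - 1), Nat.pow_le_pow_right (by omega) (by omega), ?_⟩
    unfold gExp
    rw [hQ, mul_comm, ← pow_succ, ← h1]
    push_cast
    rfl
  rw [hH2, ← mul_sum]
  have h1 := sum_light_le I hk (k * H)
  have h2 : (2 : ℝ) ^ H ≤ base k ^ (k * H) := two_pow_le_base_pow (by omega) H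
  have h3 : (140 * k ^ 2 * 2 ^ yExp k ℓ * (configBound k ℓ * ((k + 1) * (k * H + (k ^ 2 + 2) + k))) : ℝ)
      ≤ 2 ^ H := by exact_mod_cast tail_numeric hk hℓ hH1
  have hp : 0 < base k ^ (k * H) := pow_pos (base_pos k) _
  have h4 := base_pow_le_two_pow hk (yExp k ℓ)
  have h0 : 0 ≤ ∑ C ∈ configs I with C.j1 ≤ -((k * H : ℕ) : ℤ), base k ^ C.j1 :=
    sum_nonneg fun _ _ => (zpow_pos (base_pos k) _).le
  push_cast at h1 h0 ⊢
  calc _ ≤ 70 * (k : ℝ) ^ 2 * 2 ^ yExp k ℓ * (2 * (configBound k ℓ *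
        ((k + 1) * (k * H + (k ^ 2 + 2) + k) * (base k ^ (k * H))⁻¹))) := by
        gcongr
    _ = (140 * k ^ 2 * 2 ^ yExp k ℓ * (configBound k ℓ * ((k + 1) * (k * H + (k ^ 2 + 2) + k))))
        * (base k ^ (k * H))⁻¹ := by ring
    _ ≤ base k ^ (k * H) * (base k ^ (k * H))⁻¹ := by
        have := h3.trans h2
        gcongr
    _ = 1 := mul_inv_cancel₀ hp.ne'

end tail

/-! ### The cost of the rounded solution -/

namespace BoundedInstance

variable {k ℓ : ℕ} {I : BoundedInstance k ℓ} {X : Config I → ℝ}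
  {Y : Fin (yExp k ℓ + 1) → I.sizes → Config I → ℝ} {L : List (Config I)}

theorem objective_eq : objective I X Y = ∑ C ∈ configs I,
    (X C * (quadForm (base k) C.total + I.diagSum fun r i => C.large r i)
      + I.diagSum fun r i => Y r i C) / C.speed := by
  unfold objective
  have h : ∑ r : Fin (yExp k ℓ + 1), ∑ i : I.sizes, base k ^ (((r : ℕ) : ℤ) + 2 * (i : ℤ)) *
      ∑ C ∈ configs I, Y r i C / (2 * base k ^ C.j2)
      = ∑ C ∈ configs I, (I.diagSum fun r i => Y r i C) / C.speed := by
    unfold diagSum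
    simp_rw [mul_sum, sum_div]
    rw [sum_comm (s := configs I)]
    refine sum_congr rfl fun r _ => ?_
    rw [sum_comm (s := configs I)]
    refine sum_congr rfl fun i _ => sum_congr rfl fun C _ => ?_
    unfold Config.speed
    field_simp
  rw [h, ← sum_add_distrib]
  refine sum_congr rfl fun C _ => ?_
  rw [C.cost_eq]
  ring

theorem diagSum_add (N N' : Fin (yExp k ℓ + 1) → I.sizes → ℝ) :
    (I.diagSum fun r i => N r i + N' r i) = I.diagSum N + I.diagSum N' := by
  unfold diagSum
  simp_rw [mul_add, add_div, sum_add_distrib]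

theorem diagSum_mul (N : Fin (yExp k ℓ + 1) → I.sizes → ℝ) (c : ℝ) :
    (I.diagSum fun r i => c * N r i) = c * I.diagSum N := by
  unfold diagSum
  simp_rw [mul_sum]
  exact sum_congr rfl fun r _ => sum_congr rfl fun i _ => by ring

theorem diagSum_mono {N N' : Fin (yExp k ℓ + 1) → I.sizes → ℝ} (h : ∀ r i, N r i ≤ N' r i) :
    I.diagSum N ≤ I.diagSum N' := by
  have hb := base_pos k
  refine sum_le_sum fun r _ => sum_le_sum fun i _ => ?_
  have := h r i
  gcongr

theorem sizeSum_nonneg {N : Fin (yExp k ℓ + 1) → I.sizes → ℝ} (h : ∀ r i, 0 ≤ N r i)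
    (r : Fin (yExp k ℓ + 1)) : 0 ≤ I.sizeSum N r :=
  sum_nonneg fun i _ => mul_nonneg (zpow_pos (base_pos k) _).le (h r i)

theorem sizeSum_mono {N N' : Fin (yExp k ℓ + 1) → I.sizes → ℝ} (h : ∀ r i, N r i ≤ N' r i)
    (r : Fin (yExp k ℓ + 1)) : I.sizeSum N r ≤ I.sizeSum N' r := by
  have hb := base_pos k
  refine sum_le_sum fun i _ => ?_
  have := h r i
  gcongr

theorem sizeSum_add (N N' : Fin (yExp k ℓ + 1) → I.sizes → ℝ) (r : Fin (yExp k ℓ + 1)) :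
    I.sizeSum (fun r i => N r i + N' r i) r = I.sizeSum N r + I.sizeSum N' r := by
  unfold sizeSum
  simp_rw [mul_add, sum_add_distrib]

/-- Adding jobs of small total size. -/
theorem cost_add_le (hk : 0 < k) (N N' : Fin (yExp k ℓ + 1) → I.sizes → ℕ) :
    quadForm (base k) (I.sizeSum fun r i => ((N r i + N' r i : ℕ) : ℝ))
        + (I.diagSum fun r i => ((N r i + N' r i : ℕ) : ℝ))
      ≤ quadForm (base k) (I.sizeSum fun r i => N r i) + (I.diagSum fun r i => N r i)
        + base k ^ yExp k ℓ * ((∑ r, I.sizeSum (fun r i => N r i) r)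
          * (∑ r, I.sizeSum (fun r i => N' r i) r) + (∑ r, I.sizeSum (fun r i => N' r i) r) ^ 2) := by
  have hb := base_pos k
  have hb1 := (one_lt_base hk).le
  have hn : ∀ r, 0 ≤ I.sizeSum (fun r i => (N r i : ℝ)) r :=
    sizeSum_nonneg fun _ _ => Nat.cast_nonneg _
  have hn' : ∀ r, 0 ≤ I.sizeSum (fun r i => (N' r i : ℝ)) r :=
    sizeSum_nonneg fun _ _ => Nat.cast_nonneg _
  set W := ∑ r, I.sizeSum (fun r i => (N' r i : ℝ)) r with hW
  have h1 := quadForm_add_le hb1 hn hn' (y := yExp k ℓ) le_rfl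
  have h2 : (I.sizeSum fun r i => ((N r i + N' r i : ℕ) : ℝ))
      = fun r => I.sizeSum (fun r i => (N r i : ℝ)) r + I.sizeSum (fun r i => (N' r i : ℝ)) r := by
    funext r; push_cast; rw [sizeSum_add]
  have h3 : (I.diagSum fun r i => ((N r i + N' r i : ℕ) : ℝ))
      = (I.diagSum fun r i => (N r i : ℝ)) + I.diagSum fun r i => (N' r i : ℝ) := by
    push_cast; rw [diagSum_add]
  have h4 : (I.diagSum fun r i => (N' r i : ℝ)) ≤ base k ^ yExp k ℓ * W ^ 2 / 2 := by
    have h5 : base k ^ yExp k ℓ * W ^ 2 / 2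
        = ∑ r, ∑ i : I.sizes, base k ^ yExp k ℓ * W / 2 * (base k ^ (i : ℤ) * N' r i) := by
      simp_rw [← mul_sum]
      change _ = base k ^ yExp k ℓ * W / 2 * W
      ring
    rw [h5]
    refine sum_le_sum fun r _ => sum_le_sum fun i _ => ?_
    have h6 : base k ^ (i : ℤ) * N' r i ≤ W :=
      (single_le_sum (f := fun i : I.sizes => base k ^ (i : ℤ) * (N' r i : ℝ))
        (fun i _ => by positivity) (mem_univ i)).trans
        (single_le_sum (f := fun r => I.sizeSum (fun r i => (N' r i : ℝ)) r)
          (fun r _ => hn' r) (mem_univ r))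
    have h7 : base k ^ (r : ℕ) ≤ base k ^ yExp k ℓ := pow_le_pow_right₀ hb1 (by omega)
    -- A size that really occurs among the added jobs is at most their total size W, so one factor
    -- of its square can be replaced by W.
    rcases Nat.eq_zero_or_pos (N' r i) with h0 | h0
    · simp [h0]
    · have h8 : (1 : ℝ) ≤ N' r i := by exact_mod_cast h0
      have h9 : base k ^ (i : ℤ) ≤ W := by
        refine le_trans (le_mul_of_one_le_right (zpow_pos hb _).le h8) h6
      have h10 : base k ^ (r : ℕ) * base k ^ (i : ℤ) ≤ base k ^ yExp k ℓ * W := by gcongr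
      rw [zpow_add₀ hb.ne', zpow_natCast, two_mul, zpow_add₀ hb.ne']
      have h11 : 0 ≤ base k ^ (i : ℤ) * (N' r i : ℝ) := by positivity
      nlinarith [mul_le_mul_of_nonneg_right h10 h11]
  rw [h2, h3]
  nlinarith

/-- The gap 2k² between f and g exceeds the k²+1 of the load bound, so every heavy configuration is
fast and the integrality constraint applies. -/
theorem floor_eq_of_heavy (hk : 8 ≤ k) (hfeas : IsFeasible I X Y) {C : Config I}
    (hC : C ∈ configs I) (h : gExp k < C.j1) : (⌊X C⌋₊ : ℝ) = X C := by
  have hv : C.IsValid := (finite_valid I).mem_toFinset.1 hC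
  have h1 := j2_ge I hk hv
  have h2 : fExp k < C.j2 := by
    have h64 : 8 * 8 ≤ (k : ℤ) * k := by
      have : (8 : ℤ) ≤ k := by exact_mod_cast hk
      nlinarith
    unfold fExp
    rw [sq] at h1 ⊢
    linarith
  obtain ⟨z, hz⟩ := hfeas.integral C hC h h2
  have h0 := hfeas.X_nonneg C hC
  rw [hz] at h0 ⊢
  lift z to ℕ using (by exact_mod_cast h0)
  simp

variable (hfeas : IsFeasible I X Y) (hnodup : L.Nodup) (hsub : ∀ C ∈ L, C ∈ configs I)
  (hall : ∀ C ∈ configs I, X C ≠ 0 → C ∈ L)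

include hfeas

theorem Y_le_mul_ceil (C : Config I) (hC : C ∈ configs I) (r : Fin (yExp k ℓ + 1)) (i : I.sizes) :
    Y r i C ≤ X C * (⌈Y r i C / X C⌉₊ : ℝ) := by
  classical
  have hb := base_pos k
  -- Where X = 0 the quotient Y/X carries no information, but then the space constraint forces Y to
  -- vanish.
  rcases (hfeas.X_nonneg C hC).eq_or_lt with h | h
  · rw [← h, zero_mul]
    by_cases hi : C.IsSmallExp i
    · have h1 := hfeas.space r C hC
      rw [← h, mul_zero] at h1
      have h2 : base k ^ (i : ℤ) * Y r i C ≤ 0 := by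
        refine le_trans (single_le_sum (f := fun i : I.sizes => base k ^ (i : ℤ) * Y r i C)
          (fun i _ => mul_nonneg (zpow_pos hb _).le (hfeas.Y_nonneg r i C hC))
          (mem_filter.2 ⟨mem_univ i, hi⟩)) h1
      exact nonpos_of_mul_nonpos_right h2 (zpow_pos hb _)
    · exact (hfeas.Y_eq_zero r i C hC hi).le
  · rw [mul_comm, ← div_le_iff₀ h]
    exact Nat.le_ceil _

theorem jobCount_le (r : Fin (yExp k ℓ + 1)) (i : I.sizes) :
    (I.jobCount r i : ℝ) ≤ ∑ C ∈ configs I, X C * (need X Y C r i : ℝ) := by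
  rw [← hfeas.jobs r i, ← sum_add_distrib]
  refine sum_le_sum fun C hC => ?_
  have := Y_le_mul_ceil hfeas C hC r i
  unfold need
  push_cast
  linarith

include hnodup hsub hall

/-- With fractional multiplicities X the rooms cover all jobs. Passing to ⌊X⌋ loses nothing for
heavy configurations and at most one machine for each light one. -/
theorem leftover_le (hk : 8 ≤ k) (r : Fin (yExp k ℓ + 1)) (i : I.sizes) :
    ((I.jobCount r i - ∑ q, room X Y L q r i : ℕ) : ℝ)
      ≤ ∑ C ∈ configs I with C.j1 ≤ gExp k, (need X Y C r i : ℝ) := by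
  have h0 : 0 ≤ ∑ C ∈ configs I with C.j1 ≤ gExp k, (need X Y C r i : ℝ) :=
    sum_nonneg fun _ _ => Nat.cast_nonneg _
  have h1 : ((∑ q, room X Y L q r i : ℕ) : ℝ)
      = ∑ C ∈ configs I, (⌊X C⌋₊ : ℝ) * (need X Y C r i : ℝ) := by
    rw [← sum_cfg hfeas hnodup hsub hall fun C => (need X Y C r i : ℝ)]
    push_cast
    refine sum_congr rfl fun q _ => ?_
    unfold room extend
    split_ifs <;> simp
  have h2 := jobCount_le hfeas r i
  have h3 : ∑ C ∈ configs I, X C * (need X Y C r i : ℝ)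
      ≤ ∑ C ∈ configs I, (⌊X C⌋₊ : ℝ) * (need X Y C r i : ℝ)
        + ∑ C ∈ configs I with C.j1 ≤ gExp k, (need X Y C r i : ℝ) := by
    rw [sum_filter, ← sum_add_distrib]
    refine sum_le_sum fun C hC => ?_
    have hn : (0 : ℝ) ≤ need X Y C r i := Nat.cast_nonneg _
    split_ifs with h
    · have := (Nat.lt_floor_add_one (X C)).le
      nlinarith
    · rw [floor_eq_of_heavy hk hfeas hC (not_le.1 h), add_zero]
  rcases le_total (I.jobCount r i) (∑ q, room X Y L q r i) with h | h
  · rw [Nat.sub_eq_zero_of_le h]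
    simpa using h0
  · rw [Nat.cast_sub h, h1]
    linarith

theorem leftover_size_le (hk : 8 ≤ k) (hℓ : ℓ ≤ 5) :
    ∑ r, I.sizeSum (fun r i => ((I.jobCount r i - ∑ q, room X Y L q r i : ℕ) : ℝ)) r
      ≤ ∑ C ∈ configs I with C.j1 ≤ gExp k, 2 * base k ^ C.j1 := by
  calc _ ≤ ∑ r, I.sizeSum (fun r i => ∑ C ∈ configs I with C.j1 ≤ gExp k, (need X Y C r i : ℝ)) r :=
        sum_le_sum fun r _ => sizeSum_mono (leftover_le hfeas hnodup hsub hall hk) r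
    _ = ∑ C ∈ configs I with C.j1 ≤ gExp k, ∑ r, I.sizeSum (fun r i => (need X Y C r i : ℝ)) r := by
        rw [sum_comm]
        refine sum_congr rfl fun r _ => ?_
        unfold sizeSum
        simp_rw [mul_sum]
        rw [sum_comm]
    _ ≤ _ := sum_le_sum fun C hC => C.sum_sizeSum_need_le hk hℓ (mem_filter.1 hC).1 hfeas

omit hnodup hsub hall in
-- Configurations of speed 1 with j1 ≥ -1 have total multiplicity at least 1, and each has work at
-- least (8/9)³ > 2/3, hence cost at least (2/3)²/2 > 1/5.
theorem objective_ge (hk : 8 ≤ k) : 1 / 5 ≤ objective I X Y := by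
  classical
  have hb := base_pos k
  have hb1 := one_lt_base (k := k) (by omega)
  rw [objective_eq]
  have h1 := hfeas.fastest
  have hterm : ∀ C ∈ configs I, 0 ≤
      (X C * (quadForm (base k) C.total + I.diagSum fun r i => (C.large r i : ℝ))
      + I.diagSum fun r i => Y r i C) / C.speed := by
    intro C hC
    have e1 := hfeas.X_nonneg C hC
    have e2 : 0 ≤ quadForm (base k) C.total :=
      le_trans (by positivity) (sq_sum_le_quadForm hb1.le C.total_nonneg)
    have e3 : 0 ≤ I.diagSum fun r i => (C.large r i : ℝ) :=
      Config.diagSum_nonneg fun _ _ => Nat.cast_nonneg _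
    have e4 : 0 ≤ I.diagSum fun r i => Y r i C :=
      Config.diagSum_nonneg fun r i => hfeas.Y_nonneg r i C hC
    have e5 := C.speed_pos
    positivity
  refine le_trans ?_ (sum_le_sum_of_subset_of_nonneg (filter_subset
    (fun C => (C.j1 = -1 ∨ C.j1 = 0) ∧ C.j2 = 0) _) fun C hC _ => hterm C hC)
  have h2 : ∀ C ∈ (configs I).filter (fun C => (C.j1 = -1 ∨ C.j1 = 0) ∧ C.j2 = 0), X C * (1 / 5) ≤
      (X C * (quadForm (base k) C.total + I.diagSum fun r i => (C.large r i : ℝ))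
      + I.diagSum fun r i => Y r i C) / C.speed := by
    intro C hC
    obtain ⟨hC1, hj1, hj2⟩ := mem_filter.1 hC
    have hv : C.IsValid := (finite_valid I).mem_toFinset.1 hC1
    have e1 := hfeas.X_nonneg C hC1
    have e2 := sq_sum_le_quadForm hb1.le C.total_nonneg
    rw [C.sum_total] at e2
    have e3 : 0 ≤ I.diagSum fun r i => (C.large r i : ℝ) :=
      Config.diagSum_nonneg fun _ _ => Nat.cast_nonneg _
    have e4 : 0 ≤ I.diagSum fun r i => Y r i C :=
      Config.diagSum_nonneg fun r i => hfeas.Y_nonneg r i C hC1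
    have e5 : C.speed = 1 := by simp [Config.speed, hj2]
    have e6 : base k ^ (-3 : ℤ) ≤ C.work :=
      (zpow_le_zpow_right₀ hb1.le (by omega)).trans hv.work_gt.le
    have e7 : ((9 / 8 : ℝ) ^ 3)⁻¹ ≤ base k ^ (-3 : ℤ) := by
      rw [zpow_neg]
      have := base_le hk
      refine inv_anti₀ (by positivity) ?_
      norm_cast
      gcongr
    have e8 : (2 / 3 : ℝ) ≤ C.work := le_trans (by norm_num) (e7.trans e6)
    rw [e5, div_one]
    have e9 : (1 / 5 : ℝ) ≤ quadForm (base k) C.total := by nlinarith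
    nlinarith
  refine le_trans ?_ (sum_le_sum h2)
  rw [← sum_mul]
  have h3 : 1 ≤ ∑ C ∈ configs I with (C.j1 = -1 ∨ C.j1 = 0) ∧ C.j2 = 0, X C := by convert h1
  linarith

/-- A configuration is used ⌊X⌋ ≤ X times, so its share of the diagonal part of Y/X adds up to at
most that of Y. -/
theorem sum_rooms_le (hk : 8 ≤ k) (hℓ : ℓ ≤ 5) :
    ∑ q, (quadForm (base k) (I.sizeSum fun r i => room X Y L q r i)
      + I.diagSum fun r i => room X Y L q r i) / I.speed q ≤ (1 + delta k / 2) * objective I X Y := by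
  let H : Config I → ℝ := fun C => (quadForm (base k) (I.sizeSum fun r i => need X Y C r i)
    + I.diagSum fun r i => need X Y C r i) / C.speed
  have h1 : ∀ q, (quadForm (base k) (I.sizeSum fun r i => (room X Y L q r i : ℝ))
      + I.diagSum fun r i => (room X Y L q r i : ℝ)) / I.speed q
      = extend (fun c => H (L.get c)) (cfg X L q) := by
    intro q
    unfold room
    by_cases h : cfg X L q < L.length
    · have h2 : (L.get ⟨_, h⟩).speed = I.speed q := by
        unfold Config.speed speed
        rw [j2_of_cfg_eq (X := X) (q := q) (c := ⟨_, h⟩) rfl]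
      simp only [extend, dif_pos h, H, h2]
    · simp only [extend, dif_neg h]
      simp [quadForm, sizeSum, diagSum]
  simp_rw [h1]
  rw [sum_cfg hfeas hnodup hsub hall, objective_eq, mul_sum]
  refine sum_le_sum fun C hC => ?_
  have hs := C.speed_pos
  have h2 := C.need_cost_le hk hℓ hC hfeas
  have hX := hfeas.X_nonneg C hC
  have hf := Nat.floor_le hX
  have hf0 : (0 : ℝ) ≤ ⌊X C⌋₊ := Nat.cast_nonneg _
  have hd := delta_nonneg k
  set A := quadForm (base k) C.total + I.diagSum fun r i => (C.large r i : ℝ) with hA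
  have hA0 : 0 ≤ A := by
    refine add_nonneg ?_ (Config.diagSum_nonneg fun _ _ => Nat.cast_nonneg _)
    exact le_trans (by positivity) (sq_sum_le_quadForm (one_lt_base (by omega)).le C.total_nonneg)
  have h3 : (⌊X C⌋₊ : ℝ) * (I.diagSum fun r i => Y r i C / X C) ≤ I.diagSum fun r i => Y r i C := by
    rw [← diagSum_mul]
    refine diagSum_mono fun r i => ?_
    have hY := hfeas.Y_nonneg r i C hC
    rcases hX.eq_or_lt with h | h
    · rw [← h]; simpa using hY
    · rw [mul_div_assoc', div_le_iff₀ h, mul_comm]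
      gcongr
  have h4 : 0 ≤ I.diagSum fun r i => Y r i C :=
    Config.diagSum_nonneg fun r i => hfeas.Y_nonneg r i C hC
  simp only [H]
  rw [mul_div_assoc', mul_div_assoc']
  refine div_le_div_of_nonneg_right ?_ hs.le
  calc _ ≤ (⌊X C⌋₊ : ℝ) * ((1 + delta k / 2) * A + I.diagSum fun r i => Y r i C / X C) := by gcongr
    _ = (1 + delta k / 2) * ((⌊X C⌋₊ : ℝ) * A)
        + (⌊X C⌋₊ : ℝ) * (I.diagSum fun r i => Y r i C / X C) := by ring
    _ ≤ (1 + delta k / 2) * (X C * A) + (I.diagSum fun r i => Y r i C) := by gcongr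
    _ ≤ _ := by nlinarith

omit hnodup hall in
-- At speed 1 the load bound limits the work itself: the room is at most 2(1+δ)^j1 ≤ 2 · 2k · (9/8)²
-- < 6k.
theorem sum_room_le (hk : 8 ≤ k) (hℓ : ℓ ≤ 5) {q : Fin I.m} (hq : I.slowExp q = 0) :
    ∑ r, I.sizeSum (fun r i => (room X Y L q r i : ℝ)) r ≤ 6 * k := by
  have hkr : (8 : ℝ) ≤ k := by exact_mod_cast hk
  unfold room
  by_cases h : cfg X L q < L.length
  · simp only [extend, dif_pos h]
    set C := L.get ⟨_, h⟩ with hCdef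
    have hC : C ∈ configs I := hsub C (L.get_mem _)
    have hv : C.IsValid := (finite_valid I).mem_toFinset.1 hC
    have hj2 : C.j2 = 0 := by
      rw [hCdef, j2_of_cfg_eq (X := X) (q := q) (c := ⟨_, h⟩) rfl, hq]; rfl
    refine (C.sum_sizeSum_need_le hk hℓ hC hfeas).trans ?_
    have h1 := hv.load_lt
    have h2 : (2 : ℝ) / delta k = 2 * k := by unfold delta; simp
    rw [Config.j3, hj2, sub_zero, h2] at h1
    have h3 : base k ^ C.j1 = base k ^ (C.j1 - 2) * base k ^ 2 := by
      rw [← zpow_natCast, ← zpow_add₀ (base_pos k).ne']; congr 1; norm_num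
    have h4 : base k ^ 2 ≤ (9 / 8) ^ 2 := pow_le_pow_left₀ (base_pos k).le (base_le hk) 2
    rw [h3]
    have h5 : 0 < base k ^ (C.j1 - 2) := zpow_pos (base_pos k) _
    nlinarith
  · simp only [extend, dif_neg h]
    simp only [sizeSum, Nat.cast_zero, mul_zero, sum_const_zero]
    positivity

theorem schedCost_fillRooms_le (hk : 8 ≤ k) (hℓ : ℓ ≤ 5) {host : Fin I.m}
    (hhost : I.slowExp host = 0) :
    I.schedCost (fillRooms (room X Y L) host) ≤ (1 + delta k) * objective I X Y := by
  have hk0 : 0 < k := by omega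
  have hkr : (8 : ℝ) ≤ k := by exact_mod_cast hk
  have hb1 := (one_lt_base hk0).le
  set W := ∑ r, I.sizeSum (fun r i => ((I.jobCount r i - ∑ q, room X Y L q r i : ℕ) : ℝ)) r with hW
  have hW0 : 0 ≤ W := sum_nonneg fun r _ => sizeSum_nonneg (fun _ _ => Nat.cast_nonneg _) r
  have hWle : 70 * k ^ 2 * base k ^ yExp k ℓ * W ≤ 1 := by
    refine le_trans ?_ (sum_light_work_le I hk hℓ)
    have := leftover_size_le hfeas hnodup hsub hall hk hℓ
    have := base_pos k
    gcongr
  have hy1 : 1 ≤ base k ^ yExp k ℓ := one_le_pow₀ hb1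
  -- The leftovers W ≤ 1 meet at most 6k + 1 ≤ 7k of work on the host, and the tail bound makes the
  -- result at most 1/(10k) = (δ/2)(1/5).
  have hext : base k ^ yExp k ℓ * ((∑ r, I.sizeSum (fun r i => (room X Y L host r i : ℝ)) r) * W + W ^ 2)
      ≤ delta k / 2 * (1 / 5) := by
    have h1 := sum_room_le (L := L) hfeas hsub hk hℓ hhost
    have h2 : W ≤ 1 := by
      have : W ≤ 70 * k ^ 2 * base k ^ yExp k ℓ * W :=
        le_mul_of_one_le_left hW0 (by nlinarith)
      linarith
    have h3 : delta k / 2 * (1 / 5) = 1 / (10 * k) := by unfold delta; field_simp; norm_num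
    rw [h3, le_div_iff₀ (by positivity)]
    have h4 : (∑ r, I.sizeSum (fun r i => (room X Y L host r i : ℝ)) r) * W + W ^ 2 ≤ 7 * k * W := by
      nlinarith
    calc _ ≤ base k ^ yExp k ℓ * (7 * k * W) * (10 * k) := by gcongr
      _ = 70 * k ^ 2 * base k ^ yExp k ℓ * W := by ring
      _ ≤ 1 := hWle
  have hq : ∀ q, (quadForm (base k) (I.sizeSum fun r i => I.onMachine (fillRooms (room X Y L) host) q r i)
      + I.diagSum fun r i => I.onMachine (fillRooms (room X Y L) host) q r i) / I.speed q
      ≤ (quadForm (base k) (I.sizeSum fun r i => room X Y L q r i)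
      + I.diagSum fun r i => room X Y L q r i) / I.speed q
        + if q = host then delta k / 2 * (1 / 5) else 0 := by
    intro q
    have hs : 0 < I.speed q := zpow_pos (base_pos k) _
    have h1 := onMachine_fillRooms_le (room X Y L) host q
    by_cases h : q = host
    · subst h
      have hs1 : I.speed q = 1 := by simp [speed, hhost]
      simp only [if_true] at h1 ⊢
      rw [hs1, div_one, div_one]
      have h2 := cost_add_le hk0 (I := I) (room X Y L q)
        fun r i => I.jobCount r i - ∑ q', room X Y L q' r i
      refine le_trans (le_trans (add_le_add ?_ ?_) h2) (add_le_add le_rfl hext)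
      · exact quadForm_mono hb1 (sizeSum_nonneg fun _ _ => Nat.cast_nonneg _)
          (sizeSum_mono fun r i => Nat.cast_le.2 (h1 r i))
      · exact diagSum_mono fun r i => Nat.cast_le.2 (h1 r i)
    · simp only [h, if_false, add_zero] at h1 ⊢
      refine div_le_div_of_nonneg_right (add_le_add ?_ ?_) hs.le
      · exact quadForm_mono hb1 (sizeSum_nonneg fun _ _ => Nat.cast_nonneg _)
          (sizeSum_mono fun r i => Nat.cast_le.2 (h1 r i))
      · exact diagSum_mono fun r i => Nat.cast_le.2 (h1 r i)
  rw [schedCost_eq]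
  refine (sum_le_sum fun q _ => hq q).trans ?_
  rw [sum_add_distrib, sum_ite_eq' univ host, if_pos (mem_univ _)]
  have h1 := sum_rooms_le hfeas hnodup hsub hall hk hℓ
  have h2 := objective_ge hfeas hk
  have h3 := delta_nonneg k
  nlinarith

end BoundedInstance

/-! ### Reasoning about programs -/

instance : Add Expr := ⟨.add⟩
instance : Sub Expr := ⟨.sub⟩
instance : Mul Expr := ⟨.mul⟩
instance : Div Expr := ⟨.div⟩
instance (n : ℕ) : OfNat Expr n := ⟨.lit n⟩

section eval

variable (s : State) (e e' : Expr)

@[simp] theorem eval_add : (e + e').eval s = e.eval s + e'.eval s := rfl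
@[simp] theorem eval_sub : (e - e').eval s = e.eval s - e'.eval s := rfl
@[simp] theorem eval_mul : (e * e').eval s = e.eval s * e'.eval s := rfl
@[simp] theorem eval_div : (e / e').eval s = e.eval s / e'.eval s := rfl
@[simp] theorem eval_ofNat (n : ℕ) : (ofNat(n) : Expr).eval s = OfNat.ofNat n := rfl
@[simp] theorem eval_reg (x : ℕ) : (Expr.reg x).eval s = s.reg x := rfl
@[simp] theorem eval_cell : (Expr.cell e).eval s = s.mem (e.eval s) := rfl

end eval

/-- The number of operations of an expression, plus the literals. -/
def Expr.len : Expr → ℕ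
  | .lit c => c + 1
  | .reg _ => 1
  | .cell e => e.len + 1
  | .add e₁ e₂ => e₁.len + e₂.len + 1
  | .sub e₁ e₂ => e₁.len + e₂.len + 1
  | .mul e₁ e₂ => e₁.len + e₂.len + 1
  | .div e₁ e₂ => e₁.len + e₂.len + 1

/-- All registers and memory cells hold numbers of at most `B` bits. -/
def State.Ok (B : ℕ) (s : State) : Prop := (∀ x, s.reg x < 2 ^ B) ∧ ∀ a, s.mem a < 2 ^ B

/-- Assignment to a register. -/
def State.setReg (s : State) (x v : ℕ) : State := ⟨Function.update s.reg x v, s.mem⟩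

/-- Assignment to a memory cell. -/
def State.setMem (s : State) (a v : ℕ) : State := ⟨s.reg, Function.update s.mem a v⟩

@[simp] theorem setReg_reg (s : State) (x v y : ℕ) :
    (s.setReg x v).reg y = if y = x then v else s.reg y := by
  simp [State.setReg, Function.update_apply]

@[simp] theorem setReg_mem (s : State) (x v : ℕ) : (s.setReg x v).mem = s.mem := rfl
@[simp] theorem setMem_mem (s : State) (a v c : ℕ) :
    (s.setMem a v).mem c = if c = a then v else s.mem c := by
  simp [State.setMem, Function.update_apply]

theorem Expr.one_le_len (e : Expr) : 1 ≤ e.len := by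
  cases e <;> simp [Expr.len]

section bounds

variable {B M : ℕ} {s : State}

theorem Expr.eval_lt (hB : 1 ≤ B) (hs : s.Ok B) (e : Expr) : e.eval s < 2 ^ (B * e.len) := by
  have hmono : ∀ {a b : ℕ}, a ≤ b → 2 ^ (B * a) ≤ 2 ^ (B * b) := fun h =>
    Nat.pow_le_pow_right (by norm_num) (Nat.mul_le_mul_left B h)
  have hbig : ∀ e : Expr, 2 ≤ 2 ^ (B * e.len) := fun e =>
    Nat.le_self_pow (Nat.mul_ne_zero (by omega) (by have := e.one_le_len; omega)) 2
  induction e with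
  | lit c =>
    have h1 : c < 2 ^ c := Nat.lt_two_pow_self
    exact h1.trans_le (Nat.pow_le_pow_right (by norm_num) (by simp only [Expr.len]; nlinarith))
  | reg x => simpa [Expr.eval, Expr.len] using hs.1 x
  | cell e ih =>
    have := hmono (by simp [Expr.len] : 1 ≤ (Expr.cell e).len)
    rw [mul_one] at this
    exact (hs.2 _).trans_le this
  | add e₁ e₂ ih₁ ih₂ =>
    have h3 : 2 ^ (B * e₁.len) + 2 ^ (B * e₂.len) ≤ 2 ^ (B * (Expr.add e₁ e₂).len) := by
      refine (Nat.add_le_mul (hbig e₁) (hbig e₂)).trans ?_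
      rw [← pow_add, ← mul_add]
      exact hmono (by simp [Expr.len])
    simp only [Expr.eval]
    omega
  | sub e₁ e₂ ih₁ ih₂ =>
    have h3 := hmono (by simp only [Expr.len]; omega : e₁.len ≤ (Expr.sub e₁ e₂).len)
    simp only [Expr.eval]
    omega
  | mul e₁ e₂ ih₁ ih₂ =>
    simp only [Expr.eval]
    refine (Nat.mul_lt_mul'' ih₁ ih₂).trans_le ?_
    rw [← pow_add, ← mul_add]
    exact hmono (by simp [Expr.len])
  | div e₁ e₂ ih₁ ih₂ =>
    have h3 := hmono (by simp only [Expr.len]; omega : e₁.len ≤ (Expr.div e₁ e₂).len)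
    simp only [Expr.eval]
    exact (Nat.div_le_self _ _).trans_lt (ih₁.trans_le h3)

/-- Each of the operations produces a number of at most B times the length of the expression many
bits, whence the square of the length. -/
theorem Expr.cost_le (hB : 1 ≤ B) (hs : s.Ok B) (e : Expr) : e.cost s ≤ e.len ^ 2 * (B + 1) := by
  have hsize : ∀ e : Expr, Nat.size (e.eval s) ≤ B * e.len := fun e =>
    Nat.size_le.2 (e.eval_lt hB hs)
  induction e with
  | lit c =>
    have h1 : Nat.size c ≤ c := Nat.size_le.2 Nat.lt_two_pow_self
    simp only [Expr.cost, Expr.len]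
    nlinarith
  | reg x =>
    have := hsize (.reg x)
    simp only [Expr.cost, Expr.len, Expr.eval] at this ⊢
    omega
  | cell e ih =>
    have : Nat.size (s.mem (e.eval s)) ≤ B := Nat.size_le.2 (hs.2 _)
    simp only [Expr.cost, Expr.len]
    nlinarith [Nat.zero_le (e.len * (B + 1))]
  | add e₁ e₂ ih₁ ih₂ =>
    have := hsize (.add e₁ e₂)
    have h1 := e₁.one_le_len
    have h2 := e₂.one_le_len
    simp only [Expr.cost, Expr.len, Expr.eval] at this ⊢
    nlinarith [Nat.zero_le (e₁.len * e₂.len * (B + 1))]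
  | sub e₁ e₂ ih₁ ih₂ =>
    have := hsize (.sub e₁ e₂)
    simp only [Expr.cost, Expr.len, Expr.eval] at this ⊢
    nlinarith [Nat.zero_le (e₁.len * e₂.len * (B + 1))]
  | mul e₁ e₂ ih₁ ih₂ =>
    have := hsize (.mul e₁ e₂)
    simp only [Expr.cost, Expr.len, Expr.eval] at this ⊢
    nlinarith [Nat.zero_le (e₁.len * e₂.len * (B + 1))]
  | div e₁ e₂ ih₁ ih₂ =>
    have := hsize (.div e₁ e₂)
    simp only [Expr.cost, Expr.len, Expr.eval] at this ⊢
    nlinarith [Nat.zero_le (e₁.len * e₂.len * (B + 1))]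

end bounds

/-- A bound for the number of steps of a program whose loops are repeated at most `M` times. -/
def Prog.stepBound (M : ℕ) : Prog → ℕ
  | .skip => 1
  | .set _ e => 1 + e.len ^ 2
  | .store a e => 1 + a.len ^ 2 + e.len ^ 2
  | .seq c₁ c₂ => 1 + c₁.stepBound M + c₂.stepBound M
  | .ite e c₁ c₂ => 1 + e.len ^ 2 + c₁.stepBound M + c₂.stepBound M
  | .loop e c => (M + 1) * (1 + e.len ^ 2 + c.stepBound M)

open Polynomial in
-- For a fixed program the expression lengths and the nesting of loops are constants, so only the
-- number of rounds M varies.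
theorem Prog.exists_stepPoly (c : Prog) : ∃ p : ℕ[X], ∀ M, p.eval M = c.stepBound M := by
  induction c with
  | skip => exact ⟨1, fun M => by simp [Prog.stepBound]⟩
  | set x e => exact ⟨C (1 + e.len ^ 2), fun M => by rw [eval_C]; rfl⟩
  | store a e => exact ⟨C (1 + a.len ^ 2 + e.len ^ 2), fun M => by rw [eval_C]; rfl⟩
  | seq c₁ c₂ ih₁ ih₂ =>
    obtain ⟨p, hp⟩ := ih₁
    obtain ⟨q, hq⟩ := ih₂
    exact ⟨1 + p + q, fun M => by simp [Prog.stepBound, hp, hq]⟩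
  | ite e c₁ c₂ ih₁ ih₂ =>
    obtain ⟨p, hp⟩ := ih₁
    obtain ⟨q, hq⟩ := ih₂
    exact ⟨C (1 + e.len ^ 2) + p + q, fun M => by
      rw [Polynomial.eval_add, Polynomial.eval_add, eval_C, hp, hq]; rfl⟩
  | loop e c ih =>
    obtain ⟨p, hp⟩ := ih
    exact ⟨(X + 1) * (C (1 + e.len ^ 2) + p), fun M => by
      rw [Polynomial.eval_mul, Polynomial.eval_add, Polynomial.eval_add, eval_X, eval_one, eval_C, hp]; rfl⟩

/-- Started in `s`, the program `c` halts within its step bound in a state with the property `Q`,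
and all numbers stay below `2 ^ B`. -/
def WP (B M : ℕ) (c : Prog) (Q : State → Prop) (s : State) : Prop :=
  s.Ok B → ∃ t s', Exec c s t s' ∧ t ≤ c.stepBound M * (B + 1) ∧ s'.Ok B ∧ Q s'

/-- `while x < h do (c; x := x + 1)` -/
def Prog.forLoop (x h : ℕ) (c : Prog) : Prog :=
  .loop (.reg h - .reg x) (.seq c (.set x (.reg x + 1)))

section wp

variable {B M : ℕ} {s : State} {Q : State → Prop}

theorem State.Ok.setReg (hs : s.Ok B) (x : ℕ) {v : ℕ} (hv : v < 2 ^ B) : (s.setReg x v).Ok B := by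
  refine ⟨fun y => ?_, hs.2⟩
  rw [setReg_reg]
  split_ifs
  · exact hv
  · exact hs.1 y

theorem State.Ok.setMem (hs : s.Ok B) (a : ℕ) {v : ℕ} (hv : v < 2 ^ B) : (s.setMem a v).Ok B := by
  refine ⟨hs.1, fun y => ?_⟩
  rw [setMem_mem]
  split_ifs
  · exact hv
  · exact hs.2 y

theorem wp_mono {c : Prog} {Q' : State → Prop} (h : WP B M c Q s) (hQ : ∀ s', Q s' → Q' s') :
    WP B M c Q' s := fun hs =>
  let ⟨t, s', h1, h2, h3, h4⟩ := h hs
  ⟨t, s', h1, h2, h3, hQ s' h4⟩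

theorem wp_skip (h : Q s) : WP B M .skip Q s := fun hs =>
  ⟨1, s, .skip s, by simp [Prog.stepBound], hs, h⟩

theorem wp_set (hB : 1 ≤ B) {x : ℕ} {e : Expr} (he : e.eval s < 2 ^ B)
    (h : Q (s.setReg x (e.eval s))) : WP B M (.set x e) Q s := fun hs =>
  ⟨_, _, .set x e s, by
    have := e.cost_le hB hs
    simp only [Prog.stepBound]; nlinarith, hs.setReg x he, h⟩

theorem wp_store (hB : 1 ≤ B) {a e : Expr} (he : e.eval s < 2 ^ B)
    (h : Q (s.setMem (a.eval s) (e.eval s))) : WP B M (.store a e) Q s := fun hs =>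
  ⟨_, _, .store a e s, by
    have := e.cost_le hB hs
    have := a.cost_le hB hs
    simp only [Prog.stepBound]; nlinarith, hs.setMem _ he, h⟩

theorem wp_seq {c₁ c₂ : Prog} (h : WP B M c₁ (WP B M c₂ Q) s) : WP B M (.seq c₁ c₂) Q s := by
  intro hs
  obtain ⟨t, s', h1, h2, h3, h4⟩ := h hs
  obtain ⟨t', s'', h1', h2', h3', h4'⟩ := h4 h3
  refine ⟨_, s'', .seq h1 h1', ?_, h3', h4'⟩
  simp only [Prog.stepBound]
  nlinarith

theorem wp_ite (hB : 1 ≤ B) {e : Expr} {c₁ c₂ : Prog} (h₁ : e.eval s ≠ 0 → WP B M c₁ Q s)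
    (h₂ : e.eval s = 0 → WP B M c₂ Q s) : WP B M (.ite e c₁ c₂) Q s := by
  intro hs
  have he := e.cost_le hB hs
  by_cases h : e.eval s = 0
  · obtain ⟨t, s', h1, h2, h3, h4⟩ := h₂ h hs
    refine ⟨_, s', .iteFalse h h1, ?_, h3, h4⟩
    simp only [Prog.stepBound]
    nlinarith [Nat.zero_le (c₁.stepBound M * (B + 1))]
  · obtain ⟨t, s', h1, h2, h3, h4⟩ := h₁ h hs
    refine ⟨_, s', .iteTrue h h1, ?_, h3, h4⟩
    simp only [Prog.stepBound]
    nlinarith [Nat.zero_le (c₂.stepBound M * (B + 1))]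

theorem wp_forLoop (hB : 1 ≤ B) {x h a b : ℕ} {c : Prog} {Inv : ℕ → State → Prop} (hab : a ≤ b)
    (hM : b ≤ M) (hInv : ∀ i s, Inv i s → s.reg x = i ∧ s.reg h = b) (hs : Inv a s)
    (hbody : ∀ i s, a ≤ i → i < b → Inv i s →
      WP B M c (fun s' => s'.reg x = i ∧ Inv (i + 1) (s'.setReg x (i + 1))) s)
    (hQ : ∀ s', Inv b s' → Q s') : WP B M (.forLoop x h c) Q s := by
  -- Induction on the number n of remaining rounds; the summand 1 in n + 1 pays for the final
  -- failing test.
  have key : ∀ n i s, a ≤ i → i + n = b → Inv i s → s.Ok B → ∃ t s',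
      Exec (.forLoop x h c) s t s' ∧
      t ≤ (n + 1) * ((1 + (Expr.reg h - Expr.reg x).len ^ 2
        + (Prog.seq c (.set x (.reg x + 1))).stepBound M) * (B + 1)) ∧ s'.Ok B ∧ Inv b s' := by
    intro n
    induction n with
    | zero =>
      intro i s hai hi hinv hok
      obtain rfl : i = b := by omega
      obtain ⟨h1, h2⟩ := hInv i s hinv
      refine ⟨_, s, .loopFalse (by simp [h1, h2]), ?_, hok, hinv⟩
      have := (Expr.reg h - Expr.reg x).cost_le hB hok
      nlinarith [Nat.zero_le ((Prog.seq c (.set x (.reg x + 1))).stepBound M * (B + 1))]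
    | succ n ih =>
      intro i s hai hi hinv hok
      obtain ⟨h1, h2⟩ := hInv i s hinv
      have hib : i < b := by omega
      obtain ⟨t₁, s₁, e₁, ht₁, hok₁, hx₁, hinv₁⟩ := hbody i s hai hib hinv hok
      -- The bound of the loop stands in a register, so the incremented counter cannot overflow.
      have hb : b < 2 ^ B := h2 ▸ hok.1 h
      have hev : (Expr.reg x + 1).eval s₁ = i + 1 := by
        rw [eval_add, eval_reg, hx₁]; rfl
      obtain ⟨t₂, s₂, e₂, ht₂, hok₂, hs₂⟩ := wp_set (M := M) (x := x) (e := .reg x + 1)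
        (Q := fun s' => s' = s₁.setReg x (i + 1)) hB (s := s₁) (by rw [hev]; omega) (by rw [hev]) hok₁
      subst hs₂
      obtain ⟨t₃, s₃, e₃, ht₃, hok₃, hinv₃⟩ := ih (i + 1) _ (by omega) (by omega) hinv₁ hok₂
      refine ⟨_, s₃, .loopTrue ?_ (.seq e₁ e₂) e₃, ?_, hok₃, hinv₃⟩
      · simp only [eval_sub, eval_reg, h1, h2]; omega
      · have := (Expr.reg h - Expr.reg x).cost_le hB hok
        have h5 : (Prog.seq c (.set x (.reg x + 1))).stepBound M
          = 1 + c.stepBound M + (Prog.set x (.reg x + 1)).stepBound M := rfl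
        rw [h5] at ht₃ ⊢
        nlinarith
  intro hok
  obtain ⟨t, s', h1, h2, h3, h4⟩ := key (b - a) a s le_rfl (by omega) hs hok
  refine ⟨t, s', h1, h2.trans ?_, h3, hQ s' h4⟩
  rw [← mul_assoc]
  refine Nat.mul_le_mul_right _ ?_
  exact Nat.mul_le_mul_right _ (by omega)

/-- The states differ at most in the given registers. -/
def SameExcept (S : List ℕ) (s s' : State) : Prop :=
  s'.mem = s.mem ∧ ∀ x, x ∉ S → s'.reg x = s.reg x

theorem SameExcept.refl (S : List ℕ) (s : State) : SameExcept S s s := ⟨rfl, fun _ _ => rfl⟩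

theorem SameExcept.trans {S S' : List ℕ} {s s' s'' : State} (h : SameExcept S s s')
    (h' : SameExcept S' s' s'') (hS : S ⊆ S') : SameExcept S' s s'' :=
  ⟨h'.1.trans h.1, fun x hx => (h'.2 x hx).trans (h.2 x fun hx' => hx (hS hx'))⟩

theorem SameExcept.setReg {S : List ℕ} {s s' : State} (h : SameExcept S s s') {x : ℕ} (hx : x ∈ S)
    (v : ℕ) : SameExcept S s (s'.setReg x v) :=
  ⟨h.1, fun y hy => by
    rw [setReg_reg, if_neg (by rintro rfl; exact hy hx)]
    exact h.2 y hy⟩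

/-- `|a - b|` -/
def absDiff (a b : Expr) : Expr := (a - b) + (b - a)

theorem eval_absDiff_eq_zero {a b : Expr} : (absDiff a b).eval s = 0 ↔ a.eval s = b.eval s := by
  simp only [absDiff, eval_add, eval_sub]; omega

/-- Nonzero if `lo ≤ t < hi`. -/
def between (lo t hi : Expr) : Expr := (t + 1 - lo) * (hi - t)

theorem eval_between_ne_zero {lo t hi : Expr} : (between lo t hi).eval s ≠ 0 ↔
    lo.eval s ≤ t.eval s ∧ t.eval s < hi.eval s := by
  have : (1 : Expr).eval s = 1 := rfl
  simp only [between, eval_add, eval_sub, eval_mul, this, Nat.mul_ne_zero_iff]; omega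

theorem wp_count (hB : 1 ≤ B) {x h y a b : ℕ} {e : Expr} (p : ℕ → Prop) [DecidablePred p]
    (hxh : x ≠ h) (hxy : x ≠ y) (hyh : y ≠ h) (hab : a ≤ b) (hM : b ≤ M)
    (hx : s.reg x = a) (hh : s.reg h = b) (hy : s.reg y = 0)
    (he : ∀ i s', a ≤ i → i < b → SameExcept [x, y] s s' → s'.reg x = i → (e.eval s' = 0 ↔ p i))
    (hQ : ∀ s', SameExcept [x, y] s s' → s'.reg y = #{i ∈ Ico a b | p i} → Q s') :
    WP B M (.forLoop x h (.ite e .skip (.set y (.reg y + 1)))) Q s := by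
  refine wp_forLoop (a := a) (b := b) (Inv := fun i s' => SameExcept [x, y] s s' ∧ s'.reg x = i ∧
    s'.reg y = #{i' ∈ Ico a i | p i'}) hB hab hM ?_ ?_ ?_ fun s' h => hQ s' h.1 h.2.2
  · rintro i s' ⟨h1, h2, -⟩
    refine ⟨h2, ?_⟩
    rw [h1.2 h (by simp [hxh.symm, hyh.symm]), hh]
  · exact ⟨.refl _ _, hx, by simp [hy]⟩
  · rintro i s' hai hib ⟨h1, h2, h3⟩
    have hIco : Ico a (i + 1) = insert i (Ico a i) := by
      ext z; simp only [mem_Ico, mem_insert]; omega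
    have hni : i ∉ (Ico a i).filter p := by simp
    refine wp_ite hB (fun hne => wp_skip ?_) fun heq => ?_
    · have hp : ¬ p i := fun hp => hne ((he i s' hai hib h1 h2).2 hp)
      refine ⟨h2, h1.setReg (by simp) _, by simp, ?_⟩
      rw [setReg_reg, if_neg hxy.symm, h3, hIco, filter_insert, if_neg hp]
    · have hp : p i := (he i s' hai hib h1 h2).1 heq
      have hev : (Expr.reg y + 1).eval s' = #{i' ∈ Ico a i | p i'} + 1 := by
        rw [eval_add, eval_reg, h3]; rfl
      intro hok
      refine wp_set hB ?_ ?_ hok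
      · have h4 : #{i' ∈ Ico a i | p i'} ≤ i - a := (card_filter_le _ _).trans (by simp)
        have h5 : s'.reg h = b := by rw [h1.2 h (by simp [hxh.symm, hyh.symm]), hh]
        have := hok.1 h
        rw [hev]; omega
      · refine ⟨by simp [hxy, h2], (h1.setReg (by simp) _).setReg (by simp) _, by simp, ?_⟩
        rw [setReg_reg, if_neg hxy.symm, setReg_reg, if_pos rfl, hev, hIco, filter_insert, if_pos hp,
          card_insert_of_notMem hni]

end wp

/-! ### Searching in prefix sums -/

/-- For `x` from its current value to `h - 1`: `cf` computes a number in register `f`, register `d`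
is set to `e` if register `t` lies between the sums of these numbers without and with the last one,
and the sum is kept in register `p`. -/
def Prog.seekLoop (x h p t d f : ℕ) (cf : Prog) (e : Expr) : Prog :=
  .forLoop x h (.seq cf (.seq (.ite (between (.reg p) (.reg t) (.reg p + .reg f)) (.set d e) .skip)
    (.set p (.reg p + .reg f))))

section seekLoop

variable {B M : ℕ} {s : State} {Q : State → Prop}

/-- A later hit overwrites an earlier one, exactly as in the recursion of `seek`. The list S
contains the registers that the inner computation may spoil. -/
theorem wp_seekLoop (hB : 1 ≤ B) {x h p t d f b ρ d₀ : ℕ} {cf : Prog} {e : Expr} {F v : ℕ → ℕ}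
    {S : List ℕ} (hM : b ≤ M) (hhT : h ∉ x :: p :: d :: S) (htT : t ∉ x :: p :: d :: S)
    (hxS : x ∉ S) (hpS : p ∉ S) (hdS : d ∉ S) (hxp : x ≠ p) (hxd : x ≠ d) (hpd : p ≠ d)
    (hfS : f ∈ S)
    (hx : s.reg x = 0) (hh : s.reg h = b) (hp : s.reg p = 0) (ht : s.reg t = ρ) (hd : s.reg d = d₀)
    (hcf : ∀ i s', i < b → SameExcept (x :: p :: d :: S) s s' → s'.reg x = i →
      WP B M cf (fun s'' => SameExcept S s' s'' ∧ s''.reg f = F i) s')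
    (he : ∀ i s', i < b → SameExcept (x :: p :: d :: S) s s' → s'.reg x = i → e.eval s' = v i)
    (hv : ∀ i < b, v i < 2 ^ B) (hF : prefixSum F b < 2 ^ B)
    (hQ : ∀ s', SameExcept (x :: p :: d :: S) s s' → s'.reg d = seek F v ρ d₀ b → Q s') :
    WP B M (.seekLoop x h p t d f cf e) Q s := by
  have hSsub : S ⊆ x :: p :: d :: S := fun y hy => by simp [hy]
  have hfd : f ≠ d := fun h => hdS (h ▸ hfS)
  have hfx : f ≠ x := fun h => hxS (h ▸ hfS)
  have hfp : f ≠ p := fun h => hpS (h ▸ hfS)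
  have htd : t ≠ d := fun h => htT (by simp [h])
  refine wp_forLoop (a := 0) (b := b) (Inv := fun i s' => SameExcept (x :: p :: d :: S) s s' ∧
    s'.reg x = i ∧ s'.reg p = prefixSum F i ∧ s'.reg d = seek F v ρ d₀ i)
    hB (Nat.zero_le b) hM ?_ ?_ ?_ fun s' h => hQ s' h.1 h.2.2.2
  · rintro i s' ⟨h1, h2, -⟩
    exact ⟨h2, by rw [h1.2 h hhT, hh]⟩
  · exact ⟨.refl _ _, hx, by simp [hp, prefixSum], by simp [hd, seek]⟩
  · rintro i s' - hib ⟨h1, h2, h3, h4⟩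
    refine wp_seq (wp_mono (hcf i s' hib h1 h2) ?_)
    rintro s₁ ⟨h5, h6⟩
    have h7 : SameExcept (x :: p :: d :: S) s s₁ := h1.trans ⟨h5.1, fun y hy =>
      h5.2 y fun hy' => hy (hSsub hy')⟩ (List.Subset.refl _)
    have hx₁ : s₁.reg x = i := by rw [h5.2 x hxS, h2]
    have hp₁ : s₁.reg p = prefixSum F i := by rw [h5.2 p hpS, h3]
    have hd₁ : s₁.reg d = seek F v ρ d₀ i := by rw [h5.2 d hdS, h4]
    have ht₁ : s₁.reg t = ρ := by rw [h7.2 t htT, ht]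
    have hle := prefixSum_mono F hib
    rw [prefixSum_succ] at hle
    have hfin : ∀ s₂, SameExcept (x :: p :: d :: S) s s₂ → s₂.reg x = i →
        s₂.reg p = prefixSum F i → s₂.reg f = F i → s₂.reg d = seek F v ρ d₀ (i + 1) →
        WP B M (.set p (.reg p + .reg f)) (fun s' => s'.reg x = i ∧
          SameExcept (x :: p :: d :: S) s (s'.setReg x (i + 1)) ∧ (s'.setReg x (i + 1)).reg x = i + 1 ∧
          (s'.setReg x (i + 1)).reg p = prefixSum F (i + 1) ∧
          (s'.setReg x (i + 1)).reg d = seek F v ρ d₀ (i + 1)) s₂ := by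
      intro s₂ g1 g2 g3 g4 g5
      refine wp_set hB ?_ ?_
      · simp only [eval_add, eval_reg, g3, g4]; omega
      · refine ⟨by simp [hxp, g2], (g1.setReg (by simp) _).setReg (by simp) _, by simp, ?_, ?_⟩
        · simp [hxp.symm, g3, g4, prefixSum_succ]
        · simp [hxd.symm, hpd.symm, g5]
    have hbt : (between (.reg p) (.reg t) (.reg p + .reg f)).eval s₁ ≠ 0 ↔
        prefixSum F i ≤ ρ ∧ ρ < prefixSum F i + F i := by
      rw [eval_between_ne_zero]
      simp only [eval_add, eval_reg, hp₁, ht₁, h6]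
    refine wp_seq (wp_ite hB (fun hne => ?_) fun heq => wp_skip ?_)
    · have he' := he i s₁ hib h7 hx₁
      refine wp_set hB (by rw [he']; exact hv i hib) (hfin _ (h7.setReg (by simp) _) ?_ ?_ ?_ ?_)
      · simp [hxd, hx₁]
      · simp [hpd, hp₁]
      · simp [hfd, h6]
      · simp [he', seek, hbt.1 hne]
    · refine hfin _ h7 hx₁ hp₁ h6 ?_
      rw [hd₁, seek, if_neg fun hc => hbt.2 hc heq]

end seekLoop

/-! ### The rounding algorithm

Register `1` holds the number of densities, `2` the number of jobs, `3` that of machines, `4` that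
of sizes, `5` that of configurations, `6` a machine of speed one, `7` the length of a row, `8` the
address of the first row, `10` a job, `12` the index of its size, `13` its rank, `15` its machine,
`16` a machine, `17` its rank, and `19` the room on it. -/

namespace Rounding

/-- The address of the current row. -/
def rowE : Expr := .reg 8 + .reg 11 * .reg 7

/-- The index of the density and size of the current job. -/
def typeE : Expr := .cell (7 + 3 * .reg 10 + 2) * .reg 4 + .reg 12

/-- The room for the current job on a machine with the current configuration. -/
def needE : Expr :=
  .cell (rowE + 3 + .reg 1 + typeE) +
    (.cell (rowE + 5 + .reg 1 + .reg 1 * .reg 4 + 2 * typeE) * .cell (rowE + 4 + .reg 1 + .reg 1 * .reg 4)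
      + (.cell (rowE + 6 + .reg 1 + .reg 1 * .reg 4 + 2 * typeE) * .cell (rowE + 3 + .reg 1 + .reg 1 * .reg 4) - 1))
      / (.cell (rowE + 6 + .reg 1 + .reg 1 * .reg 4 + 2 * typeE) * .cell (rowE + 3 + .reg 1 + .reg 1 * .reg 4))

/-- The number of machines of the speed of the current machine that get the current configuration. -/
def multProg : Prog :=
  .ite (absDiff (.cell (rowE + 2)) (.cell (7 + 3 * .reg 2 + .reg 16))) (.set 20 0)
    (.set 20 (.cell (rowE + 3 + .reg 1 + .reg 1 * .reg 4) / .cell (rowE + 4 + .reg 1 + .reg 1 * .reg 4)))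

/-- The room for the current job on the current machine. -/
def roomProg : Prog :=
  .seq (.set 17 0) (.seq (.set 11 (.reg 16 + 1)) (.seq
    (.forLoop 11 3 (.ite (absDiff (.cell (7 + 3 * .reg 2 + .reg 11)) (.cell (7 + 3 * .reg 2 + .reg 16)))
      .skip (.set 17 (.reg 17 + 1))))
    (.seq (.set 18 0) (.seq (.set 19 0) (.seq (.set 11 0)
      (.seekLoop 11 5 18 17 19 20 multProg needE))))))

/-- The index of the size of the current job. -/
def sizeProg : Prog :=
  .seq (.set 12 0) (.seq (.set 11 0) (.forLoop 11 4
    (.ite (absDiff (.cell (7 + 3 * .reg 2 + .reg 3 + 2 * .reg 11)) (.cell (7 + 3 * .reg 10))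
        + absDiff (.cell (8 + 3 * .reg 2 + .reg 3 + 2 * .reg 11)) (.cell (8 + 3 * .reg 10)))
      .skip (.set 12 (.reg 11)))))

/-- The rank of the current job. -/
def rankProg : Prog :=
  .seq (.set 13 0) (.seq (.set 11 (.reg 10 + 1)) (.forLoop 11 2
    (.ite (absDiff (.cell (7 + 3 * .reg 11)) (.cell (7 + 3 * .reg 10))
        + absDiff (.cell (8 + 3 * .reg 11)) (.cell (8 + 3 * .reg 10))
        + absDiff (.cell (9 + 3 * .reg 11)) (.cell (9 + 3 * .reg 10)))
      .skip (.set 13 (.reg 13 + 1)))))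

/-- The machine of the current job. -/
def jobProg : Prog :=
  .seq sizeProg (.seq rankProg (.seq (.set 15 (.reg 6)) (.seq (.set 14 0) (.seq (.set 16 0)
    (.seq (.seekLoop 16 3 14 13 15 19 roomProg (.reg 16)) (.store (.reg 10) (.reg 15)))))))

/-- Reading the dimensions. -/
def headerProg : Prog :=
  .seq (.set 1 (.cell 2)) (.seq (.set 2 (.cell 3)) (.seq (.set 3 (.cell 4)) (.seq (.set 4 (.cell 5))
    (.seq (.set 5 (.cell 6)) (.seq (.set 7 (5 + .reg 1 + 3 * (.reg 1 * .reg 4)))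
      (.set 8 (7 + 3 * .reg 2 + .reg 3 + 2 * .reg 4)))))))

/-- A machine of speed one. -/
def hostProg : Prog :=
  .seq (.set 6 0) (.seq (.set 11 0)
    (.forLoop 11 3 (.ite (.cell (7 + 3 * .reg 2 + .reg 11)) .skip (.set 6 (.reg 11)))))

/-- The rounding algorithm. -/
def prog : Prog :=
  .seq headerProg (.seq hostProg (.seq (.set 10 0) (.forLoop 10 2 jobProg)))

/-! ### The quantities of the algorithm as functions of the memory. -/

section spec

variable (μ : ℕ → ℕ) (R n m S Lc host : ℕ)

/-- The address of a row. -/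
def row (c : ℕ) : ℕ := 7 + 3 * n + m + 2 * S + c * (5 + R + 3 * (R * S))

/-- The number of machines of the speed of machine `q` that get configuration `c`. -/
def memMult (q c : ℕ) : ℕ :=
  if μ (row R n m S c + 2) = μ (7 + 3 * n + q)
  then μ (row R n m S c + 3 + R + R * S) / μ (row R n m S c + 4 + R + R * S) else 0

/-- The room for jobs of a density and size on machines with configuration `c`. -/
def memNeed (τ c : ℕ) : ℕ :=
  μ (row R n m S c + 3 + R + τ)
    + (μ (row R n m S c + 5 + R + R * S + 2 * τ) * μ (row R n m S c + 4 + R + R * S)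
      + (μ (row R n m S c + 6 + R + R * S + 2 * τ) * μ (row R n m S c + 3 + R + R * S) - 1))
      / (μ (row R n m S c + 6 + R + R * S + 2 * τ) * μ (row R n m S c + 3 + R + R * S))

/-- The rank of a machine. -/
def memMachRank (q : ℕ) : ℕ := #{x ∈ Ico (q + 1) m | μ (7 + 3 * n + x) = μ (7 + 3 * n + q)}

/-- The room for jobs of a density and size on a machine. -/
def memRoom (τ q : ℕ) : ℕ :=
  seek (memMult μ R n m S q) (memNeed μ R n m S τ) (memMachRank μ n m q) 0 Lc

/-- The rank of a job. -/
def memJobRank (j : ℕ) : ℕ := #{x ∈ Ico (j + 1) n |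
  (μ (7 + 3 * x) = μ (7 + 3 * j) ∧ μ (8 + 3 * x) = μ (8 + 3 * j)) ∧ μ (9 + 3 * x) = μ (9 + 3 * j)}

/-- The machine of a job. -/
def memDest (idx j : ℕ) : ℕ :=
  seek (memRoom μ R n m S Lc (μ (9 + 3 * j) * S + idx)) id (memJobRank μ n j) host m

/-- The contents of registers and memory when job `j` is treated. -/
structure Ctx (j : ℕ) (s : State) : Prop where
  r1 : s.reg 1 = R
  r2 : s.reg 2 = n
  r3 : s.reg 3 = m
  r4 : s.reg 4 = S
  r5 : s.reg 5 = Lc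
  r6 : s.reg 6 = host
  r7 : s.reg 7 = 5 + R + 3 * (R * S)
  r8 : s.reg 8 = 7 + 3 * n + m + 2 * S
  r10 : s.reg 10 = j
  agree : ∀ a, j ≤ a → s.mem a = μ a

end spec

/-! ### Correctness of the subprograms. -/

section correctness

variable {μ : ℕ → ℕ} {R n m S Lc host j idx : ℕ} {s s' : State} {B M : ℕ} {Q : State → Prop}

theorem Ctx.same {T : List ℕ} (hc : Ctx μ R n m S Lc host j s) (h : SameExcept T s s')
    (hT : ∀ x ∈ [1, 2, 3, 4, 5, 6, 7, 8, 10], x ∉ T) : Ctx μ R n m S Lc host j s' where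
  r1 := by rw [h.2 1 (hT 1 (by simp)), hc.r1]
  r2 := by rw [h.2 2 (hT 2 (by simp)), hc.r2]
  r3 := by rw [h.2 3 (hT 3 (by simp)), hc.r3]
  r4 := by rw [h.2 4 (hT 4 (by simp)), hc.r4]
  r5 := by rw [h.2 5 (hT 5 (by simp)), hc.r5]
  r6 := by rw [h.2 6 (hT 6 (by simp)), hc.r6]
  r7 := by rw [h.2 7 (hT 7 (by simp)), hc.r7]
  r8 := by rw [h.2 8 (hT 8 (by simp)), hc.r8]
  r10 := by rw [h.2 10 (hT 10 (by simp)), hc.r10]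
  agree := fun a ha => by rw [h.1, hc.agree a ha]

theorem eval_rowE (hc : Ctx μ R n m S Lc host j s) {c : ℕ} (h11 : s.reg 11 = c) :
    rowE.eval s = row R n m S c := by
  simp only [rowE, eval_add, eval_mul, eval_reg, hc.r8, hc.r7, h11, row]

/-- Outputs overwrite the cells before j when job j is treated, so every address read has to be at
least j. -/
theorem lt_row (hj : j < n) (c : ℕ) : j < row R n m S c := by unfold row; omega

theorem eval_typeE (hc : Ctx μ R n m S Lc host j s) (h12 : s.reg 12 = idx) :
    typeE.eval s = μ (9 + 3 * j) * S + idx := by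
  have : 7 + 3 * j + 2 = 9 + 3 * j := by ring
  simp only [typeE, eval_add, eval_mul, eval_reg, eval_cell, eval_ofNat, hc.r10, hc.r4, h12, this]
  rw [hc.agree _ (by omega)]

theorem eval_needE (hc : Ctx μ R n m S Lc host j s) (hj : j < n) {c : ℕ} (h11 : s.reg 11 = c)
    (h12 : s.reg 12 = idx) : needE.eval s = memNeed μ R n m S (μ (9 + 3 * j) * S + idx) c := by
  have := lt_row (R := R) (m := m) (S := S) hj c
  simp only [needE, eval_add, eval_mul, eval_div, eval_sub, eval_reg, eval_cell, eval_ofNat,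
    eval_rowE hc h11, eval_typeE hc h12, hc.r1, hc.r4, memNeed]
  rw [hc.agree _ (by omega), hc.agree _ (by omega), hc.agree _ (by omega), hc.agree _ (by omega),
    hc.agree _ (by omega)]

theorem wp_multProg (hB : 1 ≤ B) (hc : Ctx μ R n m S Lc host j s) (hj : j < n) {c q : ℕ}
    (h11 : s.reg 11 = c) (h16 : s.reg 16 = q) (hlt : memMult μ R n m S q c < 2 ^ B) :
    WP B M multProg (fun s' => SameExcept [20] s s' ∧ s'.reg 20 = memMult μ R n m S q c) s := by
  have h1 := lt_row (R := R) (m := m) (S := S) hj c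
  have h2 : (absDiff (.cell (rowE + 2)) (.cell (7 + 3 * .reg 2 + .reg 16))).eval s = 0 ↔
      μ (row R n m S c + 2) = μ (7 + 3 * n + q) := by
    rw [eval_absDiff_eq_zero]
    simp only [eval_add, eval_mul, eval_reg, eval_cell, eval_ofNat, eval_rowE hc h11, hc.r2, h16]
    rw [hc.agree _ (by omega), hc.agree _ (by omega)]
  refine wp_ite hB (fun hne => ?_) fun heq => ?_
  · have h3 : memMult μ R n m S q c = 0 := if_neg fun h => hne (h2.2 h)
    refine wp_set hB (by simp) ⟨(SameExcept.refl _ _).setReg (by simp) _, ?_⟩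
    simp [h3]
  · have h3 : (.cell (rowE + 3 + .reg 1 + .reg 1 * .reg 4)
        / .cell (rowE + 4 + .reg 1 + .reg 1 * .reg 4) : Expr).eval s = memMult μ R n m S q c := by
      rw [memMult, if_pos (h2.1 heq)]
      simp only [eval_add, eval_mul, eval_div, eval_reg, eval_cell, eval_ofNat, eval_rowE hc h11,
        hc.r1, hc.r4]
      rw [hc.agree _ (by omega), hc.agree _ (by omega)]
    refine wp_set hB (by rw [h3]; exact hlt) ⟨(SameExcept.refl _ _).setReg (by simp) _, ?_⟩
    simp [h3]

theorem wp_roomProg (hB : 1 ≤ B) (hc : Ctx μ R n m S Lc host j s) (hj : j < n) {q : ℕ}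
    (h12 : s.reg 12 = idx) (h16 : s.reg 16 = q) (hq : q < m) (hmM : m ≤ M) (hLM : Lc ≤ M)
    (hmB : m < 2 ^ B) (hmult : prefixSum (memMult μ R n m S q) Lc < 2 ^ B)
    (hneed : ∀ c < Lc, memNeed μ R n m S (μ (9 + 3 * j) * S + idx) c < 2 ^ B) :
    WP B M roomProg (fun s' => SameExcept [11, 17, 18, 19, 20] s s' ∧
      s'.reg 19 = memRoom μ R n m S Lc (μ (9 + 3 * j) * S + idx) q) s := by
  refine wp_seq (wp_set hB (by simp) (wp_seq (wp_set hB ?_ (wp_seq ?_))))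
  · simp [h16]; omega
  set s₁ := (s.setReg 17 (Expr.eval s 0)).setReg 11 (Expr.eval (s.setReg 17 (Expr.eval s 0)) (.reg 16 + 1))
    with hs₁
  have hs : SameExcept [11, 17] s s₁ := ((SameExcept.refl _ _).setReg (by simp) _).setReg (by simp) _
  refine wp_count (a := q + 1) (b := m) hB (fun x => μ (7 + 3 * n + x) = μ (7 + 3 * n + q))
    (by simp) (by simp) (by simp) hq hmM ?_ ?_ ?_ ?_ ?_
  · simp [hs₁, h16]
  · simp [hs₁, hc.r3]
  · simp [hs₁]
  · intro i s₂ _ hi h h11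
    have h' : SameExcept [11, 17] s s₂ := hs.trans h (by simp)
    have hc₂ := hc.same h' (by decide)
    have h16₂ : s₂.reg 16 = q := by rw [h'.2 16 (by simp), h16]
    rw [eval_absDiff_eq_zero]
    simp only [eval_add, eval_mul, eval_reg, eval_cell, eval_ofNat, hc₂.r2, h16₂, h11]
    rw [hc₂.agree _ (by omega), hc₂.agree _ (by omega)]
  · intro s₂ h hrank
    have h' : SameExcept [11, 17] s s₂ := hs.trans h (by simp)
    refine wp_seq (wp_set hB (by simp) (wp_seq (wp_set hB (by simp) (wp_seq (wp_set hB (by simp) ?_)))))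
    set s₃ := ((s₂.setReg 18 (Expr.eval s₂ 0)).setReg 19
      (Expr.eval (s₂.setReg 18 (Expr.eval s₂ 0)) 0)).setReg 11
      (Expr.eval ((s₂.setReg 18 (Expr.eval s₂ 0)).setReg 19 (Expr.eval (s₂.setReg 18 (Expr.eval s₂ 0)) 0)) 0)
      with hs₃
    have h3 : SameExcept [11, 17, 18, 19, 20] s s₃ :=
      (((h'.trans (SameExcept.refl [11, 17, 18, 19, 20] s₂) (by simp)).setReg (by simp) _).setReg
        (by simp) _).setReg (by simp) _
    have hc₃ := hc.same h3 (by decide)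
    refine wp_seekLoop (b := Lc) (ρ := memMachRank μ n m q) (d₀ := 0) (F := memMult μ R n m S q)
      (v := memNeed μ R n m S (μ (9 + 3 * j) * S + idx)) (S := [20]) hB hLM (by simp) (by simp) (by simp)
      (by simp) (by simp) (by simp) (by simp) (by simp) (by simp) ?_ hc₃.r5 ?_ ?_ ?_ ?_ ?_ hneed hmult ?_
    · simp [hs₃]
    · simp [hs₃]
    · simpa [hs₃, memMachRank] using hrank
    · simp [hs₃]
    · intro c s₄ hcL h4 h11
      have h5 : SameExcept [11, 17, 18, 19, 20] s s₄ := h3.trans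
        (h4.trans (SameExcept.refl [11, 17, 18, 19, 20] s₄) (by simp)) (List.Subset.refl _)
      refine wp_multProg hB (hc.same h5 (by decide)) hj h11 (by rw [h5.2 16 (by simp), h16]) ?_
      have := prefixSum_mono (memMult μ R n m S q) hcL
      rw [prefixSum_succ] at this
      omega
    · intro c s₄ hcL h4 h11
      have h5 : SameExcept [11, 17, 18, 19, 20] s s₄ := h3.trans
        (h4.trans (SameExcept.refl [11, 17, 18, 19, 20] s₄) (by simp)) (List.Subset.refl _)
      exact eval_needE (hc.same h5 (by decide)) hj h11 (by rw [h5.2 12 (by simp), h12])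
    · intro s₄ h4 h19
      exact ⟨h3.trans (h4.trans (SameExcept.refl [11, 17, 18, 19, 20] s₄) (by simp))
        (List.Subset.refl _), h19⟩

theorem wp_sizeProg (hB : 1 ≤ B) (hc : Ctx μ R n m S Lc host j s) (hj : j < n) (hSM : S ≤ M)
    (hSB : S < 2 ^ B) (hidx : idx < S) (hiff : ∀ i < S, (μ (7 + 3 * n + m + 2 * i) = μ (7 + 3 * j) ∧
      μ (8 + 3 * n + m + 2 * i) = μ (8 + 3 * j)) ↔ i = idx) :
    WP B M sizeProg (fun s' => SameExcept [11, 12] s s' ∧ s'.reg 12 = idx) s := by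
  refine wp_seq (wp_set hB (by simp) (wp_seq (wp_set hB (by simp) ?_)))
  set s₁ := (s.setReg 12 (Expr.eval s 0)).setReg 11 (Expr.eval (s.setReg 12 (Expr.eval s 0)) 0) with hs₁
  have hs : SameExcept [11, 12] s s₁ := ((SameExcept.refl _ _).setReg (by simp) _).setReg (by simp) _
  -- Register 12 keeps its initial 0 until the unique matching index is passed.
  refine wp_forLoop (a := 0) (b := S) (Inv := fun i s' => SameExcept [11, 12] s s' ∧ s'.reg 11 = i ∧
    s'.reg 12 = if idx < i then idx else 0) hB (Nat.zero_le S) hSM ?_ ?_ ?_ ?_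
  · rintro i s' ⟨h1, h2, -⟩
    exact ⟨h2, (hc.same h1 (by decide)).r4⟩
  · exact ⟨hs, by simp [hs₁], by simp [hs₁]⟩
  · rintro i s' - hi ⟨h1, h2, h3⟩
    have hc' := hc.same h1 (by decide)
    have he : (absDiff (.cell (7 + 3 * .reg 2 + .reg 3 + 2 * .reg 11)) (.cell (7 + 3 * .reg 10))
        + absDiff (.cell (8 + 3 * .reg 2 + .reg 3 + 2 * .reg 11)) (.cell (8 + 3 * .reg 10))).eval s' = 0
        ↔ i = idx := by
      rw [← hiff i hi, eval_add, Nat.add_eq_zero_iff, eval_absDiff_eq_zero, eval_absDiff_eq_zero]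
      simp only [eval_add, eval_mul, eval_reg, eval_cell, eval_ofNat, hc'.r2, hc'.r3, hc'.r10, h2]
      rw [hc'.agree _ (by omega), hc'.agree _ (by omega), hc'.agree _ (by omega),
        hc'.agree _ (by omega)]
    refine wp_ite hB (fun hne => wp_skip ?_) fun heq => wp_set hB ?_ ?_
    · have : i ≠ idx := fun h => hne (he.2 h)
      refine ⟨h2, h1.setReg (by simp) _, by simp, ?_⟩
      have h4 : idx < i + 1 ↔ idx < i := by omega
      simp only [setReg_reg, h3, h4]
      simp
    · rw [eval_reg, h2]; omega
    · have : i = idx := he.1 heq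
      refine ⟨by simp [h2], (h1.setReg (by simp) _).setReg (by simp) _, by simp, ?_⟩
      simp [h2, this]
  · rintro s' ⟨h1, h2, h3⟩
    exact ⟨h1, by rw [h3, if_pos hidx]⟩

theorem wp_rankProg (hB : 1 ≤ B) (hc : Ctx μ R n m S Lc host j s) (hj : j < n) (hnM : n ≤ M)
    (hnB : n < 2 ^ B) :
    WP B M rankProg (fun s' => SameExcept [11, 13] s s' ∧ s'.reg 13 = memJobRank μ n j) s := by
  refine wp_seq (wp_set hB (by simp) (wp_seq (wp_set hB ?_ ?_)))
  · simp [hc.r10]; omega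
  set s₁ := (s.setReg 13 (Expr.eval s 0)).setReg 11 (Expr.eval (s.setReg 13 (Expr.eval s 0)) (.reg 10 + 1))
    with hs₁
  have hs : SameExcept [11, 13] s s₁ := ((SameExcept.refl _ _).setReg (by simp) _).setReg (by simp) _
  refine wp_count (a := j + 1) (b := n) hB (fun x => (μ (7 + 3 * x) = μ (7 + 3 * j) ∧
    μ (8 + 3 * x) = μ (8 + 3 * j)) ∧ μ (9 + 3 * x) = μ (9 + 3 * j))
    (by simp) (by simp) (by simp) hj hnM ?_ ?_ ?_ ?_ ?_
  · simp [hs₁, hc.r10]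
  · simp [hs₁, hc.r2]
  · simp [hs₁]
  · intro i s₂ hji hi h h11
    have h' : SameExcept [11, 13] s s₂ := hs.trans h (by simp)
    have hc₂ := hc.same h' (by decide)
    rw [eval_add, Nat.add_eq_zero_iff, eval_add, Nat.add_eq_zero_iff, eval_absDiff_eq_zero,
      eval_absDiff_eq_zero, eval_absDiff_eq_zero]
    simp only [eval_add, eval_mul, eval_reg, eval_cell, eval_ofNat, hc₂.r10, h11]
    rw [hc₂.agree _ (by omega), hc₂.agree _ (by omega), hc₂.agree _ (by omega),
      hc₂.agree _ (by omega), hc₂.agree _ (by omega), hc₂.agree _ (by omega)]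
  · intro s₂ h hrank
    exact ⟨hs.trans h (by simp), hrank⟩

theorem wp_jobProg (hB : 1 ≤ B) (hc : Ctx μ R n m S Lc host j s) (hj : j < n)
    (hM : n ≤ M ∧ m ≤ M ∧ S ≤ M ∧ Lc ≤ M) (hMB : M < 2 ^ B) (hhost : host < m)
    (hidx : idx < S) (hiff : ∀ i < S, (μ (7 + 3 * n + m + 2 * i) = μ (7 + 3 * j) ∧
      μ (8 + 3 * n + m + 2 * i) = μ (8 + 3 * j)) ↔ i = idx)
    (hmult : ∀ q < m, prefixSum (memMult μ R n m S q) Lc < 2 ^ B)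
    (hneed : ∀ c < Lc, memNeed μ R n m S (μ (9 + 3 * j) * S + idx) c < 2 ^ B)
    (hroom : prefixSum (memRoom μ R n m S Lc (μ (9 + 3 * j) * S + idx)) m < 2 ^ B) :
    WP B M jobProg (fun s' => (∀ x ∈ [1, 2, 3, 4, 5, 6, 7, 8, 10], s'.reg x = s.reg x) ∧
      s'.mem = Function.update s.mem j (memDest μ R n m S Lc host idx j)) s := by
  obtain ⟨hnM, hmM, hSM, hLM⟩ := hM
  refine wp_seq (wp_mono (wp_sizeProg hB hc hj hSM (by omega) hidx hiff) ?_)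
  rintro s₁ ⟨h1, h12⟩
  have hc₁ := hc.same h1 (by decide)
  refine wp_seq (wp_mono (wp_rankProg hB hc₁ hj hnM (by omega)) ?_)
  rintro s₂ ⟨h2, h13⟩
  have hc₂ := hc₁.same h2 (by decide)
  have h12₂ : s₂.reg 12 = idx := by rw [h2.2 12 (by simp), h12]
  refine wp_seq (wp_set hB ?_ (wp_seq (wp_set hB (by simp) (wp_seq (wp_set hB (by simp) (wp_seq ?_))))))
  · rw [eval_reg, hc₂.r6]; omega
  set s₃ := ((s₂.setReg 15 (Expr.eval s₂ (.reg 6))).setReg 14 _).setReg 16 _ with hs₃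
  have h3 : SameExcept [11, 14, 15, 16, 17, 18, 19, 20] s₂ s₃ :=
    (((SameExcept.refl _ _).setReg (by simp) _).setReg (by simp) _).setReg (by simp) _
  have hc₃ := hc₂.same h3 (by decide)
  refine wp_seekLoop (b := m) (ρ := memJobRank μ n j) (d₀ := host)
    (F := memRoom μ R n m S Lc (μ (9 + 3 * j) * S + idx)) (v := id) (S := [11, 17, 18, 19, 20]) hB hmM
    (by simp) (by simp) (by simp) (by simp) (by simp) (by simp) (by simp) (by simp) (by simp)
    ?_ hc₃.r3 ?_ ?_ ?_ ?_ ?_ (fun i hi => by simp only [id]; omega) hroom ?_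
  · simp [hs₃]
  · simp [hs₃]
  · simp [hs₃, h13]
  · simp [hs₃, hc₂.r6]
  · intro q s₄ hq h4 h16
    have hc₄ := hc₃.same h4 (by decide)
    have h12₄ : s₄.reg 12 = idx := by rw [h4.2 12 (by simp), h3.2 12 (by simp), h12₂]
    exact wp_roomProg hB hc₄ hj h12₄ h16 hq hmM hLM (by omega) (hmult q hq) hneed
  · intro q s₄ hq h4 h16
    rw [eval_reg, h16]; rfl
  · intro s₄ h4 h15
    have hc₄ := hc₃.same h4 (by decide)
    have hlt : seek (memRoom μ R n m S Lc (μ (9 + 3 * j) * S + idx)) id (memJobRank μ n j) host m < m :=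
      seek_lt le_rfl hhost
    refine wp_store hB (by rw [eval_reg, h15]; omega) ⟨?_, ?_⟩
    · have h5 : ∀ x ∈ [1, 2, 3, 4, 5, 6, 7, 8, 10], s₄.reg x = s.reg x := by
        intro x hx
        rw [h4.2 x, h3.2 x, h2.2 x, h1.2 x] <;> (fin_cases hx <;> simp)
      exact h5
    · change Function.update s₄.mem _ _ = _
      rw [eval_reg, eval_reg, hc₄.r10, h15, h4.1, h3.1, h2.1, h1.1]
      rfl

theorem wp_hostProg (hB : 1 ≤ B) (h2 : s.reg 2 = n) (h3 : s.reg 3 = m) (hmM : m ≤ M) (hmB : m < 2 ^ B)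
    (hfast : ∃ q < m, s.mem (7 + 3 * n + q) = 0) :
    WP B M hostProg (fun s' => SameExcept [6, 11] s s' ∧ s'.reg 6 < m ∧
      s.mem (7 + 3 * n + s'.reg 6) = 0) s := by
  refine wp_seq (wp_set hB (by simp) (wp_seq (wp_set hB (by simp) ?_)))
  set s₁ := (s.setReg 6 (Expr.eval s 0)).setReg 11 (Expr.eval (s.setReg 6 (Expr.eval s 0)) 0) with hs₁
  have hs : SameExcept [6, 11] s s₁ := ((SameExcept.refl _ _).setReg (by simp) _).setReg (by simp) _
  -- The property of register 6 is conditional on having passed a machine of speed one, so it holds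
  -- vacuously at the start.
  refine wp_forLoop (a := 0) (b := m) (Inv := fun i s' => SameExcept [6, 11] s s' ∧ s'.reg 11 = i ∧
    ((∃ q < i, s.mem (7 + 3 * n + q) = 0) → s'.reg 6 < m ∧ s.mem (7 + 3 * n + s'.reg 6) = 0))
    hB (Nat.zero_le m) hmM ?_ ?_ ?_ ?_
  · rintro i s' ⟨h1, h4, -⟩
    exact ⟨h4, by rw [h1.2 3 (by simp), h3]⟩
  · exact ⟨hs, by simp [hs₁], by simp⟩
  · rintro i s' - hi ⟨h1, h4, h5⟩
    have he : (Expr.cell (7 + 3 * .reg 2 + .reg 11)).eval s' = s.mem (7 + 3 * n + i) := by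
      simp only [eval_add, eval_mul, eval_reg, eval_cell, eval_ofNat, h4, h1.1, h1.2 2 (by simp), h2]
    refine wp_ite hB (fun hne => wp_skip ?_) fun heq => wp_set hB ?_ ?_
    · rw [he] at hne
      refine ⟨h4, h1.setReg (by simp) _, by simp, ?_⟩
      rintro ⟨q, hq, hq0⟩
      have hqi : q ≠ i := by rintro rfl; exact hne hq0
      simpa using h5 ⟨q, by omega, hq0⟩
    · rw [eval_reg, h4]; omega
    · rw [he] at heq
      refine ⟨by simp [h4], (h1.setReg (by simp) _).setReg (by simp) _, by simp, fun _ => ?_⟩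
      simpa [h4, heq] using hi
  · rintro s' ⟨h1, h4, h5⟩
    exact ⟨h1, h5 hfast⟩

theorem wp_prog (hB : 1 ≤ B) (hμ : s.mem = μ) (hR : μ 2 = R) (hn : μ 3 = n) (hm : μ 4 = m) (hS : μ 5 = S)
    (hLc : μ 6 = Lc) (hM : n ≤ M ∧ m ≤ M ∧ S ≤ M ∧ Lc ≤ M) (hMB : M < 2 ^ B)
    (hw : 5 + R + 3 * (R * S) < 2 ^ B) (hbase : 7 + 3 * n + m + 2 * S < 2 ^ B)
    (hfast : ∃ q < m, μ (7 + 3 * n + q) = 0) (idx : ℕ → ℕ) (hidx : ∀ j < n, idx j < S)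
    (hiff : ∀ j < n, ∀ i < S, (μ (7 + 3 * n + m + 2 * i) = μ (7 + 3 * j) ∧
      μ (8 + 3 * n + m + 2 * i) = μ (8 + 3 * j)) ↔ i = idx j)
    (hmult : ∀ q < m, prefixSum (memMult μ R n m S q) Lc < 2 ^ B)
    (hneed : ∀ τ, ∀ c < Lc, memNeed μ R n m S τ c < 2 ^ B)
    (hroom : ∀ τ, prefixSum (memRoom μ R n m S Lc τ) m < 2 ^ B) :
    WP B M prog (fun s' => ∃ host < m, μ (7 + 3 * n + host) = 0 ∧
      ∀ j < n, s'.mem j = memDest μ R n m S Lc host (idx j) j) s := by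
  intro hok
  have hlt : ∀ a, μ a < 2 ^ B := fun a => hμ ▸ hok.2 a
  have hR' := hlt 2
  have hn' := hlt 3
  have hm' := hlt 4
  have hS' := hlt 5
  have hL' := hlt 6
  revert hok
  refine wp_seq ?_
  refine wp_seq (wp_set hB (by simpa [hμ] using hR') (wp_seq (wp_set hB (by simpa [hμ] using hn')
    (wp_seq (wp_set hB (by simpa [hμ] using hm') (wp_seq (wp_set hB (by simpa [hμ] using hS')
    (wp_seq (wp_set hB (by simpa [hμ] using hL') (wp_seq (wp_set hB ?_ (wp_set hB ?_ ?_))))))))))))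
  · simpa [hμ, hR, hS] using hw
  · simpa [hμ, hn, hm, hS] using hbase
  set s₁ : State := State.setReg _ 8 _ with hs₁
  have hmem : s₁.mem = μ := by simp [hs₁, hμ]
  have r1 : s₁.reg 1 = R := by simp [hs₁, hμ, hR]
  have r2 : s₁.reg 2 = n := by simp [hs₁, hμ, hn]
  have r3 : s₁.reg 3 = m := by simp [hs₁, hμ, hm]
  have r4 : s₁.reg 4 = S := by simp [hs₁, hμ, hS]
  have r5 : s₁.reg 5 = Lc := by simp [hs₁, hμ, hLc]
  have r7 : s₁.reg 7 = 5 + R + 3 * (R * S) := by simp [hs₁, hμ, hR, hS]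
  have r8 : s₁.reg 8 = 7 + 3 * n + m + 2 * S := by simp [hs₁, hμ, hn, hm, hS]
  clear_value s₁
  refine wp_seq (wp_mono (wp_hostProg hB r2 r3 hM.2.1 (by omega) (by rw [hmem]; exact hfast)) ?_)
  rintro s₂ ⟨h2, h6, h6'⟩
  set host := s₂.reg 6 with hhost
  rw [hmem] at h6'
  refine wp_seq (wp_set hB (by simp) ?_)
  -- Cells from j on still hold the input, cells before j the answers.
  refine wp_forLoop (a := 0) (b := n) (Inv := fun j s' =>
    Ctx μ R n m S Lc host j s' ∧ ∀ j' < j, s'.mem j' = memDest μ R n m S Lc host (idx j') j')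
    hB (Nat.zero_le n) hM.1 ?_ ?_ ?_ ?_
  · rintro j s' ⟨hc, -⟩
    exact ⟨hc.r10, hc.r2⟩
  · refine ⟨⟨?_, ?_, ?_, ?_, ?_, ?_, ?_, ?_, ?_, ?_⟩, by simp⟩
    · simpa [h2.2 1 (by simp)] using r1
    · simpa [h2.2 2 (by simp)] using r2
    · simpa [h2.2 3 (by simp)] using r3
    · simpa [h2.2 4 (by simp)] using r4
    · simpa [h2.2 5 (by simp)] using r5
    · simp [hhost]
    · simpa [h2.2 7 (by simp)] using r7
    · simpa [h2.2 8 (by simp)] using r8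
    · simp
    · intro a _
      simp [h2.1, hmem]
  · rintro j s' - hj ⟨hc, hdone⟩
    refine wp_mono (wp_jobProg hB hc hj hM hMB h6 (hidx j hj) (hiff j hj) hmult
      (fun c hcL => hneed _ c hcL) (hroom _)) ?_
    rintro s₃ ⟨h3, h4⟩
    have h10 : s₃.reg 10 = j := by rw [h3 10 (by simp), hc.r10]
    refine ⟨h10, ⟨?_, ?_, ?_, ?_, ?_, ?_, ?_, ?_, ?_, ?_⟩, ?_⟩
    · simpa [h3 1 (by simp)] using hc.r1
    · simpa [h3 2 (by simp)] using hc.r2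
    · simpa [h3 3 (by simp)] using hc.r3
    · simpa [h3 4 (by simp)] using hc.r4
    · simpa [h3 5 (by simp)] using hc.r5
    · simpa [h3 6 (by simp)] using hc.r6
    · simpa [h3 7 (by simp)] using hc.r7
    · simpa [h3 8 (by simp)] using hc.r8
    · simp
    · intro a ha
      rw [setReg_mem, h4, Function.update_of_ne (by omega)]
      exact hc.agree a (by omega)
    · intro j' hj'
      rw [setReg_mem, h4, Function.update_apply]
      split_ifs with h
      · rw [h]
      · exact hdone j' (by omega)
  · rintro s' ⟨-, h⟩
    exact ⟨host, h6, h6', h⟩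

end correctness

end Rounding

/-! ### Addresses in the input -/

theorem getD_append_add {α : Type*} (l l' : List α) (o : ℕ) (d : α) :
    (l ++ l').getD (l.length + o) d = l'.getD o d := by
  rw [List.getD_append_right _ _ _ _ (Nat.le_add_right _ _), Nat.add_sub_cancel_left]

theorem length_flatMap_of_length_eq {α β : Type*} (f : α → List β) {w : ℕ} (l : List α)
    (hw : ∀ x, (f x).length = w) : (l.flatMap f).length = l.length * w := by
  induction l with
  | nil => simp
  | cons a l ih => rw [List.flatMap_cons, List.length_append, ih, hw, List.length_cons]; ring

theorem getD_flatMap {α β : Type*} (f : α → List β) {w : ℕ} (l : List α)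
    (hw : ∀ x, (f x).length = w) {c o : ℕ} (hc : c < l.length) (ho : o < w) (d : β) :
    (l.flatMap f).getD (c * w + o) d = (f l[c]).getD o d := by
  induction l generalizing c with
  | nil => simp at hc
  | cons a l ih =>
    rw [List.flatMap_cons]
    cases c with
    | zero =>
      rw [List.getD_append _ _ _ _ (by rw [hw]; omega)]
      simp
    | succ c =>
      have : (c + 1) * w + o = (f a).length + (c * w + o) := by rw [hw]; ring
      rw [this, getD_append_add, ih (by simpa using hc)]
      simp

section encoding

variable {k ℓ : ℕ} (I : BoundedInstance k ℓ) (X : Config I → ℚ)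
  (Y : Fin (yExp k ℓ + 1) → I.sizes → Config I → ℚ) (L : List (Config I))

theorem length_sizeList : (sizeList I).length = I.sizes.card := by
  unfold sizeList
  rw [length_sort, card_univ, Fintype.card_coe]

theorem length_encodeConfig (C : Config I) : (encodeConfig I X Y C).length
    = 5 + (yExp k ℓ + 1) + 3 * ((yExp k ℓ + 1) * I.sizes.card) := by
  unfold encodeConfig
  simp only [List.length_append, List.length_map, List.length_finRange, encodeInt, encodeRat,
    List.length_cons, List.length_nil]
  rw [length_flatMap_of_length_eq (w := I.sizes.card) _ _ fun r => by
      rw [List.length_map, length_sizeList],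
    length_flatMap_of_length_eq (w := I.sizes.card * 2) _ _ fun r => by
      rw [length_flatMap_of_length_eq (w := 2) _ _ fun i => rfl, length_sizeList],
    List.length_finRange]
  ring

variable {I}

theorem encodeConfig_j2 (C : Config I) : (encodeConfig I X Y C).getD 2 0 = (-C.j2).toNat := by
  unfold encodeConfig encodeInt
  simp

/-- The part of a row in front of the numbers of large jobs. -/
theorem encodeConfig_eq (C : Config I) : ∃ l₁ l₂ l₃ l₄ : List ℕ,
    encodeConfig I X Y C = l₁ ++ (l₂ ++ (l₃ ++ l₄)) ∧
    l₁.length = 3 + (yExp k ℓ + 1) ∧ l₂.length = (yExp k ℓ + 1) * I.sizes.card ∧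
    l₂ = (List.finRange (yExp k ℓ + 1)).flatMap (fun r => (sizeList I).map (C.large r)) ∧
    l₃ = encodeRat (X C) ∧
    l₄ = (List.finRange (yExp k ℓ + 1)).flatMap
        (fun r => (sizeList I).flatMap fun i => encodeRat (Y r i C)) := by
  refine ⟨encodeInt C.j1 ++ [(-C.j2).toNat] ++ (List.finRange (yExp k ℓ + 1)).map C.t, _, _, _, ?_,
    ?_, ?_, rfl, rfl, rfl⟩
  · unfold encodeConfig
    simp only [List.append_assoc]
  · simp [encodeInt]; omega
  · rw [length_flatMap_of_length_eq (w := I.sizes.card) _ _ fun r => by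
      rw [List.length_map, length_sizeList], List.length_finRange]

theorem encodeConfig_large (C : Config I) (r : Fin (yExp k ℓ + 1)) {i : ℕ}
    (hi : i < (sizeList I).length) :
    (encodeConfig I X Y C).getD (3 + (yExp k ℓ + 1) + (r * I.sizes.card + i)) 0
      = C.large r (sizeList I)[i] := by
  obtain ⟨l₁, l₂, l₃, l₄, h, h₁, h₂, h₃, -, -⟩ := encodeConfig_eq X Y C
  have hi' := hi
  rw [length_sizeList] at hi'
  have hlt : (r : ℕ) * I.sizes.card + i < l₂.length := by
    rw [h₂]; nlinarith [Nat.succ_le_of_lt r.2]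
  rw [h, ← h₁, getD_append_add, List.getD_append _ _ _ _ hlt, h₃,
    getD_flatMap (w := I.sizes.card) _ _ (fun r => by rw [List.length_map, length_sizeList]) (by simp; omega) hi']
  rw [List.getD_eq_getElem _ _ (by simpa using hi)]
  simp

theorem encodeConfig_X (C : Config I) :
    (encodeConfig I X Y C).getD (3 + (yExp k ℓ + 1) + (yExp k ℓ + 1) * I.sizes.card) 0
      = (X C).num.toNat ∧
    (encodeConfig I X Y C).getD (4 + (yExp k ℓ + 1) + (yExp k ℓ + 1) * I.sizes.card) 0
      = (X C).den := by
  obtain ⟨l₁, l₂, l₃, l₄, h, h₁, h₂, -, h₃, -⟩ := encodeConfig_eq X Y C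
  have e1 : 3 + (yExp k ℓ + 1) + (yExp k ℓ + 1) * I.sizes.card = l₁.length + (l₂.length + 0) := by
    rw [h₁, h₂]; ring
  have e2 : 4 + (yExp k ℓ + 1) + (yExp k ℓ + 1) * I.sizes.card = l₁.length + (l₂.length + 1) := by
    rw [h₁, h₂]; ring
  rw [e1, e2, h, getD_append_add, getD_append_add, getD_append_add, getD_append_add, h₃]
  simp [encodeRat]

theorem encodeConfig_Y (C : Config I) (r : Fin (yExp k ℓ + 1)) {i : ℕ}
    (hi : i < (sizeList I).length) :
    (encodeConfig I X Y C).getD (5 + (yExp k ℓ + 1) + (yExp k ℓ + 1) * I.sizes.card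
      + 2 * (r * I.sizes.card + i)) 0 = (Y r (sizeList I)[i] C).num.toNat ∧
    (encodeConfig I X Y C).getD (6 + (yExp k ℓ + 1) + (yExp k ℓ + 1) * I.sizes.card
      + 2 * (r * I.sizes.card + i)) 0 = (Y r (sizeList I)[i] C).den := by
  obtain ⟨l₁, l₂, l₃, l₄, h, h₁, h₂, -, h₃, h₄⟩ := encodeConfig_eq X Y C
  have hi' := hi
  rw [length_sizeList] at hi'
  have h₅ : l₃.length = 2 := by rw [h₃]; rfl
  have key : ∀ o < 2, (encodeConfig I X Y C).getD (5 + o + (yExp k ℓ + 1)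
      + (yExp k ℓ + 1) * I.sizes.card + 2 * (r * I.sizes.card + i)) 0
      = (encodeRat (Y r (sizeList I)[i] C)).getD o 0 := by
    intro o ho
    have e1 : 5 + o + (yExp k ℓ + 1) + (yExp k ℓ + 1) * I.sizes.card + 2 * (r * I.sizes.card + i)
        = l₁.length + (l₂.length + (l₃.length + (r * (I.sizes.card * 2) + (i * 2 + o)))) := by
      rw [h₁, h₂, h₅]; ring
    rw [e1, h, getD_append_add, getD_append_add, getD_append_add, h₄,
      getD_flatMap (w := I.sizes.card * 2) _ _ (fun r => by
        rw [length_flatMap_of_length_eq (w := 2) _ _ fun i => rfl, length_sizeList]) (by simp; omega) (by omega),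
      getD_flatMap (w := 2) _ _ (fun i => rfl) hi ho]
    simp
  exact ⟨key 0 (by norm_num), key 1 (by norm_num)⟩

theorem encodeInput_eq : ∃ l₀ l₁ l₂ l₃ l₄ : List ℕ,
    encodeInput I X Y L = l₀ ++ (l₁ ++ (l₂ ++ (l₃ ++ l₄))) ∧
    l₀ = [k, ℓ, yExp k ℓ + 1, I.n, I.m, I.sizes.card, L.length] ∧
    l₁ = (List.finRange I.n).flatMap (fun j => encodeInt (I.sizeExp j) ++ [(I.densExp j : ℕ)]) ∧
    l₁.length = I.n * 3 ∧ l₂ = (List.finRange I.m).map I.slowExp ∧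
    l₂.length = I.m ∧ l₃ = (sizeList I).flatMap (fun i : I.sizes => encodeInt (i : ℤ)) ∧
    l₃.length = I.sizes.card * 2 ∧ l₄ = L.flatMap (encodeConfig I X Y) ∧
    l₄.length = L.length * (5 + (yExp k ℓ + 1) + 3 * ((yExp k ℓ + 1) * I.sizes.card)) := by
  refine ⟨_, _, _, _, _, ?_, rfl, rfl, ?_, rfl, ?_, rfl, ?_, rfl, ?_⟩
  · unfold encodeInput
    simp only [List.append_assoc, List.bind_eq_flatMap, List.pure_def, List.flatMap_assoc,
      List.flatMap_singleton]
  · rw [length_flatMap_of_length_eq (w := 3) _ _ fun j => rfl, List.length_finRange]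
  · simp
  · rw [length_flatMap_of_length_eq (w := 2) _ _ fun j => rfl, length_sizeList]
  · rw [length_flatMap_of_length_eq _ _ (length_encodeConfig I X Y)]

theorem encodeInput_header : (encodeInput I X Y L).getD 2 0 = yExp k ℓ + 1 ∧
    (encodeInput I X Y L).getD 3 0 = I.n ∧ (encodeInput I X Y L).getD 4 0 = I.m ∧
    (encodeInput I X Y L).getD 5 0 = I.sizes.card ∧ (encodeInput I X Y L).getD 6 0 = L.length := by
  obtain ⟨l₀, l₁, l₂, l₃, l₄, h, h₀, -⟩ := encodeInput_eq X Y L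
  rw [h, h₀]
  simp

theorem encodeInput_job (j : Fin I.n) :
    (encodeInput I X Y L).getD (7 + 3 * j) 0 = (I.sizeExp j).toNat ∧
    (encodeInput I X Y L).getD (8 + 3 * j) 0 = (-I.sizeExp j).toNat ∧
    (encodeInput I X Y L).getD (9 + 3 * j) 0 = I.densExp j := by
  obtain ⟨l₀, l₁, l₂, l₃, l₄, h, h₀, h₁, h₁', -⟩ := encodeInput_eq X Y L
  have h₀' : l₀.length = 7 := by rw [h₀]; rfl
  have key : ∀ o < 3, (encodeInput I X Y L).getD (7 + o + 3 * j) 0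
      = (encodeInt (I.sizeExp j) ++ [(I.densExp j : ℕ)]).getD o 0 := by
    intro o ho
    have e : 7 + o + 3 * (j : ℕ) = l₀.length + (j * 3 + o) := by rw [h₀']; ring
    have hlt : (j : ℕ) * 3 + o < l₁.length := by rw [h₁']; omega
    rw [e, h, getD_append_add, List.getD_append _ _ _ _ hlt, h₁,
      getD_flatMap (w := 3) _ _ (fun j => rfl) (by simp) ho]
    simp
  exact ⟨key 0 (by norm_num), key 1 (by norm_num), key 2 (by norm_num)⟩

theorem encodeInput_machine (q : Fin I.m) :
    (encodeInput I X Y L).getD (7 + 3 * I.n + q) 0 = I.slowExp q := by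
  obtain ⟨l₀, l₁, l₂, l₃, l₄, h, h₀, -, h₁', h₂, h₂', -⟩ := encodeInput_eq X Y L
  have h₀' : l₀.length = 7 := by rw [h₀]; rfl
  have e : 7 + 3 * I.n + (q : ℕ) = l₀.length + (l₁.length + q) := by rw [h₀', h₁']; ring
  have hlt : (q : ℕ) < l₂.length := by rw [h₂']; exact q.2
  rw [e, h, getD_append_add, getD_append_add, List.getD_append _ _ _ _ hlt,
    List.getD_eq_getElem _ _ hlt]
  simp [h₂]

theorem encodeInput_size {i : ℕ} (hi : i < (sizeList I).length) :
    (encodeInput I X Y L).getD (7 + 3 * I.n + I.m + 2 * i) 0 = ((sizeList I)[i] : ℤ).toNat ∧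
    (encodeInput I X Y L).getD (8 + 3 * I.n + I.m + 2 * i) 0 = (-((sizeList I)[i] : ℤ)).toNat := by
  obtain ⟨l₀, l₁, l₂, l₃, l₄, h, h₀, -, h₁', -, h₂', h₃, h₃', -⟩ := encodeInput_eq X Y L
  have h₀' : l₀.length = 7 := by rw [h₀]; rfl
  have hi' := hi
  rw [length_sizeList] at hi'
  have key : ∀ o < 2, (encodeInput I X Y L).getD (7 + o + 3 * I.n + I.m + 2 * i) 0
      = (encodeInt ((sizeList I)[i] : ℤ)).getD o 0 := by
    intro o ho
    have e : 7 + o + 3 * I.n + I.m + 2 * i = l₀.length + (l₁.length + (l₂.length + (i * 2 + o))) := by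
      rw [h₀', h₁', h₂']; ring
    have hlt : i * 2 + o < l₃.length := by rw [h₃']; omega
    rw [e, h, getD_append_add, getD_append_add, getD_append_add, List.getD_append _ _ _ _ hlt, h₃,
      getD_flatMap (w := 2) _ _ (fun j => rfl) hi ho]
  exact ⟨key 0 (by norm_num), key 1 (by norm_num)⟩

theorem encodeInput_row {c o : ℕ} (hc : c < L.length)
    (ho : o < 5 + (yExp k ℓ + 1) + 3 * ((yExp k ℓ + 1) * I.sizes.card)) :
    (encodeInput I X Y L).getD (Rounding.row (yExp k ℓ + 1) I.n I.m I.sizes.card c + o) 0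
      = (encodeConfig I X Y L[c]).getD o 0 := by
  obtain ⟨l₀, l₁, l₂, l₃, l₄, h, h₀, -, h₁', -, h₂', -, h₃', h₄, -⟩ := encodeInput_eq X Y L
  have h₀' : l₀.length = 7 := by rw [h₀]; rfl
  have e : Rounding.row (yExp k ℓ + 1) I.n I.m I.sizes.card c + o
      = l₀.length + (l₁.length + (l₂.length + (l₃.length
        + (c * (5 + (yExp k ℓ + 1) + 3 * ((yExp k ℓ + 1) * I.sizes.card)) + o)))) := by
    rw [h₀', h₁', h₂', h₃', Rounding.row]; ring
  rw [e, h, getD_append_add, getD_append_add, getD_append_add, getD_append_add, h₄,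
    getD_flatMap _ _ (length_encodeConfig I X Y) hc ho]

theorem length_encodeInput : (encodeInput I X Y L).length = 7 + 3 * I.n + I.m + 2 * I.sizes.card
    + L.length * (5 + (yExp k ℓ + 1) + 3 * ((yExp k ℓ + 1) * I.sizes.card)) := by
  obtain ⟨l₀, l₁, l₂, l₃, l₄, h, h₀, -, h₁', -, h₂', -, h₃', -, h₄'⟩ := encodeInput_eq X Y L
  rw [h]
  simp only [List.length_append, h₁', h₂', h₃', h₄', h₀, List.length_cons, List.length_nil]
  ring

end encoding

theorem length_le_bitLength (l : List ℕ) : l.length ≤ bitLength l := by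
  unfold bitLength
  induction l with
  | nil => simp
  | cons a l ih => simp only [List.length_cons, List.map_cons, List.sum_cons]; omega

theorem getD_lt_two_pow (l : List ℕ) (a : ℕ) : l.getD a 0 < 2 ^ bitLength l := by
  have hmem : ∀ x ∈ l, x < 2 ^ bitLength l := by
    intro x hx
    refine Nat.size_le.1 ?_
    have := List.single_le_sum (l := l.map fun a => Nat.size a + 1) (fun _ _ => Nat.zero_le _)
      (Nat.size x + 1) (List.mem_map.2 ⟨x, hx, rfl⟩)
    unfold bitLength
    omega
  by_cases h : a < l.length
  · rw [List.getD_eq_getElem _ _ h]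
    exact hmem _ (List.getElem_mem h)
  · rw [List.getD_eq_default _ _ (by omega)]
    positivity

/-! ### Rational numbers -/

theorem ratCast_eq_div {x : ℚ} (hx : 0 ≤ x) : (x : ℝ) = (x.num.toNat : ℝ) / (x.den : ℝ) := by
  have h1 : ((x.num.toNat : ℤ) : ℝ) = (x.num : ℝ) := by
    rw [Int.toNat_of_nonneg (Rat.num_nonneg.2 hx)]
  rw [Int.cast_natCast] at h1
  rw [h1, Rat.cast_def]

theorem floor_ratCast {x : ℚ} (hx : 0 ≤ x) : ⌊(x : ℝ)⌋₊ = x.num.toNat / x.den := by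
  rw [ratCast_eq_div hx, Nat.floor_div_eq_div]

/-- Division by zero gives 0 on both sides, so the case X = 0 needs no test in the program. -/
theorem ceil_natCast_div (a b : ℕ) : ⌈(a : ℝ) / b⌉₊ = (a + (b - 1)) / b := by
  rcases Nat.eq_zero_or_pos b with rfl | hb
  · simp
  · have hb' : (0 : ℝ) < b := by exact_mod_cast hb
    refine eq_of_forall_ge_iff fun c => ?_
    rw [Nat.ceil_le, div_le_iff₀ hb', Nat.div_le_iff_le_mul_add_pred hb]
    norm_cast
    rw [mul_comm c b]
    omega

theorem ceil_ratCast_div {x y : ℚ} (hx : 0 ≤ x) (hy : 0 ≤ y) : ⌈(y : ℝ) / (x : ℝ)⌉₊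
    = (y.num.toNat * x.den + (y.den * x.num.toNat - 1)) / (y.den * x.num.toNat) := by
  rw [ratCast_eq_div hx, ratCast_eq_div hy, div_div_div_eq, ← ceil_natCast_div]
  push_cast
  rfl

theorem seek_congr {f f' v v' : ℕ → ℕ} {t d n : ℕ} (hf : ∀ x < n, f x = f' x)
    (hv : ∀ x < n, v x = v' x) : seek f v t d n = seek f' v' t d n := by
  induction n with
  | zero => rfl
  | succ n ih =>
    have h : prefixSum f n = prefixSum f' n :=
      sum_congr rfl fun x hx => hf x ((mem_range.1 hx).trans (Nat.lt_succ_self n))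
    rw [seek, seek, h, hf n (Nat.lt_succ_self n), hv n (Nat.lt_succ_self n),
      ih (fun x hx => hf x (hx.trans (Nat.lt_succ_self n)))
        fun x hx => hv x (hx.trans (Nat.lt_succ_self n))]

theorem card_filter_Ico_eq {n : ℕ} (a : Fin n) (p : ℕ → Prop) (p' : Fin n → Prop)
    [DecidablePred p] [DecidablePred p'] (h : ∀ x : Fin n, p x ↔ p' x) :
    #{x ∈ Ico ((a : ℕ) + 1) n | p x} = #{x | a < x ∧ p' x} := by
  symm
  refine card_bij (fun x _ => (x : ℕ)) ?_ (fun _ _ _ _ => Fin.ext) ?_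
  · intro x hx
    simp only [mem_filter, mem_univ, true_and, mem_Ico] at hx ⊢
    exact ⟨⟨hx.1, x.2⟩, (h x).2 hx.2⟩
  · intro x hx
    simp only [mem_filter, mem_Ico] at hx
    refine ⟨⟨x, hx.1.2⟩, ?_, rfl⟩
    simp only [mem_filter, mem_univ, true_and]
    exact ⟨hx.1.1, (h ⟨x, hx.1.2⟩).1 hx.2⟩

theorem prefixSum_le_mul {f : ℕ → ℕ} {n b : ℕ} (h : ∀ x < n, f x ≤ b) : prefixSum f n ≤ n * b := by
  have := sum_le_card_nsmul (range n) f b fun x hx => h x (mem_range.1 hx)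
  simpa [prefixSum] using this

theorem toNat_pair_eq_iff (a b : ℤ) :
    (a.toNat = b.toNat ∧ (-a).toNat = (-b).toNat) ↔ a = b := by omega

namespace Rounding
open BoundedInstance

/-! ### The program computes the rounding defined above. -/

section link

variable {k ℓ : ℕ} {I : BoundedInstance k ℓ} (X : Config I → ℚ)
  (Y : Fin (yExp k ℓ + 1) → I.sizes → Config I → ℚ) (L : List (Config I))

theorem memMult_encodeInput (hsub : ∀ C ∈ L, C ∈ configs I) (hX : ∀ C ∈ configs I, 0 ≤ X C)
    (q : Fin I.m) {c : ℕ} (hc : c < L.length) :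
    memMult (initState (encodeInput I X Y L)).mem (yExp k ℓ + 1) I.n I.m I.sizes.card q c
      = extend (copies (fun C => (X C : ℝ)) L (-(I.slowExp q : ℤ))) c := by
  have hC := hsub _ (List.getElem_mem hc)
  -- Since j2 is minus a natural number, the truncation in its encoding loses nothing and comparing
  -- encodings compares speeds.
  obtain ⟨q', hq'⟩ := ((finite_valid I).mem_toFinset.1 hC).j2_mem
  obtain ⟨h1, h2⟩ := encodeConfig_X X Y L[c]
  rw [extend_of_lt _ hc]
  unfold memMult copies
  simp only [initState, add_assoc (row _ _ _ _ _)]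
  rw [encodeInput_row X Y L hc (by omega), encodeInput_row X Y L hc (by ring_nf; omega),
    encodeInput_row X Y L hc (by ring_nf; omega), encodeInput_machine, encodeConfig_j2]
  rw [h1, h2, List.get_eq_getElem, floor_ratCast (hX _ hC), hq']
  congr 1
  simp only [eq_iff_iff]
  omega

theorem memNeed_encodeInput (hsub : ∀ C ∈ L, C ∈ configs I) (hX : ∀ C ∈ configs I, 0 ≤ X C)
    (hY : ∀ r i, ∀ C ∈ configs I, 0 ≤ Y r i C) (r : Fin (yExp k ℓ + 1)) {i : ℕ}
    (hi : i < (sizeList I).length) {c : ℕ} (hc : c < L.length) :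
    memNeed (initState (encodeInput I X Y L)).mem (yExp k ℓ + 1) I.n I.m I.sizes.card (r * I.sizes.card + i) c
      = extend (fun c => need (fun C => (X C : ℝ)) (fun r i C => (Y r i C : ℝ)) (L.get c) r
          (sizeList I)[i]) c := by
  have hC := hsub _ (List.getElem_mem hc)
  have hi' := hi
  rw [length_sizeList] at hi'
  have hlt : (r : ℕ) * I.sizes.card + i < (yExp k ℓ + 1) * I.sizes.card := by
    nlinarith [Nat.succ_le_of_lt r.2]
  obtain ⟨h1, h2⟩ := encodeConfig_X X Y L[c]
  obtain ⟨h3, h4⟩ := encodeConfig_Y X Y L[c] r hi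
  have h5 := encodeConfig_large X Y L[c] r hi
  rw [extend_of_lt _ hc]
  unfold memNeed need
  simp only [initState, add_assoc (row _ _ _ _ _)]
  rw [encodeInput_row X Y L hc (by omega), encodeInput_row X Y L hc (by omega),
    encodeInput_row X Y L hc (by omega), encodeInput_row X Y L hc (by omega),
    encodeInput_row X Y L hc (by omega), h1, h2, h3, h4, h5, List.get_eq_getElem,
    ceil_ratCast_div (hX _ hC) (hY _ _ _ hC)]

theorem memMachRank_encodeInput (q : Fin I.m) : memMachRank (initState (encodeInput I X Y L)).mem I.n I.m q = machRank q := by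
  refine card_filter_Ico_eq q _ _ fun x => ?_
  simp only [initState, encodeInput_machine]

theorem memJobRank_encodeInput (j : Fin I.n) : memJobRank (initState (encodeInput I X Y L)).mem I.n j = jobRank j := by
  refine card_filter_Ico_eq j _ _ fun x => ?_
  obtain ⟨h1, h2, h3⟩ := encodeInput_job X Y L x
  obtain ⟨h4, h5, h6⟩ := encodeInput_job X Y L j
  simp only [initState, h1, h2, h3, h4, h5, h6, toNat_pair_eq_iff, Fin.val_inj]
  exact and_comm

/-- The position of the size of a job. -/
def sizePos (j : Fin I.n) : ℕ := (sizeList I).idxOf (I.sizeIdx j)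

theorem sizePos_lt (j : Fin I.n) : sizePos j < (sizeList I).length :=
  List.idxOf_lt_length_of_mem ((mem_sort _).2 (mem_univ _))

theorem getElem_sizeList_eq_iff (j : Fin I.n) {i : ℕ} (hi : i < (sizeList I).length) :
    (sizeList I)[i] = I.sizeIdx j ↔ i = sizePos j := by
  have h : (sizeList I)[sizePos j]'(sizePos_lt j) = I.sizeIdx j := List.getElem_idxOf _
  rw [← h]
  exact (sort_nodup _ _).getElem_inj_iff

theorem memDest_encodeInput (hsub : ∀ C ∈ L, C ∈ configs I) (hX : ∀ C ∈ configs I, 0 ≤ X C)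
    (hY : ∀ r i, ∀ C ∈ configs I, 0 ≤ Y r i C) (host : Fin I.m) (j : Fin I.n) :
    memDest (initState (encodeInput I X Y L)).mem (yExp k ℓ + 1) I.n I.m I.sizes.card L.length host (sizePos j) j
      = fillRooms (room (fun C => (X C : ℝ)) (fun r i C => (Y r i C : ℝ)) L) host j := by
  unfold memDest fillRooms
  rw [memJobRank_encodeInput]
  refine seek_congr (fun q hq => ?_) fun _ _ => rfl
  rw [extend_of_lt _ hq, room_eq_seek, memRoom,
    show (initState (encodeInput I X Y L)).mem (9 + 3 * j) = I.densExp j from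
      (encodeInput_job X Y L j).2.2]
  rw [memMachRank_encodeInput X Y L ⟨q, hq⟩]
  refine seek_congr (fun c hc => memMult_encodeInput X Y L hsub hX ⟨q, hq⟩ hc) fun c hc => ?_
  rw [memNeed_encodeInput X Y L hsub hX hY _ (sizePos_lt j) hc,
    (getElem_sizeList_eq_iff j (sizePos_lt j)).2 rfl]

end link

/-! ### Bounds for the numbers that occur. -/

section bounds

variable {μ : ℕ → ℕ} {R n m S Lc b : ℕ}

theorem memMult_lt (hμ : ∀ a, μ a < 2 ^ b) (q c : ℕ) : memMult μ R n m S q c < 2 ^ b := by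
  unfold memMult
  split_ifs
  · exact (Nat.div_le_self _ _).trans_lt (hμ _)
  · positivity

theorem memNeed_lt (hμ : ∀ a, μ a < 2 ^ b) (τ c : ℕ) : memNeed μ R n m S τ c < 2 ^ (2 * b + 2) := by
  unfold memNeed
  refine (Nat.add_le_add_left (Nat.div_le_self _ _) _).trans_lt ?_
  have hmul : ∀ a a', μ a * μ a' < 2 ^ (2 * b) := fun a a' => by
    rw [two_mul, pow_add]; exact Nat.mul_lt_mul'' (hμ a) (hμ a')
  have h1 := hmul (row R n m S c + 5 + R + R * S + 2 * τ) (row R n m S c + 4 + R + R * S)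
  have h2 := hmul (row R n m S c + 6 + R + R * S + 2 * τ) (row R n m S c + 3 + R + R * S)
  have h3 := hμ (row R n m S c + 3 + R + τ)
  have h4 : 2 ^ b ≤ 2 ^ (2 * b) := Nat.pow_le_pow_right (by norm_num) (by omega)
  rw [pow_add]
  omega

theorem prefixSum_memMult_lt (hμ : ∀ a, μ a < 2 ^ b) (hLc : Lc ≤ b) (q : ℕ) :
    prefixSum (memMult μ R n m S q) Lc < 2 ^ (3 * b + 10) := by
  have h := prefixSum_le_mul (n := Lc) fun c _ => (memMult_lt (R := R) (n := n) (m := m) (S := S) hμ q c).le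
  have h1 : Lc < 2 ^ b := hLc.trans_lt Nat.lt_two_pow_self
  calc _ ≤ Lc * 2 ^ b := h
    _ < 2 ^ b * 2 ^ b := Nat.mul_lt_mul_of_pos_right h1 (by positivity)
    _ ≤ _ := by rw [← pow_add]; exact Nat.pow_le_pow_right (by norm_num) (by omega)

theorem prefixSum_memRoom_lt (hμ : ∀ a, μ a < 2 ^ b) (hm : m ≤ b) (τ : ℕ) :
    prefixSum (memRoom μ R n m S Lc τ) m < 2 ^ (3 * b + 10) := by
  have h := prefixSum_le_mul (f := memRoom μ R n m S Lc τ) (n := m) (b := 2 ^ (2 * b + 2))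
    fun q _ => by
      unfold memRoom
      rcases seek_cases (memMult μ R n m S q) (memNeed μ R n m S τ) (memMachRank μ n m q) 0 Lc with
        ⟨c, -, -, -, h⟩ | ⟨-, h⟩ <;> rw [h]
      · exact (memNeed_lt hμ τ c).le
      · positivity
  have h1 : m < 2 ^ b := hm.trans_lt Nat.lt_two_pow_self
  calc _ ≤ m * 2 ^ (2 * b + 2) := h
    _ < 2 ^ b * 2 ^ (2 * b + 2) := Nat.mul_lt_mul_of_pos_right h1 (by positivity)
    _ ≤ _ := by rw [← pow_add]; exact Nat.pow_le_pow_right (by norm_num) (by omega)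

end bounds

/-- The stored program rounds an encoded solution. -/
theorem exists_exec {k ℓ : ℕ} {I : BoundedInstance k ℓ} (X : Config I → ℚ)
    (Y : Fin (yExp k ℓ + 1) → I.sizes → Config I → ℚ) (L : List (Config I))
    (hsub : ∀ C ∈ L, C ∈ configs I) (hX : ∀ C ∈ configs I, 0 ≤ X C)
    (hY : ∀ r i, ∀ C ∈ configs I, 0 ≤ Y r i C) :
    ∃ (time : ℕ) (final : State) (host : Fin I.m),
      Exec prog (initState (encodeInput I X Y L)) time final ∧
      time ≤ prog.stepBound (bitLength (encodeInput I X Y L))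
        * (3 * bitLength (encodeInput I X Y L) + 11) ∧ I.slowExp host = 0 ∧
      ∀ j : Fin I.n, final.mem j
        = fillRooms (room (fun C => (X C : ℝ)) (fun r i C => (Y r i C : ℝ)) L) host j := by
  have hlen := length_encodeInput X Y L
  have hle := length_le_bitLength (encodeInput I X Y L)
  have hlt : ∀ a, (initState (encodeInput I X Y L)).mem a < 2 ^ bitLength (encodeInput I X Y L) :=
    getD_lt_two_pow _
  obtain ⟨h2, h3, h4, h5, h6⟩ := encodeInput_header X Y L
  set b := bitLength (encodeInput I X Y L) with hb
  -- Every listed configuration occupies a nonempty row of the input.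
  have hLc : L.length ≤ b := by
    have : L.length * 1 ≤ L.length * (5 + (yExp k ℓ + 1) + 3 * ((yExp k ℓ + 1) * I.sizes.card)) :=
      Nat.mul_le_mul_left _ (by omega)
    omega
  have hpow : b < 2 ^ b := Nat.lt_two_pow_self
  have hmono : ∀ e, e ≤ 3 * b + 10 → 2 ^ e ≤ 2 ^ (3 * b + 10) :=
    fun e he => Nat.pow_le_pow_right (by norm_num) he
  have hbB := hmono b (by omega)
  have hR : yExp k ℓ + 1 < 2 ^ b := h2 ▸ hlt 2
  have hS : I.sizes.card < 2 ^ b := h5 ▸ hlt 5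
  have hRS : (yExp k ℓ + 1) * I.sizes.card < 2 ^ b * 2 ^ b := Nat.mul_lt_mul'' hR hS
  -- The exponent 3b + 10 leaves room for a sum of at most b rooms of 2b+2 bits each and for all
  -- addresses computed in the header.
  have hBw : 2 ^ b * 2 ^ b * 2 ^ b * 1024 = 2 ^ (3 * b + 10) := by ring
  have h1b : 1 ≤ 2 ^ b := Nat.one_le_two_pow
  have hw2 : 2 ^ b ≤ 2 ^ b * 2 ^ b := Nat.le_mul_of_pos_left _ h1b
  have hw3 : 2 ^ b * 2 ^ b ≤ 2 ^ b * 2 ^ b * 2 ^ b := Nat.le_mul_of_pos_right _ h1b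
  obtain ⟨t, s', hexec, ht, -, host, hhost, hhost0, hdest⟩ :=
    wp_prog (s := initState (encodeInput I X Y L)) (B := 3 * b + 10) (M := b)
      (μ := (initState (encodeInput I X Y L)).mem) (by omega) rfl h2 h3 h4 h5 h6
      ⟨by omega, by omega, by omega, hLc⟩ (by omega) (by omega) (by omega)
      (by
        obtain ⟨q, hq⟩ := I.fastest
        exact ⟨q, q.2, (encodeInput_machine X Y L q).trans hq⟩)
      (fun j => if h : j < I.n then sizePos ⟨j, h⟩ else 0)
      (fun j hj => by
        rw [dif_pos hj, ← length_sizeList]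
        exact sizePos_lt _)
      (fun j hj i hi => by
        rw [← length_sizeList] at hi
        rw [dif_pos hj, ← getElem_sizeList_eq_iff ⟨j, hj⟩ hi]
        obtain ⟨e1, e2⟩ := encodeInput_size X Y L hi
        obtain ⟨e3, e4, -⟩ := encodeInput_job X Y L ⟨j, hj⟩
        simp only [initState, e1, e2, e3, e4, toNat_pair_eq_iff]
        exact (Subtype.ext_iff (a2 := I.sizeIdx ⟨j, hj⟩)).symm)
      (fun q _ => prefixSum_memMult_lt hlt hLc q)
      (fun τ c _ => (memNeed_lt hlt τ c).trans_le (hmono _ (by omega)))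
      (fun τ => prefixSum_memRoom_lt hlt (by omega) τ)
      ⟨fun x => by
        show (if x = 0 then _ else 0) < _
        split_ifs <;> omega, fun a => (hlt a).trans_le hbB⟩
  refine ⟨t, s', ⟨host, hhost⟩, hexec, ht, ?_, fun j => ?_⟩
  · rw [← encodeInput_machine X Y L ⟨host, hhost⟩]
    exact hhost0
  · rw [hdest j j.2, dif_pos j.2]
    exact memDest_encodeInput X Y L hsub hX hY ⟨host, hhost⟩ j

end Rounding

end

end WeightedScheduling

/-! ### The theorem. -/

open WeightedScheduling in
theorem mainTheorem3 :
    (∀ (k ℓ : ℕ), 8 ≤ k → 3 ≤ ℓ → ℓ ≤ 5 →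
      ∀ (I : BoundedInstance k ℓ) (X : Config I → ℝ)
        (Y : Fin (yExp k ℓ + 1) → I.sizes → Config I → ℝ),
        IsOptimal I X Y →
          ∃ σ : I.Schedule, I.schedCost σ ≤ (1 + delta k) * objective I X Y)
    ∧ ∃ (P : Prog) (poly : Polynomial ℕ), ∀ (k ℓ : ℕ), 8 ≤ k → 3 ≤ ℓ → ℓ ≤ 5 →
      ∀ (I : BoundedInstance k ℓ) (X : Config I → ℚ)
        (Y : Fin (yExp k ℓ + 1) → I.sizes → Config I → ℚ),
        IsOptimal I (fun C => (X C : ℝ)) (fun r i C => (Y r i C : ℝ)) →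
        ∀ L : List (Config I), L.Nodup → (∀ C ∈ L, C ∈ configs I) →
          (∀ C ∈ configs I, X C ≠ 0 → C ∈ L) →
          ∃ (time : ℕ) (final : State) (σ : I.Schedule),
            Exec P (initState (encodeInput I X Y L)) time final ∧
            time ≤ poly.eval (bitLength (encodeInput I X Y L)) ∧
            (∀ j : Fin I.n, final.mem (j : ℕ) = (σ j : ℕ)) ∧
            I.schedCost σ
              ≤ (1 + delta k) * objective I (fun C => (X C : ℝ)) (fun r i C => (Y r i C : ℝ)) := by
  refine ⟨fun k ℓ hk _ hℓ I X Y hopt => ?_, ?_⟩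
  · obtain ⟨host, hhost⟩ := I.fastest
    -- For mere existence all configurations can be listed.
    exact ⟨_, BoundedInstance.schedCost_fillRooms_le (L := (configs I).toList) hopt.1
      (Finset.nodup_toList _) (fun C => Finset.mem_toList.1) (fun C hC _ => Finset.mem_toList.2 hC)
      hk hℓ hhost⟩
  · obtain ⟨p, hp⟩ := Prog.exists_stepPoly Rounding.prog
    -- Steps times cost per step: with N bits of input, loops have at most N rounds and numbers at
    -- most B = 3N + 10 bits, so the cost per step is B + 1.
    refine ⟨Rounding.prog, p * (Polynomial.C 3 * Polynomial.X + Polynomial.C 11), ?_⟩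
    intro k ℓ hk _ hℓ I X Y hopt L hnodup hsub hall
    obtain ⟨t, s, host, hexec, ht, hhost, hdest⟩ := Rounding.exists_exec X Y L hsub
      (fun C hC => by exact_mod_cast hopt.1.X_nonneg C hC)
      (fun r i C hC => by exact_mod_cast hopt.1.Y_nonneg r i C hC)
    refine ⟨t, s, _, hexec, ?_, hdest, BoundedInstance.schedCost_fillRooms_le hopt.1 hnodup hsub
      (fun C hC h => hall C hC fun h' => h (by simp [h'])) hk hℓ hhost⟩
    rw [Polynomial.eval_mul, Polynomial.eval_add, Polynomial.eval_mul, Polynomial.eval_C,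
      Polynomial.eval_X, Polynomial.eval_C, hp]
    exact ht
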